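/- Let $-3<\gamma<0$, $\langle v\rangle=(1+|v|^2)^{1/2}$, $\mu(v)=(2\pi)^{-3/2}e^{-|v|^2/2}$ and $a_{jk}(v)=(\delta_{jk}|v|^2-v_jv_k)|v|^\gamma$ on $\mathbb R^3$. Let $$Q(G,F)(v)=\sum_{j,k=1}^3\partial_j\int_{\mathbb R^3}a_{jk}(v-v_*)\big[G(v_*)\partial_kF(v)-\partial_kG(v_*)F(v)\big]\,dv_*,$$ $$\Gamma(f,g)=\mu^{-1/2}Q(\sqrt\mu f,\sqrt\mu g),\qquad \mathcal L_1f=-\Gamma(\sqrt\mu,f),\qquad \mathcal L_2f=-\Gamma(f,\sqrt\mu).$$ Let $A_{+,k}=\frac{v_k}2-\partial_{v_k}$ and $\nabla_{\mathcal H_+}=(A_{+,1},A_{+,2},A_{+,3})$; $\nabla_{\mathcal H_+}^mf$ is the tensor with components $A_{+,i_1}\cdots A_{+,i_m}f$, $(i_1,\dots,i_m)\in\{1,2,3\}^m$; operators, and multiplication by functions, act on tensors componentwise, and $L^2$ inner products and squared norms of tensors are summed over all components. Put $\|f\|_{2,r}=\|\langle\cdot\rangle^rf\|_{L^2(\mathbb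 R^3)}$ and, with $\bar a_{jk}=a_{jk}*\mu$, $$\|f\|_A^2=\sum_{j,k=1}^3\int_{\mathbb R^3}\Big(\bar a_{jk}\,\partial_jf\,\partial_kf+\tfrac14\bar a_{jk}v_jv_kf^2\Big)dv.$$ For $c_0>0$, $0<b\le2$ and $t\ge0$ let $\omega_t(v)=\exp\big(\frac{c_0}{1+t}\langle v\rangle^b\big)$. There is a constant $\kappa>0$ depending only on $\gamma$ such that for all $0<b\le2$ and $c_0>0$ there are positive constants $C_4,C_5,C_6,C_7$, depending only on $\gamma,b,c_0$, such that for all integers $m\ge1$, all $t\ge0$ and all real-valued $f$ on $\mathbb R^3$ such that $\omega_tf$ is a Schwartz function, the following hold, the integrals in each inner product on the left being absolutely convergent. (1) $$\Big|\big(\omega_t\nabla_{\mathcal H_+}^m\Gamma(f,f),\ \omega_t\nabla_{\mathcal H_+}^mf\big)_{L^2}\Big|\le C_4\sum_{p=0}^m\binom mp\|\nabla_{\mathcal H_+}^pf\|_{2,\frac\gamma2}\,\|\omega_t\nabla_{\mathcal H_+}^{m-p}f\|_A\,\|\omega_t\nabla_{\mathcal H_+}^mf\|_A.$$ (2) If $b<2$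 or $c_0<\frac14$, then $$\Big|\big(\omega_t\nabla_{\mathcal H_+}^m\mathcal L_2f,\ \omega_t\nabla_{\mathcal H_+}^mf\big)_{L^2}\Big|\le C_6\sum_{p=0}^m\binom mp\big(\sqrt{C_5}\big)^{m-p}\sqrt{(m-p+3)!}\;\|\nabla_{\mathcal H_+}^pf\|_{2,\frac\gamma2}\,\|\omega_t\nabla_{\mathcal H_+}^mf\|_A.$$ (3) If $b<2$ or $c_0\le\kappa$, then $$\begin{aligned}\Big|\big([\omega_t\nabla_{\mathcal H_+}^m,\mathcal L_1]f,\ \omega_t\nabla_{\mathcal H_+}^mf\big)_{L^2}\Big|\le{}&\tfrac18\|\omega_t\nabla_{\mathcal H_+}^mf\|_A^2+C_7\sum_{p=0}^{m-1}\binom mp\sqrt{\tfrac{(m-p+2)!}2}\;\|\omega_t\nabla_{\mathcal H_+}^pf\|_A\,\|\omega_t\nabla_{\mathcal H_+}^mf\|_A\\&+C_7\sum_{p=1}^m\binom mp\,p\,\sqrt{\tfrac{(m-p+2)!}2}\;\|\omega_t\nabla_{\mathcal H_+}^{p-1}f\|_A\,\|\omega_t\nabla_{\mathcal H_+}^mf\|_A.\end{aligned}$$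 -/

import Mathlib

namespace Landau

/-- The velocity space `ℝ³` with its Euclidean norm and Lebesgue measure. -/
abbrev V : Type := EuclideanSpace ℝ (Fin 3)

/-- The partial derivative `∂ₖ f`. -/
noncomputable def pd (k : Fin 3) (f : V → ℝ) (v : V) : ℝ :=
  fderiv ℝ f v (EuclideanSpace.single k 1)

/-- The Japanese bracket `⟨v⟩ = (1 + |v|²)^{1/2}`. -/
noncomputable def bracket (v : V) : ℝ := Real.sqrt (1 + ‖v‖ ^ 2)

/-- The Maxwellian `μ(v) = (2π)^{-3/2} exp(-|v|²/2)`. -/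
noncomputable def maxwellian (v : V) : ℝ :=
  (2 * Real.pi) ^ (-(3 / 2) : ℝ) * Real.exp (-(‖v‖ ^ 2) / 2)

/-- The square root `√μ` of the Maxwellian. -/
noncomputable def sqrtMu (v : V) : ℝ := Real.sqrt (maxwellian v)

/-- The collision matrix `a_{jk}(v) = (δ_{jk} |v|² - v_j v_k) |v|^γ`. -/
noncomputable def collisionMatrix (γ : ℝ) (j k : Fin 3) (v : V) : ℝ :=
  ((if j = k then ‖v‖ ^ 2 else 0) - v j * v k) * ‖v‖ ^ γ

/-- The averaged matrix `ā_{jk} = a_{jk} * μ`. -/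
noncomputable def averagedMatrix (γ : ℝ) (j k : Fin 3) (v : V) : ℝ :=
  ∫ w : V, collisionMatrix γ j k (v - w) * maxwellian w

/-- The Landau collision operator
`Q(G, F)(v) = ∑_{j,k} ∂_j ( ∫ a_{jk}(v - w) [G(w) ∂_k F(v) - ∂_k G(w) F(v)] dw )`. -/
noncomputable def collisionOp (γ : ℝ) (G F : V → ℝ) (v : V) : ℝ :=
  ∑ j : Fin 3, ∑ k : Fin 3,
    pd j (fun u : V =>
      ∫ w : V, collisionMatrix γ j k (u - w) * (G w * pd k F u - pd k G w * F u)) v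

/-- `Γ(f, g) = μ^{-1/2} Q(√μ f, √μ g)`. -/
noncomputable def Gam (γ : ℝ) (f g : V → ℝ) (v : V) : ℝ :=
  (sqrtMu v)⁻¹ * collisionOp γ (fun u => sqrtMu u * f u) (fun u => sqrtMu u * g u) v

/-- `𝓛₁ f = -Γ(√μ, f)`. -/
noncomputable def opL1 (γ : ℝ) (f : V → ℝ) (v : V) : ℝ := -Gam γ sqrtMu f v

/-- `𝓛₂ f = -Γ(f, √μ)`. -/
noncomputable def opL2 (γ : ℝ) (f : V → ℝ) (v : V) : ℝ := -Gam γ f sqrtMu v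

/-- The creation operator `A_{+,k} = v_k / 2 - ∂_k`. -/
noncomputable def creation (k : Fin 3) (f : V → ℝ) (v : V) : ℝ := v k / 2 * f v - pd k f v

/-- The tensor `∇_{𝓗₊}^m f`, where `∇_{𝓗₊} = (A_{+,1}, A_{+,2}, A_{+,3})`; its component at
`(i₁, …, i_m)` is `A_{+,i₁} ⋯ A_{+,i_m} f`. A multi-index `α` with `|α| = m` stands for `m! / α!`
of these components, so that a sum of squares over all components is
`∑_{|α| = m} (m! / α!) |A_+^α f|²`. -/
noncomputable def gradH : (m : ℕ) → (V → ℝ) → (Fin m → Fin 3) → V → ℝ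
  | 0, f, _ => f
  | m + 1, f, I => creation (I 0) (gradH m f (Fin.tail I))

/-- The weight `ω_t(v) = exp( c₀ / (1 + t) ⟨v⟩^b )`. -/
noncomputable def weight (b c₀ t : ℝ) (v : V) : ℝ :=
  Real.exp (c₀ / (1 + t) * bracket v ^ b)

/-- The weighted tensor `ω_t ∇_{𝓗₊}^m f`. -/
noncomputable def wgrad (b c₀ t : ℝ) (m : ℕ) (f : V → ℝ) (I : Fin m → Fin 3) (v : V) : ℝ :=
  weight b c₀ t v * gradH m f I v

/-- The commutator `[ω_t ∇_{𝓗₊}^m, 𝓛₁] f`, componentwise. -/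
noncomputable def commL1 (γ b c₀ t : ℝ) (m : ℕ) (f : V → ℝ) (I : Fin m → Fin 3) (v : V) : ℝ :=
  wgrad b c₀ t m (opL1 γ f) I v - opL1 γ (wgrad b c₀ t m f I) v

/-- `‖f‖²_A = ∑_{j,k} ∫ ( ā_{jk} ∂_j f ∂_k f + ¼ ā_{jk} v_j v_k f² ) dv`. -/
noncomputable def normASq (γ : ℝ) (f : V → ℝ) : ℝ :=
  ∑ j : Fin 3, ∑ k : Fin 3,
    ∫ v : V, (averagedMatrix γ j k v * pd j f v * pd k f v
      + 1 / 4 * averagedMatrix γ j k v * v j * v k * f v ^ 2)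

/-- `‖T‖_A` for a tensor-valued function: the `ℓ²` sum over the components. -/
noncomputable def normA (γ : ℝ) {m : ℕ} (T : (Fin m → Fin 3) → V → ℝ) : ℝ :=
  Real.sqrt (∑ I, normASq γ (T I))

/-- `‖T‖_{2,r} = ‖⟨·⟩^r T‖_{L²}` for a tensor-valued function. -/
noncomputable def norm2 (r : ℝ) {m : ℕ} (T : (Fin m → Fin 3) → V → ℝ) : ℝ :=
  Real.sqrt (∑ I, ∫ v : V, (bracket v ^ r * T I v) ^ 2)

/-- The integrals that make up `(S, T)_{L²}` converge absolutely. -/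
def PairingConverges {m : ℕ} (S T : (Fin m → Fin 3) → V → ℝ) : Prop :=
  ∀ I, MeasureTheory.Integrable (fun v : V => S I v * T I v)

/-- The inner product `(S, T)_{L²(ℝ³)}` of two tensor-valued functions. -/
noncomputable def pairing {m : ℕ} (S T : (Fin m → Fin 3) → V → ℝ) : ℝ :=
  ∑ I, ∫ v : V, S I v * T I v

/-- The class of functions considered: `ω_t f` is a Schwartz function. -/
def Suitable (b c₀ t : ℝ) (f : V → ℝ) : Prop :=
  ∃ g : SchwartzMap V ℝ, ∀ v, g v = weight b c₀ t v * f v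

end Landau

namespace Landau

open MeasureTheory Function Filter Topology

/-! Since `∂_k (√μ h) = -√μ A_{+,k} h`, the operator has the divergence form `Γ(f,g) = ∑ A_{+,j}
[(a_{jk} * √μ f) A_{+,k} g - (a_{jk} * √μ A_{+,k} f) g]` (`Gam_eq`). Convolution commutes with
derivatives and the creation operators commute with each other, so `A_{+,i}` obeys an exact Leibniz
rule on `Γ` (`creation_Gam`). Hence `∇^m Γ` is a binomial sum without commutator terms, and all
three bounds rest on one estimate without derivatives, `|(ω Γ(f,g), H)| ≤ C ‖f‖_{2,γ/2} ‖ω g‖_A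
‖H‖_A` (`weighted_trilinear`).

For that estimate, the norm `‖G‖_A` controls `∫ ⟨v⟩^γ (|∇G|² + |v × ∇G|² + ⟨v⟩² G²)`
(`energy_le_normASq`). Conjugation by `ω` adds to `A_+` a bounded multiple of `v`; a vector parallel
to `v` has no cross product with `v`, so this costs only the zero order part of the energy. The form
of `a(z)` is `|z|^γ (z × x)·(z × y)`, which bounds the second order term of the flux by
`‖f‖_{2,γ/2}` and the energy densities. In the term with `A_{+,k} f`, the divergence is moved onto
the kernel (`sum_kconv_pd`). The resulting kernel `-2 z_j |z|^γ` is less singular than `|z|⁻²`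
because `γ > -3`, and Hardy's inequality absorbs it.

The sum over multi-indices is treated by proving the estimate for families of functions
(`trilinear_family`): each creation operator enlarges a family, Pascal's rule produces the binomial
coefficients, and Cauchy-Schwarz over components is used only after all operators have been
distributed. This gives (1).

For (2), take `g = √μ`. The functions `∇^n √μ` are Hermite functions, bounded by `√(n!)` times an
exponential in `n`, at the price of an arbitrarily small Gaussian loss; this beats the weight when
`b < 2` or `c₀ < 1/4`.

For (3), the commutator splits in two. In the Leibniz terms at least one operator falls on `√μ`, and
`‖∇^n √μ‖² = (n+2)!/2 ‖√μ‖²` exactly (`sum_integral_gradH_sqrtMu_sq`). The commutator with the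
weight, tested against `H = ω ∇^m f`, equals up to sign `∫ φ² H² ā v·v`, where `∇ω = φ v ω`
(`integral_weight_commutator`). Where `φ` is small this is at most `1/8 ‖H‖_A²`; elsewhere `v` is
bounded, and since `H` is a first order operator applied to `ω ∇^{m-1} f`, interpolation gives the
term `p = m - 1` of the first sum. -/

/-! ### Function classes closed under partial derivatives -/

/-- Partial derivatives determine the derivative. -/
theorem fderiv_eq_sum_pd (u : V → ℝ) :
    fderiv ℝ u = fun v => ∑ k : Fin 3,
      (ContinuousLinearMap.toSpanSingleton ℝ (EuclideanSpace.proj k : V →L[ℝ] ℝ)) (pd k u v) := by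
  funext v
  ext x
  have hx : x = ∑ k : Fin 3, x k • EuclideanSpace.single k (1 : ℝ) := by
    ext i
    fin_cases i <;> simp [Fin.sum_univ_three]
  conv_lhs => rw [hx]
  rw [map_sum]
  simp only [map_smul, sum_apply, pd]
  refine Finset.sum_congr rfl fun k _ => ?_
  simp [ContinuousLinearMap.toSpanSingleton_apply, mul_comm]

theorem norm_iteratedFDeriv_succ_le_sum_pd {u : V → ℝ} (n : ℕ)
    (h : ∀ k, ContDiff ℝ n (pd k u)) (v : V) :
    ‖iteratedFDeriv ℝ (n + 1) u v‖ ≤ ∑ k : Fin 3, ‖iteratedFDeriv ℝ n (pd k u) v‖ := by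
  rw [← norm_iteratedFDeriv_fderiv, fderiv_eq_sum_pd]
  have hc : ∀ k ∈ (Finset.univ : Finset (Fin 3)), ContDiff ℝ n (fun v =>
      (ContinuousLinearMap.toSpanSingleton ℝ (EuclideanSpace.proj k : V →L[ℝ] ℝ)) (pd k u v)) :=
    fun k _ => (ContinuousLinearMap.contDiff _).comp (h k)
  rw [iteratedFDeriv_fun_sum_apply fun k hk => (hc k hk).contDiffAt]
  refine (norm_sum_le _ _).trans (Finset.sum_le_sum fun k _ => ?_)
  have := ContinuousLinearMap.norm_iteratedFDeriv_comp_left (𝕜 := ℝ)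
    (ContinuousLinearMap.toSpanSingleton ℝ (EuclideanSpace.proj k : V →L[ℝ] ℝ))
    (h k).contDiffAt (x := v) (n := n) le_rfl
  refine this.trans ?_
  have hn : ‖ContinuousLinearMap.toSpanSingleton ℝ (EuclideanSpace.proj k : V →L[ℝ] ℝ)‖ ≤ 1 := by
    rw [ContinuousLinearMap.norm_toSpanSingleton]
    refine ContinuousLinearMap.opNorm_le_bound _ zero_le_one fun x => ?_
    simpa using PiLp.norm_apply_le x k
  calc _ ≤ 1 * ‖iteratedFDeriv ℝ n (pd k u) v‖ := by gcongr
    _ = _ := one_mul _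

/-- The derivative is a finite combination of partial derivatives, which stay in the class, so
smoothness follows by induction. This and the next two results allow regularity to be checked
through order zero bounds alone. -/
theorem contDiff_of_pd_closed (P : (V → ℝ) → Prop) (hd : ∀ u, P u → Differentiable ℝ u)
    (hpd : ∀ u k, P u → P (pd k u)) (n : ℕ) : ∀ u, P u → ContDiff ℝ n u := by
  induction n with
  | zero => exact fun u hu => contDiff_zero.2 (hd u hu).continuous
  | succ n ih =>
    intro u hu
    rw [Nat.cast_add, Nat.cast_one, contDiff_succ_iff_fderiv]
    refine ⟨hd u hu, by simp, ?_⟩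
    rw [fderiv_eq_sum_pd]
    exact ContDiff.sum fun k _ => (ContinuousLinearMap.contDiff _).comp (ih _ (hpd u k hu))

/-- A class of functions that is closed under partial derivatives and consists of functions of
polynomial growth consists of functions of temperate growth. -/
theorem hasTemperateGrowth_of_pd_closed (P : (V → ℝ) → Prop)
    (hd : ∀ u, P u → Differentiable ℝ u) (hpd : ∀ u k, P u → P (pd k u))
    (hb : ∀ u, P u → ∃ (k : ℕ) (C : ℝ), ∀ v, |u v| ≤ C * (1 + ‖v‖) ^ k) {u : V → ℝ} (hu : P u) :
    HasTemperateGrowth u := by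
  have hc := contDiff_of_pd_closed P hd hpd
  refine ⟨contDiff_infty.2 fun n => hc n u hu, fun n => ?_⟩
  induction n generalizing u with
  | zero => simpa using hb u hu
  | succ n ih =>
    choose k C h using fun j => ih (hpd u j hu)
    refine ⟨∑ j, k j, ∑ j, |C j|, fun v => ?_⟩
    refine (norm_iteratedFDeriv_succ_le_sum_pd n (fun j => hc n _ (hpd u j hu)) v).trans ?_
    rw [Finset.sum_mul]
    refine Finset.sum_le_sum fun j _ => (h j v).trans ?_
    have h1 : (1 : ℝ) ≤ 1 + ‖v‖ := by linarith [norm_nonneg v]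
    calc C j * (1 + ‖v‖) ^ k j ≤ |C j| * (1 + ‖v‖) ^ k j := by gcongr; exact le_abs_self _
      _ ≤ _ := by
        refine mul_le_mul_of_nonneg_left (pow_le_pow_right₀ h1 ?_) (abs_nonneg _)
        exact Finset.single_le_sum (f := k) (fun i _ => Nat.zero_le _) (Finset.mem_univ j)

/-- A real function on `ℝ³` that underlies a Schwartz function. -/
def IsSchwartz (g : V → ℝ) : Prop := ∃ s : SchwartzMap V ℝ, ⇑s = g

theorem isSchwartz_of_pd_closed (P : (V → ℝ) → Prop)
    (hd : ∀ u, P u → Differentiable ℝ u) (hpd : ∀ u k, P u → P (pd k u))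
    (hb : ∀ u, P u → ∀ k : ℕ, ∃ C : ℝ, ∀ v, ‖v‖ ^ k * |u v| ≤ C) {u : V → ℝ} (hu : P u) :
    IsSchwartz u := by
  have hc := contDiff_of_pd_closed P hd hpd
  refine ⟨⟨u, contDiff_infty.2 fun n => hc n u hu, fun k n => ?_⟩, rfl⟩
  induction n generalizing u with
  | zero => simpa using hb u hu k
  | succ n ih =>
    choose C h using fun j => ih (hpd u j hu)
    refine ⟨∑ j, C j, fun v => ?_⟩
    refine (mul_le_mul_of_nonneg_left (norm_iteratedFDeriv_succ_le_sum_pd n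
      (fun j => hc n _ (hpd u j hu)) v) (by positivity)).trans ?_
    rw [Finset.mul_sum]
    exact Finset.sum_le_sum fun j _ => h j v

/-! ### Calculus of partial derivatives -/

theorem pd_mul {f g : V → ℝ} {v : V} (k : Fin 3) (hf : DifferentiableAt ℝ f v)
    (hg : DifferentiableAt ℝ g v) :
    pd k (fun u => f u * g u) v = pd k f v * g v + f v * pd k g v := by
  simp only [pd]
  rw [fderiv_fun_mul hf hg]
  simp
  ring

theorem pd_add {f g : V → ℝ} {v : V} (k : Fin 3) (hf : DifferentiableAt ℝ f v)
    (hg : DifferentiableAt ℝ g v) :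
    pd k (fun u => f u + g u) v = pd k f v + pd k g v := by
  simp only [pd]
  rw [fderiv_fun_add hf hg]
  simp

theorem pd_sub {f g : V → ℝ} {v : V} (k : Fin 3) (hf : DifferentiableAt ℝ f v)
    (hg : DifferentiableAt ℝ g v) :
    pd k (fun u => f u - g u) v = pd k f v - pd k g v := by
  simp only [pd]
  rw [fderiv_fun_sub hf hg]
  simp

theorem pd_neg (f : V → ℝ) (v : V) (k : Fin 3) : pd k (fun u => -f u) v = -pd k f v := by
  simp only [pd]
  rw [fderiv_fun_neg]
  simp

theorem pd_sum {ι : Type*} {s : Finset ι} {f : ι → V → ℝ} {v : V} (k : Fin 3)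
    (hf : ∀ i ∈ s, DifferentiableAt ℝ (f i) v) :
    pd k (fun u => ∑ i ∈ s, f i u) v = ∑ i ∈ s, pd k (f i) v := by
  simp only [pd]
  rw [fderiv_fun_sum hf]
  simp

theorem pd_coord (j k : Fin 3) (v : V) :
    pd k (fun u : V => u j) v = if j = k then 1 else 0 := by
  have : (fun u : V => u j) = (EuclideanSpace.proj j : V →L[ℝ] ℝ) := rfl
  simp only [pd]
  rw [this, ContinuousLinearMap.fderiv]
  simp

theorem pd_comm {f : V → ℝ} (hf : ContDiff ℝ 2 f) (j k : Fin 3) : pd j (pd k f) = pd k (pd j f) := by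
  have hd : Differentiable ℝ (fderiv ℝ f) := (hf.fderiv_right (m := 1) le_rfl).differentiable (by simp)
  have key : ∀ (i l : Fin 3) (v : V), pd i (pd l f) v =
      fderiv ℝ (fderiv ℝ f) v (EuclideanSpace.single i 1) (EuclideanSpace.single l 1) := by
    intro i l v
    have : pd l f = fun v => fderiv ℝ f v (EuclideanSpace.single l 1) := rfl
    simp only [pd, this]
    rw [fderiv_clm_apply (hd v) (differentiableAt_const _)]
    simp
  funext v
  rw [key, key]
  exact (hf.contDiffAt.isSymmSndFDerivAt (by simp)) _ _

theorem pd_hasTemperateGrowth {f : V → ℝ} (hf : HasTemperateGrowth f) (k : Fin 3) :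
    HasTemperateGrowth (pd k f) := by
  have hc : ContDiff ℝ (⊤ : ℕ∞) (fderiv ℝ f) := hf.1.fderiv_right (by simp)
  refine ⟨hc.clm_apply contDiff_const, fun n => ?_⟩
  obtain ⟨N, C, h⟩ := hf.2 (n + 1)
  refine ⟨N, C, fun v => le_trans ?_ (h v)⟩
  rw [← norm_iteratedFDeriv_fderiv]
  have := norm_iteratedFDeriv_clm_apply_const (𝕜 := ℝ) (f := fderiv ℝ f)
    (c := EuclideanSpace.single k (1 : ℝ)) (x := v) (N := (⊤ : ℕ∞)) (n := n)
    hc.contDiffAt (by exact_mod_cast le_top)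
  have hs : ‖(EuclideanSpace.single k (1 : ℝ) : V)‖ = 1 := by simp
  rw [hs, one_mul] at this
  exact this

theorem hasTemperateGrowth_coord (j : Fin 3) : HasTemperateGrowth (fun v : V => v j) :=
  (EuclideanSpace.proj j : V →L[ℝ] ℝ).hasTemperateGrowth

/-! ### Stability of the Schwartz class -/

namespace IsSchwartz

variable {f g : V → ℝ}

theorem hasTemperateGrowth (hf : IsSchwartz f) : HasTemperateGrowth f := by
  obtain ⟨s, rfl⟩ := hf
  exact s.hasTemperateGrowth

theorem contDiff (hf : IsSchwartz f) (n : ℕ∞) : ContDiff ℝ n f := by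
  obtain ⟨s, rfl⟩ := hf
  exact s.smooth n

theorem differentiable (hf : IsSchwartz f) : Differentiable ℝ f := by
  obtain ⟨s, rfl⟩ := hf
  exact s.differentiable

theorem continuous (hf : IsSchwartz f) : Continuous f := hf.differentiable.continuous

theorem integrable (hf : IsSchwartz f) : Integrable f := by
  obtain ⟨s, rfl⟩ := hf
  exact s.integrable

theorem pd (hf : IsSchwartz f) (k : Fin 3) : IsSchwartz (pd k f) := by
  obtain ⟨s, rfl⟩ := hf
  exact ⟨SchwartzMap.evalCLM ℝ V ℝ (EuclideanSpace.single k 1) (SchwartzMap.fderivCLM ℝ V ℝ s), rfl⟩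

theorem mul_left (hf : IsSchwartz f) (hg : HasTemperateGrowth g) :
    IsSchwartz (fun v => g v * f v) := by
  obtain ⟨s, rfl⟩ := hf
  exact ⟨SchwartzMap.smulLeftCLM ℝ g s, by
    funext v; rw [SchwartzMap.smulLeftCLM_apply_apply hg]; rfl⟩

theorem mul_right (hf : IsSchwartz f) (hg : HasTemperateGrowth g) :
    IsSchwartz (fun v => f v * g v) := by
  simpa only [mul_comm] using hf.mul_left hg

theorem mul (hf : IsSchwartz f) (hg : IsSchwartz g) : IsSchwartz (fun v => f v * g v) :=
  hf.mul_right hg.hasTemperateGrowth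

theorem add (hf : IsSchwartz f) (hg : IsSchwartz g) : IsSchwartz (fun v => f v + g v) := by
  obtain ⟨s, rfl⟩ := hf
  obtain ⟨t, rfl⟩ := hg
  exact ⟨s + t, rfl⟩

theorem sub (hf : IsSchwartz f) (hg : IsSchwartz g) : IsSchwartz (fun v => f v - g v) := by
  obtain ⟨s, rfl⟩ := hf
  obtain ⟨t, rfl⟩ := hg
  exact ⟨s - t, rfl⟩

theorem zero : IsSchwartz (fun _ => 0) := ⟨0, rfl⟩

theorem sum {ι : Type*} {s : Finset ι} {f : ι → V → ℝ} (hf : ∀ i ∈ s, IsSchwartz (f i)) :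
    IsSchwartz (fun v => ∑ i ∈ s, f i v) := by
  classical
  induction s using Finset.induction_on with
  | empty => simpa using zero
  | insert a s ha ih =>
    simp only [Finset.sum_insert ha]
    exact (hf a (by simp)).add (ih fun i hi => hf i (by simp [hi]))

theorem integral_pd_mul (hf : IsSchwartz f) (hg : IsSchwartz g) (k : Fin 3) :
    ∫ v, Landau.pd k f v * g v = -∫ v, f v * Landau.pd k g v := by
  have h := integral_mul_fderiv_eq_neg_fderiv_mul_of_integrable (𝕜 := ℝ) (μ := (volume : Measure V))
    (f := f) (g := g) (v := EuclideanSpace.single k 1)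
    ((hf.pd k).mul hg).integrable (hf.mul (hg.pd k)).integrable (hf.mul hg).integrable
    (fun x _ => hf.differentiable x) (fun x _ => hg.differentiable x)
  simp only [Landau.pd]
  rw [h, neg_neg]

end IsSchwartz

/-! ### Integration by parts and Hardy's inequality -/

theorem norm_sq_eq_sum (v : V) : ‖v‖ ^ 2 = ∑ k : Fin 3, v k ^ 2 := by
  rw [EuclideanSpace.norm_sq_eq]
  simp

theorem abs_coord_le (v : V) (k : Fin 3) : |v k| ≤ ‖v‖ := PiLp.norm_apply_le v k

theorem one_add_norm_le_mul (v z : V) : 1 + ‖z‖ ≤ (1 + ‖v - z‖) * (1 + ‖v‖) := by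
  have h : ‖z‖ ≤ ‖v - z‖ + ‖v‖ := by
    calc ‖z‖ = ‖v - (v - z)‖ := by congr 1; abel
      _ ≤ ‖v‖ + ‖v - z‖ := norm_sub_le _ _
      _ = _ := add_comm _ _
  nlinarith [norm_nonneg v, norm_nonneg (v - z), mul_nonneg (norm_nonneg v) (norm_nonneg (v - z))]

theorem hasTemperateGrowth_sub_const (w : V) : HasTemperateGrowth (fun v : V => v - w) :=
  HasTemperateGrowth.id'.sub (HasTemperateGrowth.const w)

theorem hasTemperateGrowth_coord_sub (w : V) (k : Fin 3) :
    HasTemperateGrowth (fun v : V => v k - w k) :=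
  (hasTemperateGrowth_coord k).sub (HasTemperateGrowth.const (w k))

theorem hasTemperateGrowth_add_norm_sq_rpow {ε : ℝ} (hε : 0 < ε) (w : V) (s : ℝ) :
    HasTemperateGrowth (fun v : V => (ε + ‖v - w‖ ^ 2) ^ s) := by
  have h1 : HasTemperateGrowth (fun v : V => (Real.sqrt ε)⁻¹ • (v - w)) :=
    (HasTemperateGrowth.const (Real.sqrt ε)⁻¹).smul (hasTemperateGrowth_sub_const w)
  have h2 := (HasTemperateGrowth.const (E := V) (ε ^ s)).mul
    ((hasTemperateGrowth_one_add_norm_sq_rpow V s).comp h1)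
  suffices h3 : (fun v : V => (ε + ‖v - w‖ ^ 2) ^ s) = (fun _ => ε ^ s) *
      ((fun x : V => (1 + ‖x‖ ^ 2) ^ s) ∘ fun v => (Real.sqrt ε)⁻¹ • (v - w)) by
    rw [h3]
    exact h2
  funext v
  have : ε + ‖v - w‖ ^ 2 = ε * (1 + ‖(Real.sqrt ε)⁻¹ • (v - w)‖ ^ 2) := by
    rw [norm_smul, mul_pow, norm_inv, inv_pow, Real.norm_eq_abs, sq_abs, Real.sq_sqrt hε.le]
    field_simp
  simp only [comp, Pi.mul_apply]
  rw [this, Real.mul_rpow hε.le (by positivity)]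

theorem pd_add_norm_sq_rpow {ε : ℝ} (hε : 0 < ε) (w : V) (s : ℝ) (k : Fin 3) (v : V) :
    pd k (fun v : V => (ε + ‖v - w‖ ^ 2) ^ s) v =
      2 * s * (v k - w k) * (ε + ‖v - w‖ ^ 2) ^ (s - 1) := by
  have h1 : HasFDerivAt (fun v : V => ε + ‖v - w‖ ^ 2)
      (2 • (innerSL ℝ (v - w)).comp (ContinuousLinearMap.id ℝ V)) v :=
    (((hasFDerivAt_id v).sub_const w).norm_sq).const_add ε
  have h2 := h1.rpow_const (p := s) (Or.inl (by positivity))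
  rw [pd, h2.fderiv]
  simp [EuclideanSpace.inner_single_right]
  ring

/-- Functions of temperate growth integrate by parts against Schwartz functions. -/
theorem integral_pd_mul_of_hasTemperateGrowth {f g : V → ℝ} (hf : HasTemperateGrowth f)
    (hg : IsSchwartz g) (k : Fin 3) : ∫ v, pd k f v * g v = -∫ v, f v * pd k g v := by
  have hd : Differentiable ℝ f := hf.1.differentiable (by simp)
  have h := integral_mul_fderiv_eq_neg_fderiv_mul_of_integrable (𝕜 := ℝ) (μ := (volume : Measure V))
    (f := f) (g := g) (v := EuclideanSpace.single k 1)
    (hg.mul_left (pd_hasTemperateGrowth hf k)).integrable ((hg.pd k).mul_left hf).integrable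
    (hg.mul_left hf).integrable (fun x _ => hd x) (fun x _ => hg.differentiable x)
  simp only [pd]
  rw [h, neg_neg]

/-- The divergence theorem for `g² X`. -/
theorem integral_divergence_sq {X : Fin 3 → V → ℝ} (hX : ∀ k, HasTemperateGrowth (X k))
    {g : V → ℝ} (hg : IsSchwartz g) :
    ∫ v, ((∑ k, pd k (X k) v) * g v ^ 2 + 2 * g v * ∑ k, X k v * pd k g v) = 0 := by
  have h : ∀ k, ∫ v, (pd k (X k) v * (g v * g v) + X k v * (2 * (g v * pd k g v))) = 0 := by
    intro k
    have h1 := integral_pd_mul_of_hasTemperateGrowth (hX k) (hg.mul hg) k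
    have h2 : pd k (fun v => g v * g v) = fun v => 2 * (g v * pd k g v) := by
      funext v
      rw [pd_mul k (hg.differentiable v) (hg.differentiable v)]
      ring
    rw [h2] at h1
    have i2 : IsSchwartz fun v => X k v * (2 * (g v * pd k g v)) := by
      have := ((hg.mul hg).pd k).mul_left (hX k)
      rwa [h2] at this
    rw [integral_add ((hg.mul hg).mul_left (pd_hasTemperateGrowth (hX k) k)).integrable
      i2.integrable, h1]
    ring
  have hi : ∀ k, IsSchwartz fun v => pd k (X k) v * (g v * g v) + X k v * (2 * (g v * pd k g v)) :=
    fun k => ((hg.mul hg).mul_left (pd_hasTemperateGrowth (hX k) k)).add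
      (((hg.mul (hg.pd k)).mul_left (HasTemperateGrowth.const 2)).mul_left (hX k))
  calc _ = ∫ v, ∑ k, (pd k (X k) v * (g v * g v) + X k v * (2 * (g v * pd k g v))) := by
        congr 1
        funext v
        simp only [Fin.sum_univ_three]
        ring
    _ = 0 := by
        rw [integral_finsetSum _ fun k _ => (hi k).integrable]
        exact Finset.sum_eq_zero fun k _ => h k

/-- The squared length of the gradient. -/
noncomputable def gradSq (g : V → ℝ) (v : V) : ℝ := ∑ k : Fin 3, pd k g v ^ 2

theorem gradSq_nonneg (g : V → ℝ) (v : V) : 0 ≤ gradSq g v :=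
  Finset.sum_nonneg fun _ _ => sq_nonneg _

theorem IsSchwartz.sq {g : V → ℝ} (hg : IsSchwartz g) : IsSchwartz fun v => g v ^ 2 := by
  simpa only [_root_.sq] using hg.mul hg

theorem IsSchwartz.gradSq {g : V → ℝ} (hg : IsSchwartz g) : IsSchwartz (gradSq g) :=
  IsSchwartz.sum fun k _ => (hg.pd k).sq

theorem sum_mul_sq_le (x y : Fin 3 → ℝ) :
    (∑ k, x k * y k) ^ 2 ≤ (∑ k, x k ^ 2) * ∑ k, y k ^ 2 :=
  Finset.sum_mul_sq_le_sq_mul_sq _ _ _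

/-- Apply the divergence theorem to `g² X` with `X = r z`, `z = v - w`, `r = (ε + |z|²)⁻¹`. In
dimension three `div X = 3r - 2|z|² r² ≥ r`, and the cross term is absorbed by completing a square.
-/
theorem hardy_regularized {g : V → ℝ} (hg : IsSchwartz g) (w : V) {ε : ℝ} (hε : 0 < ε) :
    ∫ v, (ε + ‖v - w‖ ^ 2)⁻¹ * g v ^ 2 ≤ 4 * ∫ v, gradSq g v := by
  set r : V → ℝ := fun v => (ε + ‖v - w‖ ^ 2)⁻¹ with hr
  have hr' : r = fun v => (ε + ‖v - w‖ ^ 2) ^ (-1 : ℝ) := by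
    funext v
    rw [hr, Real.rpow_neg_one]
  have hrt : HasTemperateGrowth r := hr' ▸ hasTemperateGrowth_add_norm_sq_rpow hε w _
  have hX : ∀ k : Fin 3, HasTemperateGrowth (fun v : V => (v k - w k) * r v) := fun k =>
    (hasTemperateGrowth_coord_sub w k).mul hrt
  have key := integral_divergence_sq hX hg
  have hpt : ∀ v, 1 / 2 * (r v * g v ^ 2) - 2 * gradSq g v ≤
      (∑ k, pd k (fun v : V => (v k - w k) * r v) v) * g v ^ 2 +
        2 * g v * ∑ k, (v k - w k) * r v * pd k g v := by
    intro v
    have hrv : 0 < r v := by rw [hr]; positivity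
    have hz : ∑ k : Fin 3, (v k - w k) ^ 2 = ‖v - w‖ ^ 2 := by
      rw [norm_sq_eq_sum]; rfl
    have hpd : ∀ k : Fin 3, pd k (fun v : V => (v k - w k) * r v) v =
        r v - 2 * (v k - w k) ^ 2 * r v ^ 2 := by
      intro k
      rw [pd_mul k ((hasTemperateGrowth_coord_sub w k).1.differentiable (by simp) v)
        (hrt.1.differentiable (by simp) v)]
      have h1 : pd k (fun v : V => v k - w k) v = 1 := by
        have : (fun v : V => v k - w k) = fun v => (fun u : V => u k) v - (fun _ => w k) v := rfl
        rw [this, pd_sub k ((hasTemperateGrowth_coord k).1.differentiable (by simp) v)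
          (differentiableAt_const _), pd_coord]
        simp [pd]
      have h2 : (ε + ‖v - w‖ ^ 2) ^ ((-1 : ℝ) - 1) = r v ^ 2 := by
        have : (-1 : ℝ) - 1 = -(2 : ℕ) := by norm_num
        rw [this, Real.rpow_neg (by positivity), Real.rpow_natCast, hr]
        simp
      rw [h1, hr', pd_add_norm_sq_rpow hε, h2, ← hr']
      ring
    have hD : ∑ k, pd k (fun v : V => (v k - w k) * r v) v = 3 * r v - 2 * ‖v - w‖ ^ 2 * r v ^ 2 := by
      simp only [hpd, ← hz, Fin.sum_univ_three]
      ring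
    have hrz : ‖v - w‖ ^ 2 * r v ≤ 1 := by
      rw [hr]
      simp only
      rw [← div_eq_mul_inv, div_le_one (by positivity)]
      linarith
    set S := ∑ k, (v k - w k) * pd k g v with hS
    have hS' : ∑ k, (v k - w k) * r v * pd k g v = r v * S := by
      rw [hS, Finset.mul_sum]
      exact Finset.sum_congr rfl fun k _ => by ring
    have hCS : S ^ 2 ≤ ‖v - w‖ ^ 2 * gradSq g v := by
      rw [← hz]; exact sum_mul_sq_le _ _
    have hrS : r v * S ^ 2 ≤ gradSq g v := by
      calc r v * S ^ 2 ≤ r v * (‖v - w‖ ^ 2 * gradSq g v) := by gcongr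
        _ = (‖v - w‖ ^ 2 * r v) * gradSq g v := by ring
        _ ≤ 1 * gradSq g v := by gcongr; exact gradSq_nonneg g v
        _ = _ := one_mul _
    rw [hD, hS']
    have h3 : r v * g v ^ 2 ≤ (3 * r v - 2 * ‖v - w‖ ^ 2 * r v ^ 2) * g v ^ 2 := by
      refine mul_le_mul_of_nonneg_right ?_ (sq_nonneg _)
      nlinarith
    -- The square `r (g + 2S)² ≥ 0` gives `2 g r S ≥ -r g²/2 - 2 r S²`, and `r S² ≤ |∇g|²`.
    nlinarith [mul_nonneg hrv.le (sq_nonneg (g v + 2 * S))]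
  have hi1 : Integrable fun v => 1 / 2 * (r v * g v ^ 2) :=
    ((hg.sq).mul_left hrt).integrable.const_mul _
  have hi2 : Integrable fun v => 2 * gradSq g v := hg.gradSq.integrable.const_mul _
  have hi3 : Integrable fun v => (∑ k, pd k (fun v : V => (v k - w k) * r v) v) * g v ^ 2 +
        2 * g v * ∑ k, (v k - w k) * r v * pd k g v := by
    refine (IsSchwartz.add (hg.sq.mul_left (HasTemperateGrowth.sum fun k _ =>
      pd_hasTemperateGrowth (hX k) k)) ?_).integrable
    exact (hg.mul_left (HasTemperateGrowth.const 2)).mul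
      (IsSchwartz.sum fun k _ => (hg.pd k).mul_left (hX k))
  have := integral_mono (hi1.sub hi2) hi3 hpt
  rw [key] at this
  simp only [Pi.sub_apply] at this
  rw [integral_sub hi1 hi2, integral_const_mul, integral_const_mul] at this
  linarith

/-- Hardy's inequality in `ℝ³`. -/
theorem hardy_lintegral {g : V → ℝ} (hg : IsSchwartz g) (w : V) :
    ∫⁻ v, ENNReal.ofReal ((‖v - w‖ ^ 2)⁻¹ * g v ^ 2) ≤ ENNReal.ofReal (4 * ∫ v, gradSq g v) := by
  set ε : ℕ → ℝ := fun n => 1 / ((n : ℝ) + 1) with hεd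
  have hε : ∀ n, 0 < ε n := fun n => by rw [hεd]; positivity
  have hε0 : Tendsto ε atTop (𝓝 0) := tendsto_one_div_add_atTop_nhds_zero_nat
  have hm : ∀ n, Measurable fun v : V => ENNReal.ofReal ((ε n + ‖v - w‖ ^ 2)⁻¹ * g v ^ 2) := by
    intro n
    have := hg.continuous.measurable
    fun_prop
  have hle : ∀ v, ENNReal.ofReal ((‖v - w‖ ^ 2)⁻¹ * g v ^ 2) ≤
      liminf (fun n => ENNReal.ofReal ((ε n + ‖v - w‖ ^ 2)⁻¹ * g v ^ 2)) atTop := by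
    intro v
    rcases eq_or_ne v w with rfl | hvw
    -- At `v = w` the convention `0⁻¹ = 0` makes the left side vanish.
    · simp
    · refine (Tendsto.liminf_eq ?_).ge
      have h0 : (0 : ℝ) + ‖v - w‖ ^ 2 ≠ 0 := by
        have : 0 < ‖v - w‖ := norm_pos_iff.2 (sub_ne_zero.2 hvw)
        positivity
      have := (((hε0.add_const (‖v - w‖ ^ 2)).inv₀ h0).mul_const (g v ^ 2))
      rw [zero_add] at this
      exact (ENNReal.continuous_ofReal.tendsto _).comp this
  -- Fatou's lemma removes the regularization, since its bound does not depend on `ε`.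
  refine (lintegral_mono hle).trans ((lintegral_liminf_le hm).trans ?_)
  refine liminf_le_of_le (by isBoundedDefault) fun b hb => ?_
  obtain ⟨n, hn⟩ := hb.exists
  refine hn.trans ?_
  have hi : Integrable fun v => (ε n + ‖v - w‖ ^ 2)⁻¹ * g v ^ 2 := by
    have := hasTemperateGrowth_add_norm_sq_rpow (hε n) w (-1)
    simp only [Real.rpow_neg_one] at this
    exact (hg.sq.mul_left this).integrable
  rw [← ofReal_integral_eq_lintegral_ofReal hi (ae_of_all _ fun v => by
    have := hε n
    positivity)]
  exact ENNReal.ofReal_le_ofReal (hardy_regularized hg w (hε n))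

theorem hardy_integrable {g : V → ℝ} (hg : IsSchwartz g) (w : V) :
    Integrable fun v => (‖v - w‖ ^ 2)⁻¹ * g v ^ 2 := by
  have := hg.continuous.measurable
  refine ⟨by fun_prop, ?_⟩
  rw [hasFiniteIntegral_iff_ofReal (ae_of_all _ fun v => by positivity)]
  exact (hardy_lintegral hg w).trans_lt ENNReal.ofReal_lt_top

/-! ### Logarithmic derivatives and Gaussians -/

/-- If the logarithmic derivative of `u` has temperate growth and `u` is polynomially bounded, then
`u` has temperate growth. -/
theorem hasTemperateGrowth_of_pd_eq_mul {u : V → ℝ} (hu : Differentiable ℝ u) {p : Fin 3 → V → ℝ}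
    (hp : ∀ k, HasTemperateGrowth (p k)) (h : ∀ k v, pd k u v = p k v * u v)
    (hb : ∃ (k : ℕ) (C : ℝ), ∀ v, |u v| ≤ C * (1 + ‖v‖) ^ k) : HasTemperateGrowth u := by
  refine hasTemperateGrowth_of_pd_closed
    (fun w => ∃ q, HasTemperateGrowth q ∧ w = fun v => q v * u v) ?_ ?_ ?_
    ⟨fun _ => 1, HasTemperateGrowth.const 1, by simp⟩
  · rintro _ ⟨q, hq, rfl⟩
    exact (hq.1.differentiable (by simp)).mul hu
  · rintro _ k ⟨q, hq, rfl⟩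
    refine ⟨fun v => pd k q v + q v * p k v, (pd_hasTemperateGrowth hq k).add (hq.mul (hp k)), ?_⟩
    funext v
    rw [pd_mul k (hq.1.differentiable (by simp) v) (hu v), h]
    ring
  · rintro _ ⟨q, hq, rfl⟩
    obtain ⟨k, C, hb⟩ := hb
    obtain ⟨N, D, hD⟩ := hq.2 0
    refine ⟨N + k, D * C, fun v => ?_⟩
    have h1 := hD v
    rw [norm_iteratedFDeriv_zero, Real.norm_eq_abs] at h1
    rw [abs_mul]
    calc |q v| * |u v| ≤ (D * (1 + ‖v‖) ^ N) * (C * (1 + ‖v‖) ^ k) :=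
          mul_le_mul h1 (hb v) (abs_nonneg _) ((abs_nonneg _).trans h1)
      _ = _ := by ring

/-- The products `q u` with `q` of temperate growth form a class closed under partial derivatives,
because `∂_k (q u) = (∂_k q + q p_k) u`. -/
theorem isSchwartz_of_pd_eq_mul {u : V → ℝ} (hu : Differentiable ℝ u) {p : Fin 3 → V → ℝ}
    (hp : ∀ k, HasTemperateGrowth (p k)) (h : ∀ k v, pd k u v = p k v * u v)
    (hb : ∀ k : ℕ, ∃ C : ℝ, ∀ v, (1 + ‖v‖) ^ k * |u v| ≤ C) : IsSchwartz u := by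
  refine isSchwartz_of_pd_closed
    (fun w => ∃ q, HasTemperateGrowth q ∧ w = fun v => q v * u v) ?_ ?_ ?_
    ⟨fun _ => 1, HasTemperateGrowth.const 1, by simp⟩
  · rintro _ ⟨q, hq, rfl⟩
    exact (hq.1.differentiable (by simp)).mul hu
  · rintro _ k ⟨q, hq, rfl⟩
    refine ⟨fun v => pd k q v + q v * p k v, (pd_hasTemperateGrowth hq k).add (hq.mul (hp k)), ?_⟩
    funext v
    rw [pd_mul k (hq.1.differentiable (by simp) v) (hu v), h]
    ring
  · rintro _ ⟨q, hq, rfl⟩ k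
    obtain ⟨N, D, hD⟩ := hq.2 0
    obtain ⟨C, hb⟩ := hb (N + k)
    have hD0 : 0 ≤ D := by simpa using (norm_nonneg _).trans (hD 0)
    refine ⟨D * C, fun v => ?_⟩
    have h1 := hD v
    rw [norm_iteratedFDeriv_zero, Real.norm_eq_abs] at h1
    rw [abs_mul]
    calc ‖v‖ ^ k * (|q v| * |u v|) ≤ (1 + ‖v‖) ^ k * ((D * (1 + ‖v‖) ^ N) * |u v|) := by
          gcongr
          linarith
      _ = D * ((1 + ‖v‖) ^ (N + k) * |u v|) := by ring
      _ ≤ D * C := by gcongr; exact hb v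

theorem exp_neg_mul_sq_decay {a : ℝ} (ha : 0 < a) (k : ℕ) :
    ∃ C : ℝ, ∀ x : ℝ, 0 ≤ x → (1 + x) ^ k * Real.exp (-(a * x ^ 2)) ≤ C := by
  -- From `(1+x)^k ≤ k! e^{1+x}` and `x ≤ 1/a + a x²`.
  refine ⟨k.factorial * Real.exp (1 + (1 / a) ), fun x hx => ?_⟩
  have h1 : (1 + x) ^ k ≤ k.factorial * Real.exp (1 + x) := by
    have := Real.pow_div_factorial_le_exp (1 + x) (by positivity) k
    rwa [div_le_iff₀ (by positivity), mul_comm] at this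
  have h2 : 1 + x ≤ 1 + 1 / a + a * x ^ 2 := by
    have : a * (1 / a + a * x ^ 2 - x) = (a * x - 1 / 2) ^ 2 + 3 / 4 := by
      field_simp
      ring
    have h4 : 0 < 1 / a + a * x ^ 2 - x := by
      by_contra hcon
      push Not at hcon
      nlinarith [sq_nonneg (a * x - 1 / 2), mul_nonneg ha.le (neg_nonneg.2 hcon)]
    linarith
  calc (1 + x) ^ k * Real.exp (-(a * x ^ 2))
      ≤ (k.factorial * Real.exp (1 + x)) * Real.exp (-(a * x ^ 2)) := by gcongr
    _ ≤ (k.factorial * Real.exp (1 + 1 / a + a * x ^ 2)) * Real.exp (-(a * x ^ 2)) := by gcongr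
    _ = _ := by
      rw [mul_assoc, ← Real.exp_add]
      congr 2
      ring

theorem pd_exp_neg_mul_sq (a : ℝ) (k : Fin 3) (v : V) :
    pd k (fun v : V => Real.exp (-(a * ‖v‖ ^ 2))) v =
      -(2 * a) * v k * Real.exp (-(a * ‖v‖ ^ 2)) := by
  have h1 := ((((hasFDerivAt_id v).norm_sq).const_mul a).neg).exp
  simp only [id, Pi.neg_apply] at h1
  rw [pd, h1.fderiv]
  simp [EuclideanSpace.inner_single_right]
  ring

theorem isSchwartz_gaussian {a : ℝ} (ha : 0 < a) :
    IsSchwartz fun v : V => Real.exp (-(a * ‖v‖ ^ 2)) := by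
  refine isSchwartz_of_pd_eq_mul (p := fun k v => -(2 * a) * v k) ?_ ?_
    (fun k v => pd_exp_neg_mul_sq a k v) fun k => ?_
  · intro v
    exact ((((hasFDerivAt_id v).norm_sq).const_mul a).neg).exp.differentiableAt
  · exact fun k => (HasTemperateGrowth.const (-(2 * a))).mul (hasTemperateGrowth_coord k)
  · obtain ⟨C, hC⟩ := exp_neg_mul_sq_decay ha k
    exact ⟨C, fun v => by
      rw [abs_of_pos (Real.exp_pos _)]
      exact hC _ (norm_nonneg v)⟩

/-! ### Convolution with mildly singular kernels -/

theorem IsSchwartz.one_add_norm_decay {f : V → ℝ} (hf : IsSchwartz f) (k : ℕ) :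
    ∃ C, 0 ≤ C ∧ ∀ v, |f v| ≤ C * ((1 + ‖v‖) ^ k)⁻¹ := by
  obtain ⟨s, rfl⟩ := hf
  have h := SchwartzMap.one_add_le_sup_seminorm_apply (𝕜 := ℝ) (m := (k, 0)) le_rfl le_rfl s
  refine ⟨_, le_trans (by positivity) (h 0), fun v => ?_⟩
  have := h v
  rw [norm_iteratedFDeriv_zero, Real.norm_eq_abs, mul_comm] at this
  rw [← div_eq_mul_inv, le_div_iff₀ (by positivity)]
  exact this

theorem IsSchwartz.fderiv_decay {f : V → ℝ} (hf : IsSchwartz f) (k : ℕ) :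
    ∃ C, 0 ≤ C ∧ ∀ v, ‖fderiv ℝ f v‖ ≤ C * ((1 + ‖v‖) ^ k)⁻¹ := by
  obtain ⟨s, rfl⟩ := hf
  have h := SchwartzMap.one_add_le_sup_seminorm_apply (𝕜 := ℝ) (m := (k, 1)) le_rfl le_rfl s
  refine ⟨_, le_trans (by positivity) (h 0), fun v => ?_⟩
  have := h v
  rw [norm_iteratedFDeriv_one, mul_comm] at this
  rw [← div_eq_mul_inv, le_div_iff₀ (by positivity)]
  exact this

theorem integrable_inv_one_add_norm_pow {k : ℕ} (hk : 4 ≤ k) :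
    Integrable fun z : V => ((1 + ‖z‖) ^ k)⁻¹ := by
  have h := integrable_one_add_norm (E := V) (μ := volume) (r := k) (by
    rw [finrank_euclideanSpace_fin]
    exact_mod_cast (by omega : 3 < k))
  refine h.congr (ae_of_all _ fun z => ?_)
  simp only
  rw [Real.rpow_neg (by positivity), Real.rpow_natCast]

/-- The kernels considered here are at most as singular as `|z|⁻²` and grow at most
quadratically. -/
structure IsKernel (K : V → ℝ) : Prop where
  measurable : Measurable K
  bound : ∃ A, 0 ≤ A ∧ ∀ z, |K z| ≤ A * ((‖z‖ ^ 2)⁻¹ + (1 + ‖z‖) ^ 2)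

/-- The convolution of a kernel with a function. -/
noncomputable def kconv (K G : V → ℝ) (v : V) : ℝ := ∫ w, K (v - w) * G w

/-- Splits `|z|⁻²` into a bounded part and an integrable part. The Gaussian is written as a square
so that the second part is exactly what Hardy's inequality controls. -/
theorem inv_norm_sq_le (z : V) : (‖z‖ ^ 2)⁻¹ ≤
    1 + Real.exp 1 * ((‖z‖ ^ 2)⁻¹ * Real.exp (-(1 / 2 * ‖z‖ ^ 2)) ^ 2) := by
  have he : Real.exp (-(1 / 2 * ‖z‖ ^ 2)) ^ 2 = Real.exp (-‖z‖ ^ 2) := by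
    rw [← Real.exp_nat_mul]
    congr 1
    push_cast
    ring
  rw [he]
  rcases le_total 1 (‖z‖ ^ 2) with h | h
  · have : (‖z‖ ^ 2)⁻¹ ≤ 1 := inv_le_one_of_one_le₀ h
    have : 0 ≤ Real.exp 1 * ((‖z‖ ^ 2)⁻¹ * Real.exp (-‖z‖ ^ 2)) := by positivity
    linarith
  · have h1 : 1 ≤ Real.exp 1 * Real.exp (-‖z‖ ^ 2) := by
      rw [← Real.exp_add]
      exact Real.one_le_exp (by linarith)
    have h2 : 0 ≤ (‖z‖ ^ 2)⁻¹ := by positivity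
    nlinarith

/-- Hardy's inequality for a Gaussian yields the local integrability of `|z|⁻²`, without polar
coordinates. -/
theorem integrable_singular_gaussian :
    Integrable fun z : V => (‖z‖ ^ 2)⁻¹ * Real.exp (-(1 / 2 * ‖z‖ ^ 2)) ^ 2 := by
  simpa using hardy_integrable (isSchwartz_gaussian (a := 1 / 2) (by norm_num)) 0

namespace IsKernel

variable {K : V → ℝ} {G : V → ℝ}

/-- The exponent six is the quadratic growth of the kernel plus the four that suffice for
integrability in dimension three. -/
theorem integrable_weight (hK : IsKernel K) : Integrable fun z => |K z| * ((1 + ‖z‖) ^ 6)⁻¹ := by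
  obtain ⟨A, hA, h⟩ := hK.bound
  have hm := hK.measurable
  refine Integrable.mono' (g := fun z => A * (((1 + ‖z‖) ^ 4)⁻¹ + ((1 + ‖z‖) ^ 4)⁻¹ + Real.exp 1 *
    ((‖z‖ ^ 2)⁻¹ * Real.exp (-(1 / 2 * ‖z‖ ^ 2)) ^ 2))) ?_ (by fun_prop) (ae_of_all _ fun z => ?_)
  · exact (((integrable_inv_one_add_norm_pow le_rfl).add
      (integrable_inv_one_add_norm_pow le_rfl)).add
      (integrable_singular_gaussian.const_mul _)).const_mul _
  · rw [Real.norm_of_nonneg (by positivity)]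
    have h0 : (1 : ℝ) ≤ 1 + ‖z‖ := by linarith [norm_nonneg z]
    have h1 : ((1 + ‖z‖) ^ 6)⁻¹ ≤ ((1 + ‖z‖) ^ 4)⁻¹ := by gcongr <;> norm_num [h0]
    have h2 : (1 + ‖z‖) ^ 2 * ((1 + ‖z‖) ^ 6)⁻¹ = ((1 + ‖z‖) ^ 4)⁻¹ := by field_simp
    have h3 : ((1 + ‖z‖) ^ 6)⁻¹ ≤ 1 := inv_le_one_of_one_le₀ (one_le_pow₀ h0)
    have h4 : (‖z‖ ^ 2)⁻¹ * ((1 + ‖z‖) ^ 6)⁻¹ ≤ ((1 + ‖z‖) ^ 4)⁻¹ + Real.exp 1 *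
        ((‖z‖ ^ 2)⁻¹ * Real.exp (-(1 / 2 * ‖z‖ ^ 2)) ^ 2) := by
      calc _ ≤ (1 + Real.exp 1 * ((‖z‖ ^ 2)⁻¹ * Real.exp (-(1 / 2 * ‖z‖ ^ 2)) ^ 2)) *
            ((1 + ‖z‖) ^ 6)⁻¹ := by gcongr; exact inv_norm_sq_le z
        _ = ((1 + ‖z‖) ^ 6)⁻¹ + Real.exp 1 * ((‖z‖ ^ 2)⁻¹ *
            Real.exp (-(1 / 2 * ‖z‖ ^ 2)) ^ 2) * ((1 + ‖z‖) ^ 6)⁻¹ := by ring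
        _ ≤ _ := add_le_add h1 (mul_le_of_le_one_right (by positivity) h3)
    calc |K z| * ((1 + ‖z‖) ^ 6)⁻¹
        ≤ A * ((‖z‖ ^ 2)⁻¹ + (1 + ‖z‖) ^ 2) * ((1 + ‖z‖) ^ 6)⁻¹ := by gcongr; exact h z
      _ = A * ((‖z‖ ^ 2)⁻¹ * ((1 + ‖z‖) ^ 6)⁻¹ + (1 + ‖z‖) ^ 2 * ((1 + ‖z‖) ^ 6)⁻¹) := by ring
      _ ≤ _ := by
        rw [h2]
        refine mul_le_mul_of_nonneg_left ?_ hA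
        linarith

theorem inv_weight_le (v z : V) :
    ((1 + ‖v - z‖) ^ 6)⁻¹ ≤ (1 + ‖v‖) ^ 6 * ((1 + ‖z‖) ^ 6)⁻¹ := by
  rw [← div_eq_mul_inv, le_div_iff₀ (by positivity), inv_mul_le_iff₀ (by positivity), ← mul_pow]
  gcongr
  exact one_add_norm_le_mul v z

theorem integrable_translate (hK : IsKernel K) (hG : IsSchwartz G) (v : V) :
    Integrable fun z => K z * G (v - z) := by
  obtain ⟨C, hC, h⟩ := hG.one_add_norm_decay 6
  have hm := hK.measurable
  have hm' := hG.continuous.measurable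
  refine (hK.integrable_weight.const_mul (C * (1 + ‖v‖) ^ 6)).mono' (by fun_prop)
    (ae_of_all _ fun z => ?_)
  rw [norm_mul, Real.norm_eq_abs, Real.norm_eq_abs]
  calc |K z| * |G (v - z)| ≤ |K z| * (C * ((1 + ‖v - z‖) ^ 6)⁻¹) := by gcongr; exact h _
    _ ≤ |K z| * (C * ((1 + ‖v‖) ^ 6 * ((1 + ‖z‖) ^ 6)⁻¹)) := by gcongr; exact inv_weight_le v z
    _ = _ := by ring

theorem integrable (hK : IsKernel K) (hG : IsSchwartz G) (v : V) :
    Integrable fun w => K (v - w) * G w := by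
  have := (hK.integrable_translate hG v).comp_sub_left v
  simpa using this

theorem kconv_eq (K G : V → ℝ) (v : V) : kconv K G v = ∫ z, K z * G (v - z) := by
  rw [kconv, ← integral_sub_left_eq_self _ _ v]
  simp

theorem kconv_bound (hK : IsKernel K) (hG : IsSchwartz G) :
    ∃ (k : ℕ) (C : ℝ), ∀ v, |kconv K G v| ≤ C * (1 + ‖v‖) ^ k := by
  obtain ⟨C, hC, h⟩ := hG.one_add_norm_decay 6
  refine ⟨6, C * ∫ z, |K z| * ((1 + ‖z‖) ^ 6)⁻¹, fun v => ?_⟩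
  rw [kconv_eq, ← Real.norm_eq_abs]
  calc _ ≤ ∫ z, (C * (1 + ‖v‖) ^ 6) * (|K z| * ((1 + ‖z‖) ^ 6)⁻¹) := by
        refine norm_integral_le_of_norm_le (hK.integrable_weight.const_mul _)
          (ae_of_all _ fun z => ?_)
        rw [norm_mul, Real.norm_eq_abs, Real.norm_eq_abs]
        calc |K z| * |G (v - z)| ≤ |K z| * (C * ((1 + ‖v - z‖) ^ 6)⁻¹) := by gcongr; exact h _
          _ ≤ |K z| * (C * ((1 + ‖v‖) ^ 6 * ((1 + ‖z‖) ^ 6)⁻¹)) := by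
            gcongr; exact inv_weight_le v z
          _ = _ := by ring
    _ = _ := by rw [integral_const_mul]; ring

/-- The translation is placed on the Schwartz factor, so the singular kernel is never
differentiated; the decay of `∇G` gives a dominating function uniform on a unit ball. -/
theorem hasFDerivAt_kconv (hK : IsKernel K) (hG : IsSchwartz G) (v₀ : V) :
    Integrable (fun z => K z • fderiv ℝ G (v₀ - z)) ∧
    HasFDerivAt (kconv K G) (∫ z, K z • fderiv ℝ G (v₀ - z)) v₀ := by
  have heq : kconv K G = fun v => ∫ z, K z * G (v - z) := funext (kconv_eq K G)
  rw [heq]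
  obtain ⟨C, hC, h⟩ := hG.fderiv_decay 6
  have hm := hK.measurable
  have hm' := hG.continuous.measurable
  have hbd : ∀ (z : V), ∀ v ∈ Metric.ball v₀ 1, ‖K z • fderiv ℝ G (v - z)‖ ≤
      (C * (2 + ‖v₀‖) ^ 6) * (|K z| * ((1 + ‖z‖) ^ 6)⁻¹) := by
    intro z v hv
    rw [norm_smul, Real.norm_eq_abs]
    have hv' : 1 + ‖v‖ ≤ 2 + ‖v₀‖ := by
      have := norm_sub_norm_le v v₀
      rw [Metric.mem_ball, dist_eq_norm] at hv
      linarith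
    calc |K z| * ‖fderiv ℝ G (v - z)‖ ≤ |K z| * (C * ((1 + ‖v - z‖) ^ 6)⁻¹) := by
          gcongr; exact h _
      _ ≤ |K z| * (C * ((1 + ‖v‖) ^ 6 * ((1 + ‖z‖) ^ 6)⁻¹)) := by gcongr; exact inv_weight_le v z
      _ ≤ |K z| * (C * ((2 + ‖v₀‖) ^ 6 * ((1 + ‖z‖) ^ 6)⁻¹)) := by gcongr
      _ = _ := by ring
  have hmd : AEStronglyMeasurable (fun z => K z • fderiv ℝ G (v₀ - z)) := by
    have hcont : Continuous (fderiv ℝ G) := (hG.contDiff 1).continuous_fderiv (by simp)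
    exact hm.aestronglyMeasurable.smul (hcont.comp (by fun_prop)).aestronglyMeasurable
  refine ⟨(hK.integrable_weight.const_mul (C * (2 + ‖v₀‖) ^ 6)).mono' hmd
    (ae_of_all _ fun z => hbd z v₀ (Metric.mem_ball_self one_pos)), ?_⟩
  refine hasFDerivAt_integral_of_dominated_of_fderiv_le (Metric.ball_mem_nhds v₀ one_pos)
    (F' := fun v z => K z • fderiv ℝ G (v - z))
    (Eventually.of_forall fun v => (hK.integrable_translate hG v).aestronglyMeasurable)
    (hK.integrable_translate hG v₀) hmd (ae_of_all _ hbd)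
    (hK.integrable_weight.const_mul (C * (2 + ‖v₀‖) ^ 6))
    (ae_of_all _ fun z v _ => ?_)
  have h1 : HasFDerivAt (fun v => G (v - z)) (fderiv ℝ G (v - z)) v := by
    have := (hG.differentiable (v - z)).hasFDerivAt.comp v ((hasFDerivAt_id v).sub_const z)
    rwa [ContinuousLinearMap.comp_id] at this
  exact h1.const_mul (K z)

theorem differentiable_kconv (hK : IsKernel K) (hG : IsSchwartz G) : Differentiable ℝ (kconv K G) :=
  fun v => (hK.hasFDerivAt_kconv hG v).2.differentiableAt

theorem pd_kconv (hK : IsKernel K) (hG : IsSchwartz G) (k : Fin 3) :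
    pd k (kconv K G) = kconv K (pd k G) := by
  funext v
  obtain ⟨hi, hd⟩ := hK.hasFDerivAt_kconv hG v
  rw [pd, hd.fderiv, ContinuousLinearMap.integral_apply hi, kconv_eq]
  rfl

theorem hasTemperateGrowth_kconv (hK : IsKernel K) (hG : IsSchwartz G) :
    HasTemperateGrowth (kconv K G) := by
  refine hasTemperateGrowth_of_pd_closed (fun u => ∃ G, IsSchwartz G ∧ u = kconv K G) ?_ ?_ ?_
    ⟨G, hG, rfl⟩
  · rintro _ ⟨G, hG, rfl⟩
    exact hK.differentiable_kconv hG
  · rintro _ k ⟨G, hG, rfl⟩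
    exact ⟨_, hG.pd k, hK.pd_kconv hG k⟩
  · rintro _ ⟨G, hG, rfl⟩
    exact hK.kconv_bound hG

theorem kconv_neg (K G : V → ℝ) : kconv K (fun v => -G v) = fun v => -kconv K G v := by
  funext v
  simp only [kconv, mul_neg]
  exact integral_neg _

end IsKernel

/-! ### The collision matrix and its divergence -/

theorem rpow_le_inv_sq_add {r s : ℝ} (hr : 0 < r) (h1 : -2 ≤ s) (h2 : s ≤ 2) :
    r ^ s ≤ (r ^ 2)⁻¹ + (1 + r) ^ 2 := by
  rcases le_total 1 r with h | h
  · calc r ^ s ≤ r ^ (2 : ℝ) := Real.rpow_le_rpow_of_exponent_le h h2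
      _ = r ^ 2 := Real.rpow_two r
      _ ≤ _ := by
        have : 0 ≤ (r ^ 2)⁻¹ := by positivity
        nlinarith
  · calc r ^ s ≤ r ^ (-2 : ℝ) := Real.rpow_le_rpow_of_exponent_ge hr h h1
      _ = (r ^ 2)⁻¹ := by rw [Real.rpow_neg hr.le, Real.rpow_two]
      _ ≤ _ := le_add_of_nonneg_right (by positivity)

/-- The vector field `b_j = ∑_k ∂_k a_{jk}`. -/
noncomputable def divKernel (γ : ℝ) (j : Fin 3) (z : V) : ℝ := -2 * z j * ‖z‖ ^ γ

theorem abs_projection_le (j k : Fin 3) (z : V) :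
    |(if j = k then ‖z‖ ^ 2 else 0) - z j * z k| ≤ 2 * ‖z‖ ^ 2 := by
  have h1 : |z j * z k| ≤ ‖z‖ ^ 2 := by
    rw [abs_mul, sq]
    exact mul_le_mul (abs_coord_le z j) (abs_coord_le z k) (abs_nonneg _) (norm_nonneg _)
  have h2 : |if j = k then ‖z‖ ^ 2 else 0| ≤ ‖z‖ ^ 2 := by
    split_ifs <;> simp
  rw [abs_le] at *
  constructor <;> linarith

theorem isKernel_collisionMatrix {γ : ℝ} (h1 : -3 < γ) (h2 : γ < 0) (j k : Fin 3) :
    IsKernel (collisionMatrix γ j k) := by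
  refine ⟨?_, 2, by norm_num, fun z => ?_⟩
  · unfold collisionMatrix
    by_cases h : j = k
    · simp only [h, if_true]; fun_prop
    · simp only [h, if_false]; fun_prop
  · rcases eq_or_ne z 0 with rfl | hz
    · have : ‖(0 : V)‖ ^ γ = 0 := by rw [norm_zero, Real.zero_rpow h2.ne]
      rw [collisionMatrix, this, mul_zero, abs_zero]
      positivity
    · have hz' : 0 < ‖z‖ := norm_pos_iff.2 hz
      rw [collisionMatrix, abs_mul, abs_of_nonneg (Real.rpow_nonneg (norm_nonneg z) γ)]
      calc _ ≤ 2 * ‖z‖ ^ 2 * ‖z‖ ^ γ := by gcongr; exact abs_projection_le j k z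
        _ = 2 * ‖z‖ ^ (2 + γ) := by rw [Real.rpow_add hz', Real.rpow_two]; ring
        _ ≤ _ := by gcongr; exact rpow_le_inv_sq_add hz' (by linarith) (by linarith)

theorem abs_divKernel_le (γ : ℝ) (j : Fin 3) (z : V) : |divKernel γ j z| ≤ 2 * (‖z‖ * ‖z‖ ^ γ) := by
  rw [divKernel, abs_mul, abs_of_nonneg (Real.rpow_nonneg (norm_nonneg z) γ), abs_mul]
  have := abs_coord_le z j
  have h2 : |(-2 : ℝ)| = 2 := by norm_num
  rw [h2]
  have := mul_le_mul_of_nonneg_right this (Real.rpow_nonneg (norm_nonneg z) γ)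
  linarith

/-- The homogeneity is `1 + γ > -2`. This is the most singular kernel that occurs, and the reason
why `IsKernel` allows `|z|⁻²`. -/
theorem isKernel_divKernel {γ : ℝ} (h1 : -3 < γ) (h2 : γ < 0) (j : Fin 3) :
    IsKernel (divKernel γ j) := by
  refine ⟨?_, 2, by norm_num, fun z => ?_⟩
  · unfold divKernel
    fun_prop
  · rcases eq_or_ne z 0 with rfl | hz
    · have : ‖(0 : V)‖ ^ γ = 0 := by rw [norm_zero, Real.zero_rpow h2.ne]
      rw [divKernel, this, mul_zero, abs_zero]
      positivity
    · have hz' : 0 < ‖z‖ := norm_pos_iff.2 hz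
      refine (abs_divKernel_le γ j z).trans ?_
      gcongr
      calc _ = ‖z‖ ^ (1 + γ) := by rw [Real.rpow_add hz', Real.rpow_one]
        _ ≤ _ := rpow_le_inv_sq_add hz' (by linarith) (by linarith)

/-- Up to a scalar, `a(z)` is the projection orthogonal to `z`. -/
theorem sum_collisionMatrix_mul_self (γ : ℝ) (j : Fin 3) (z : V) :
    ∑ k, collisionMatrix γ j k z * z k = 0 := by
  have h := norm_sq_eq_sum z
  simp only [collisionMatrix, h, Fin.sum_univ_three]
  fin_cases j <;> simp <;> ring

/-- A regularization of the collision matrix. -/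
noncomputable def regMatrix (γ ε : ℝ) (j k : Fin 3) (z : V) : ℝ :=
  ((if j = k then ‖z‖ ^ 2 else 0) - z j * z k) * (ε + ‖z‖ ^ 2) ^ (γ / 2)

theorem rpow_half_sq {r : ℝ} (hr : 0 ≤ r) (γ : ℝ) : (r ^ 2) ^ (γ / 2) = r ^ γ := by
  rw [← Real.rpow_two, ← Real.rpow_mul hr]
  congr 1
  ring

theorem reg_rpow_le {γ ε : ℝ} (h2 : γ < 0) (hε : 0 < ε) {r : ℝ} (hr : 0 < r) :
    (ε + r ^ 2) ^ (γ / 2) ≤ r ^ γ := by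
  rw [← rpow_half_sq hr.le]
  exact Real.rpow_le_rpow_of_nonpos (by positivity) (by linarith) (by linarith)

theorem tendsto_reg_rpow {ε : ℕ → ℝ} (h : Tendsto ε atTop (𝓝 0)) (γ : ℝ) {r : ℝ} (hr : 0 < r) :
    Tendsto (fun n => (ε n + r ^ 2) ^ (γ / 2)) atTop (𝓝 (r ^ γ)) := by
  rw [← rpow_half_sq hr.le]
  have := (h.add_const (r ^ 2)).rpow_const (p := γ / 2) (Or.inl (by positivity))
  rwa [zero_add] at this

/-- The condition at `z = 0` is needed because `0 ^ γ = 0` for `γ < 0`, while the regularized power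
is positive there. -/
theorem abs_reg_mul_le {γ ε : ℝ} (h2 : γ < 0) (hε : 0 < ε) (z : V) {x : ℝ} (hx : z = 0 → x = 0) :
    |x * (ε + ‖z‖ ^ 2) ^ (γ / 2)| ≤ |x * ‖z‖ ^ γ| := by
  rcases eq_or_ne z 0 with hz | hz
  · simp [hx hz]
  · rw [abs_mul, abs_mul, abs_of_nonneg (Real.rpow_nonneg (norm_nonneg z) γ),
      abs_of_nonneg (Real.rpow_nonneg (by positivity) _)]
    exact mul_le_mul_of_nonneg_left (reg_rpow_le h2 hε (norm_pos_iff.2 hz)) (abs_nonneg _)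

theorem tendsto_reg_mul {ε : ℕ → ℝ} (h : Tendsto ε atTop (𝓝 0)) (γ : ℝ) (z : V) {x : ℝ}
    (hx : z = 0 → x = 0) :
    Tendsto (fun n => x * (ε n + ‖z‖ ^ 2) ^ (γ / 2)) atTop (𝓝 (x * ‖z‖ ^ γ)) := by
  rcases eq_or_ne z 0 with hz | hz
  · simp [hx hz]
  · exact (tendsto_reg_rpow h γ (norm_pos_iff.2 hz)).const_mul _

/-- The gradient of the radial factor is parallel to `z` and is annihilated by the projection, so
only the quadratic polynomial contributes to the divergence. -/
theorem sum_integral_regMatrix {γ ε : ℝ} (hε : 0 < ε) (j : Fin 3) {G : V → ℝ} (hG : IsSchwartz G)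
    (v : V) :
    ∑ k, ∫ w, regMatrix γ ε j k (v - w) * pd k G w =
      ∫ w, (-2 * (v - w) j * (ε + ‖v - w‖ ^ 2) ^ (γ / 2)) * G w := by
  set r : V → ℝ := fun w => (ε + ‖w - v‖ ^ 2) ^ (γ / 2) with hr
  set p : Fin 3 → V → ℝ := fun k w =>
    (if j = k then ∑ i : Fin 3, (w i - v i) * (w i - v i) else 0) - (w j - v j) * (w k - v k) with hp
  have hrt : HasTemperateGrowth r := hasTemperateGrowth_add_norm_sq_rpow hε v _
  have hct := hasTemperateGrowth_coord_sub v
  have hcd : ∀ k w, DifferentiableAt ℝ (fun w : V => w k - v k) w := fun k w =>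
    (hct k).1.differentiable (by simp) w
  have hcp : ∀ i k (w : V), pd k (fun w : V => w i - v i) w = if i = k then 1 else 0 := by
    intro i k w
    rw [pd_sub k ((hasTemperateGrowth_coord i).1.differentiable (by simp) w)
      (differentiableAt_const _), pd_coord]
    simp [pd]
  have hpt : ∀ k, HasTemperateGrowth (p k) := by
    intro k
    refine HasTemperateGrowth.sub ?_ ((hct j).mul (hct k))
    by_cases h : j = k
    · simp only [h, if_true]
      exact HasTemperateGrowth.sum fun i _ => (hct i).mul (hct i)
    · simp only [h, if_false]
      exact HasTemperateGrowth.const 0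
  have hreg : ∀ k w, regMatrix γ ε j k (v - w) = p k w * r w := by
    intro k w
    rw [regMatrix, norm_sub_rev, hr, hp]
    congr 2
    · split_ifs
      · rw [norm_sq_eq_sum]
        exact Finset.sum_congr rfl fun i _ => by simp [_root_.sq]
      · rfl
    · simp only [PiLp.sub_apply]
      ring
  have hpp : ∀ k w, pd k (p k) w =
      (if j = k then 2 * (w k - v k) else 0) - ((if j = k then 1 else 0) * (w k - v k)
        + (w j - v j)) := by
    intro k w
    have hs : pd k (fun w : V => ∑ i : Fin 3, (w i - v i) * (w i - v i)) w = 2 * (w k - v k) := by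
      rw [pd_sum k fun i _ => (hcd i w).fun_mul (hcd i w)]
      simp only [pd_mul k (hcd _ w) (hcd _ w), hcp]
      simp only [Fin.sum_univ_three]
      fin_cases k <;> simp <;> ring
    have hm : pd k (fun w : V => (w j - v j) * (w k - v k)) w =
        (if j = k then 1 else 0) * (w k - v k) + (w j - v j) := by
      rw [pd_mul k (hcd _ w) (hcd _ w), hcp, hcp]
      simp
    by_cases h : j = k
    · have : p k = fun w : V => (∑ i : Fin 3, (w i - v i) * (w i - v i)) -
          (w j - v j) * (w k - v k) := by
        funext w; simp only [hp, h, if_true]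
      rw [this, pd_sub k (DifferentiableAt.fun_sum fun i _ => (hcd i w).fun_mul (hcd i w))
        ((hcd j w).fun_mul (hcd k w)), hs, hm]
      simp [h]
    · have : p k = fun w : V => -((w j - v j) * (w k - v k)) := by
        funext w; simp only [hp, h, if_false, zero_sub]
      rw [this, pd_neg, hm]
      simp [h]
  have hprt : ∀ k, HasTemperateGrowth (fun w => p k w * r w) := fun k => (hpt k).mul hrt
  have hdiv : ∀ w, ∑ k, pd k (fun w => p k w * r w) w = 2 * (v - w) j * r w := by
    intro w
    have h1 : ∀ k, pd k (fun w => p k w * r w) w = pd k (p k) w * r w +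
        p k w * (γ * (w k - v k) * (ε + ‖w - v‖ ^ 2) ^ (γ / 2 - 1)) := by
      intro k
      rw [pd_mul k ((hpt k).1.differentiable (by simp) w) (hrt.1.differentiable (by simp) w),
        hr, pd_add_norm_sq_rpow hε]
      ring
    rw [Finset.sum_congr rfl fun k _ => h1 k]
    simp only [hpp]
    simp only [hp, Fin.sum_univ_three, PiLp.sub_apply]
    fin_cases j <;> simp <;> ring
  calc _ = ∑ k, -∫ w, pd k (fun w => p k w * r w) w * G w := by
        refine Finset.sum_congr rfl fun k _ => ?_
        rw [integral_pd_mul_of_hasTemperateGrowth (hprt k) hG k, neg_neg]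
        simp only [hreg]
    _ = -∫ w, ∑ k, pd k (fun w => p k w * r w) w * G w := by
        rw [integral_finsetSum _ fun k _ =>
          (hG.mul_left (pd_hasTemperateGrowth (hprt k) k)).integrable,
          Finset.sum_neg_distrib]
    _ = _ := by
        rw [← integral_neg]
        congr 1
        funext w
        rw [← Finset.sum_mul, hdiv, hr]
        simp only
        rw [norm_sub_rev]
        ring

/-- The divergence of the collision matrix, moved off the convolved function. -/
theorem sum_kconv_pd {γ : ℝ} (h1 : -3 < γ) (h2 : γ < 0) (j : Fin 3) {G : V → ℝ}
    (hG : IsSchwartz G) (v : V) :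
    ∑ k, kconv (collisionMatrix γ j k) (pd k G) v = kconv (divKernel γ j) G v := by
  set ε : ℕ → ℝ := fun n => 1 / ((n : ℝ) + 1) with hεd
  have hε : ∀ n, 0 < ε n := fun n => by rw [hεd]; positivity
  have hε0 : Tendsto ε atTop (𝓝 0) := tendsto_one_div_add_atTop_nhds_zero_nat
  have hGm := hG.continuous.measurable
  have hz : ∀ (j k : Fin 3) (z : V), z = 0 → (if j = k then ‖z‖ ^ 2 else 0) - z j * z k = 0 := by
    rintro j k _ rfl; simp
  have hz' : ∀ (j : Fin 3) (z : V), z = 0 → -2 * z j = 0 := by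
    rintro j _ rfl; simp
  -- Both sides of the regularized identity converge by domination: for `γ < 0` the regularized
  -- kernels are smaller in absolute value than the limits.
  have l1 : Tendsto (fun n => ∑ k, ∫ w, regMatrix γ (ε n) j k (v - w) * pd k G w) atTop
      (𝓝 (∑ k, kconv (collisionMatrix γ j k) (pd k G) v)) := by
    refine tendsto_finsetSum _ fun k _ => ?_
    have hpm := (hG.pd k).continuous.measurable
    refine tendsto_integral_of_dominated_convergence
      (fun w => ‖collisionMatrix γ j k (v - w) * pd k G w‖) (fun n => ?_)
      ((isKernel_collisionMatrix h1 h2 j k).integrable (hG.pd k) v).norm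
      (fun n => ae_of_all _ fun w => ?_) (ae_of_all _ fun w => ?_)
    · unfold regMatrix
      by_cases h : j = k
      · simp only [h, if_true]; fun_prop
      · simp only [h, if_false]; fun_prop
    · rw [norm_mul, norm_mul]
      exact mul_le_mul_of_nonneg_right (abs_reg_mul_le h2 (hε n) _ (hz j k _)) (norm_nonneg _)
    · exact (tendsto_reg_mul hε0 γ _ (hz j k _)).mul_const _
  have l2 : Tendsto (fun n => ∫ w, (-2 * (v - w) j * (ε n + ‖v - w‖ ^ 2) ^ (γ / 2)) * G w) atTop
      (𝓝 (kconv (divKernel γ j) G v)) := by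
    refine tendsto_integral_of_dominated_convergence
      (fun w => ‖divKernel γ j (v - w) * G w‖) (fun n => by fun_prop)
      ((isKernel_divKernel h1 h2 j).integrable hG v).norm
      (fun n => ae_of_all _ fun w => ?_) (ae_of_all _ fun w => ?_)
    · rw [norm_mul, norm_mul (divKernel γ j (v - w))]
      exact mul_le_mul_of_nonneg_right (abs_reg_mul_le h2 (hε n) (v - w) (hz' j (v - w)))
        (norm_nonneg (G w))
    · exact (tendsto_reg_mul hε0 γ (v - w) (hz' j (v - w))).mul_const _
  simp only [sum_integral_regMatrix (hε _) j hG v] at l1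
  exact tendsto_nhds_unique l1 l2

/-! ### Creation operators, divergence form and Leibniz rule for `Γ` -/

theorem hasTemperateGrowth_fun_mul {f g : V → ℝ} (hf : HasTemperateGrowth f)
    (hg : HasTemperateGrowth g) : HasTemperateGrowth (fun v => f v * g v) := hf.mul hg

theorem hasTemperateGrowth_coord_half (k : Fin 3) : HasTemperateGrowth fun v : V => v k / 2 := by
  simpa only [div_eq_mul_inv] using
    hasTemperateGrowth_fun_mul (hasTemperateGrowth_coord k) (HasTemperateGrowth.const _)

theorem maxwellian_pos (v : V) : 0 < maxwellian v := by
  unfold maxwellian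
  positivity

theorem sqrtMu_pos (v : V) : 0 < sqrtMu v := Real.sqrt_pos.2 (maxwellian_pos v)

theorem sqrtMu_mul_self (v : V) : sqrtMu v * sqrtMu v = maxwellian v :=
  Real.mul_self_sqrt (maxwellian_pos v).le

theorem sqrtMu_eq : sqrtMu = fun v =>
    Real.sqrt ((2 * Real.pi) ^ (-(3 / 2) : ℝ)) * Real.exp (-(1 / 4 * ‖v‖ ^ 2)) := by
  funext v
  rw [sqrtMu, maxwellian, Real.sqrt_mul (by positivity)]
  congr 1
  rw [Real.sqrt_eq_iff_mul_self_eq (by positivity) (by positivity), ← Real.exp_add]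
  congr 1
  ring

theorem isSchwartz_sqrtMu : IsSchwartz sqrtMu := by
  rw [sqrtMu_eq]
  exact (isSchwartz_gaussian (by norm_num)).mul_left (HasTemperateGrowth.const _)

theorem isSchwartz_maxwellian : IsSchwartz maxwellian := by
  have : maxwellian = fun v => sqrtMu v * sqrtMu v := funext fun v => (sqrtMu_mul_self v).symm
  rw [this]
  exact isSchwartz_sqrtMu.mul isSchwartz_sqrtMu

theorem pd_sqrtMu (k : Fin 3) (v : V) : pd k sqrtMu v = -(v k / 2) * sqrtMu v := by
  rw [sqrtMu_eq]
  simp only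
  rw [pd_mul k (differentiableAt_const _)
    ((isSchwartz_gaussian (by norm_num)).differentiable v), pd_exp_neg_mul_sq]
  simp [pd]
  ring

theorem IsSchwartz.creation {f : V → ℝ} (hf : IsSchwartz f) (k : Fin 3) :
    IsSchwartz (creation k f) :=
  (hf.mul_left (hasTemperateGrowth_coord_half k)).sub (hf.pd k)

/-- Multiplication by `√μ` intertwines `∂_k` with `-A_{+,k}`; this is what makes creation operators
the natural derivatives for `Γ`. -/
theorem pd_sqrtMu_mul {f : V → ℝ} (hf : Differentiable ℝ f) (k : Fin 3) :
    pd k (fun v => sqrtMu v * f v) = fun v => -(sqrtMu v * creation k f v) := by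
  funext v
  rw [pd_mul k (isSchwartz_sqrtMu.differentiable v) (hf v), pd_sqrtMu, creation]
  ring

theorem creation_add {f g : V → ℝ} (hf : Differentiable ℝ f) (hg : Differentiable ℝ g)
    (k : Fin 3) :
    creation k (fun v => f v + g v) = fun v => creation k f v + creation k g v := by
  funext v
  rw [creation, creation, creation, pd_add k (hf v) (hg v)]
  ring

theorem creation_sub {f g : V → ℝ} (hf : Differentiable ℝ f) (hg : Differentiable ℝ g)
    (k : Fin 3) :
    creation k (fun v => f v - g v) = fun v => creation k f v - creation k g v := by
  funext v
  rw [creation, creation, creation, pd_sub k (hf v) (hg v)]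
  ring

theorem creation_sum {ι : Type*} {s : Finset ι} {f : ι → V → ℝ}
    (hf : ∀ i ∈ s, Differentiable ℝ (f i)) (k : Fin 3) :
    creation k (fun v => ∑ i ∈ s, f i v) = fun v => ∑ i ∈ s, creation k (f i) v := by
  funext v
  simp only [creation]
  rw [pd_sum k fun i hi => hf i hi v, Finset.mul_sum, Finset.sum_sub_distrib]

theorem creation_mul {c f : V → ℝ} (hc : Differentiable ℝ c) (hf : Differentiable ℝ f)
    (k : Fin 3) :
    creation k (fun v => c v * f v) = fun v => c v * creation k f v - pd k c v * f v := by
  funext v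
  rw [creation, creation, pd_mul k (hc v) (hf v)]
  ring

theorem creation_comm {f : V → ℝ} (hf : IsSchwartz f) (j k : Fin 3) :
    creation j (creation k f) = creation k (creation j f) := by
  have h : ∀ i l : Fin 3, ∀ v, creation i (creation l f) v = v i / 2 * (v l / 2 * f v) -
      v i / 2 * pd l f v - (if l = i then 1 else 0) / 2 * f v - v l / 2 * pd i f v +
      pd i (pd l f) v := by
    intro i l v
    have hc : DifferentiableAt ℝ (fun v : V => v l / 2) v :=
      (hasTemperateGrowth_coord_half l).1.differentiable (by simp) v
    have h1 : pd i (fun v : V => v l / 2) v = (if l = i then 1 else 0) / 2 := by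
      simp only [div_eq_mul_inv]
      rw [pd_mul i ((hasTemperateGrowth_coord l).1.differentiable (by simp) v)
        (differentiableAt_const _), pd_coord]
      simp [pd]
    have h2 : pd i (creation l f) v = (if l = i then 1 else 0) / 2 * f v + v l / 2 * pd i f v -
        pd i (pd l f) v := by
      have : creation l f = fun v => (fun v => v l / 2 * f v) v - pd l f v := rfl
      rw [this, pd_sub i (hc.fun_mul (hf.differentiable v)) ((hf.pd l).differentiable v),
        pd_mul i hc (hf.differentiable v), h1]
    rw [creation, h2, creation]
    ring
  funext v
  rw [h, h, pd_comm (hf.contDiff 2) j k]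
  by_cases hjk : j = k
  · subst hjk
    ring
  · simp only [hjk, Ne.symm hjk, if_false]
    ring

/-- The coefficient `a_{jk} * (√μ f)`. -/
noncomputable def coeff (γ : ℝ) (f : V → ℝ) (j k : Fin 3) : V → ℝ :=
  kconv (collisionMatrix γ j k) (fun v => sqrtMu v * f v)

/-- The flux in the divergence form of `Γ(f, g)`. -/
noncomputable def flux (γ : ℝ) (f g : V → ℝ) (j k : Fin 3) (v : V) : ℝ :=
  coeff γ f j k v * creation k g v - coeff γ (creation k f) j k v * g v

section

variable {γ : ℝ} (h1 : -3 < γ) (h2 : γ < 0)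

include h1 h2

theorem hasTemperateGrowth_coeff {f : V → ℝ} (hf : IsSchwartz f) (j k : Fin 3) :
    HasTemperateGrowth (coeff γ f j k) :=
  (isKernel_collisionMatrix h1 h2 j k).hasTemperateGrowth_kconv (isSchwartz_sqrtMu.mul hf)

theorem pd_coeff {f : V → ℝ} (hf : IsSchwartz f) (i j k : Fin 3) :
    pd i (coeff γ f j k) = fun v => -coeff γ (creation i f) j k v := by
  rw [coeff, (isKernel_collisionMatrix h1 h2 j k).pd_kconv (isSchwartz_sqrtMu.mul hf),
    pd_sqrtMu_mul hf.differentiable, IsKernel.kconv_neg]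
  rfl

theorem isSchwartz_flux {f g : V → ℝ} (hf : IsSchwartz f) (hg : IsSchwartz g) (j k : Fin 3) :
    IsSchwartz (flux γ f g j k) :=
  ((hg.creation k).mul_left (hasTemperateGrowth_coeff h1 h2 hf j k)).sub
    (hg.mul_left (hasTemperateGrowth_coeff h1 h2 (hf.creation k) j k))

/-- The divergence form of `Γ`. -/
theorem Gam_eq {f g : V → ℝ} (hf : IsSchwartz f) (hg : IsSchwartz g) :
    Gam γ f g = fun v => ∑ j, ∑ k, creation j (flux γ f g j k) v := by
  funext v
  rw [Gam, collisionOp, Finset.mul_sum]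
  refine Finset.sum_congr rfl fun j _ => ?_
  rw [Finset.mul_sum]
  refine Finset.sum_congr rfl fun k _ => ?_
  have hK := isKernel_collisionMatrix h1 h2 j k
  have hin : (fun u : V => ∫ w : V, collisionMatrix γ j k (u - w) *
      (sqrtMu w * f w * pd k (fun u => sqrtMu u * g u) u -
        pd k (fun u => sqrtMu u * f u) w * (sqrtMu u * g u))) =
      fun u => -(sqrtMu u * flux γ f g j k u) := by
    funext u
    rw [pd_sqrtMu_mul hf.differentiable, pd_sqrtMu_mul hg.differentiable]
    have hi1 := hK.integrable (isSchwartz_sqrtMu.mul hf) u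
    have hi2 := hK.integrable (isSchwartz_sqrtMu.mul (hf.creation k)) u
    calc _ = ∫ w, ((-(sqrtMu u * creation k g u)) * (collisionMatrix γ j k (u - w) *
            (sqrtMu w * f w)) + (sqrtMu u * g u) * (collisionMatrix γ j k (u - w) *
            (sqrtMu w * creation k f w))) := by
          congr 1
          funext w
          ring
      _ = _ := by
          rw [integral_add (hi1.const_mul _) (hi2.const_mul _), integral_const_mul,
            integral_const_mul, flux, coeff, coeff, kconv, kconv]
          ring
  rw [hin, pd_neg, pd_sqrtMu_mul (isSchwartz_flux h1 h2 hf hg j k).differentiable]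
  have := (sqrtMu_pos v).ne'
  field_simp

/-- A creation operator acts on a product as itself on one factor minus `∂_i` on the other. Since
`∂_i` of a coefficient is minus the coefficient of `A_{+,i} f`, the two signs cancel and no
remainder is left. -/
theorem creation_flux {f g : V → ℝ} (hf : IsSchwartz f) (hg : IsSchwartz g) (i j k : Fin 3) :
    creation i (flux γ f g j k) =
      fun v => flux γ (creation i f) g j k v + flux γ f (creation i g) j k v := by
  have e1 := hasTemperateGrowth_coeff h1 h2 hf j k
  have e2 := hasTemperateGrowth_coeff h1 h2 (hf.creation k) j k
  have e := creation_sub (((hg.creation k).mul_left e1).differentiable)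
    ((hg.mul_left e2).differentiable) i
  have : flux γ f g j k = fun v => coeff γ f j k v * creation k g v -
    coeff γ (creation k f) j k v * g v := rfl
  rw [this, e, creation_mul (e1.1.differentiable (by simp)) (hg.creation k).differentiable,
    creation_mul (e2.1.differentiable (by simp)) hg.differentiable, pd_coeff h1 h2 hf,
    pd_coeff h1 h2 (hf.creation k)]
  funext v
  simp only [flux]
  rw [creation_comm hg i k, creation_comm hf i k]
  ring

theorem isSchwartz_Gam {f g : V → ℝ} (hf : IsSchwartz f) (hg : IsSchwartz g) :
    IsSchwartz (Gam γ f g) := by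
  rw [Gam_eq h1 h2 hf hg]
  exact IsSchwartz.sum fun j _ => IsSchwartz.sum fun k _ =>
    (isSchwartz_flux h1 h2 hf hg j k).creation j

/-- The Leibniz rule for the creation operators. -/
theorem creation_Gam {f g : V → ℝ} (hf : IsSchwartz f) (hg : IsSchwartz g) (i : Fin 3) :
    creation i (Gam γ f g) = fun v => Gam γ (creation i f) g v + Gam γ f (creation i g) v := by
  have hF := isSchwartz_flux h1 h2 hf hg
  have hF1 := isSchwartz_flux h1 h2 (hf.creation i) hg
  have hF2 := isSchwartz_flux h1 h2 hf (hg.creation i)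
  rw [Gam_eq h1 h2 hf hg, Gam_eq h1 h2 (hf.creation i) hg, Gam_eq h1 h2 hf (hg.creation i)]
  rw [creation_sum fun j _ => (IsSchwartz.sum fun k _ => (hF j k).creation j).differentiable]
  funext v
  rw [← Finset.sum_add_distrib]
  refine Finset.sum_congr rfl fun j _ => ?_
  rw [creation_sum fun k _ => ((hF j k).creation j).differentiable, ← Finset.sum_add_distrib]
  refine Finset.sum_congr rfl fun k _ => ?_
  rw [creation_comm (hF j k), creation_flux h1 h2 hf hg,
    creation_add (hF1 j k).differentiable (hF2 j k).differentiable]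

end

/-! ### Conjugation by a weight and the weak form of `Γ` -/

/-- A weight `ω ≥ 1` whose logarithmic gradient is `φ(v) v`, with `|φ| ≤ B`. -/
structure IsWeight (B : ℝ) (ω φ : V → ℝ) : Prop where
  one_le : ∀ v, 1 ≤ ω v
  differentiable : Differentiable ℝ ω
  tg : HasTemperateGrowth φ
  pd_eq : ∀ k v, pd k ω v = φ v * v k * ω v
  abs_le : ∀ v, |φ v| ≤ B

/-- The creation operator conjugated by the weight. -/
noncomputable def wcreation (φ : V → ℝ) (k : Fin 3) (G : V → ℝ) (v : V) : ℝ :=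
  creation k G v + φ v * v k * G v

/-- The annihilation operator conjugated by the inverse of the weight. -/
noncomputable def wannihil (φ : V → ℝ) (k : Fin 3) (G : V → ℝ) (v : V) : ℝ :=
  v k / 2 * G v + pd k G v + φ v * v k * G v

namespace IsWeight

variable {B : ℝ} {ω φ : V → ℝ}

theorem pos (hω : IsWeight B ω φ) (v : V) : 0 < ω v := one_pos.trans_le (hω.one_le v)

theorem hasTemperateGrowth_inv (hω : IsWeight B ω φ) : HasTemperateGrowth fun v => (ω v)⁻¹ := by
  refine hasTemperateGrowth_of_pd_eq_mul (p := fun k v => -(φ v * v k))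
    (fun v => (hω.differentiable v).inv (hω.pos v).ne')
    (fun k => (hasTemperateGrowth_fun_mul hω.tg (hasTemperateGrowth_coord k)).neg) ?_ ⟨0, 1, ?_⟩
  · intro k v
    have h := (hasDerivAt_inv (hω.pos v).ne').comp_hasFDerivAt v (hω.differentiable v).hasFDerivAt
    have h' : pd k (fun v => (ω v)⁻¹) v = -(ω v ^ 2)⁻¹ * pd k ω v := by
      have e : (fun v => (ω v)⁻¹) = Inv.inv ∘ ω := rfl
      rw [pd, e, h.fderiv, pd]
      simp
    rw [h', hω.pd_eq]
    have := (hω.pos v).ne'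
    field_simp
  · intro v
    rw [abs_of_pos (inv_pos.2 (hω.pos v))]
    simpa using inv_le_one_of_one_le₀ (hω.one_le v)

/-- The inverse weight is bounded and its logarithmic derivative has temperate growth, so it is a
multiplier of the Schwartz class. The weight itself may grow too fast to be one. -/
theorem isSchwartz_of_mul (hω : IsWeight B ω φ) {f : V → ℝ}
    (hf : IsSchwartz fun v => ω v * f v) : IsSchwartz f := by
  convert hf.mul_left hω.hasTemperateGrowth_inv using 1
  funext v
  have := (hω.pos v).ne'
  field_simp

theorem mul_creation (hω : IsWeight B ω φ) {f : V → ℝ} (hf : Differentiable ℝ f) (k : Fin 3) :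
    (fun v => ω v * creation k f v) = wcreation φ k (fun v => ω v * f v) := by
  funext v
  rw [wcreation, creation, creation, pd_mul k (hω.differentiable v) (hf v), hω.pd_eq]
  ring

theorem isSchwartz_wcreation (hω : IsWeight B ω φ) {G : V → ℝ} (hG : IsSchwartz G) (k : Fin 3) :
    IsSchwartz (wcreation φ k G) :=
  (hG.creation k).add (hG.mul_left (hasTemperateGrowth_fun_mul hω.tg (hasTemperateGrowth_coord k)))

theorem isSchwartz_wannihil (hω : IsWeight B ω φ) {G : V → ℝ} (hG : IsSchwartz G) (k : Fin 3) :
    IsSchwartz (wannihil φ k G) := by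
  exact ((hG.mul_left (hasTemperateGrowth_coord_half k)).add (hG.pd k)).add
    (hG.mul_left (hasTemperateGrowth_fun_mul hω.tg (hasTemperateGrowth_coord k)))

theorem isSchwartz_mul_creation (hω : IsWeight B ω φ) {f : V → ℝ}
    (hf : IsSchwartz fun v => ω v * f v) (k : Fin 3) :
    IsSchwartz fun v => ω v * creation k f v := by
  rw [hω.mul_creation (hω.isSchwartz_of_mul hf).differentiable]
  exact hω.isSchwartz_wcreation hf k

/-- `wannihil` is the adjoint of `wcreation`. -/
theorem integral_wcreation_mul (hω : IsWeight B ω φ) {X H : V → ℝ} (hX : IsSchwartz X)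
    (hH : IsSchwartz H) (k : Fin 3) :
    ∫ v, wcreation φ k X v * H v = ∫ v, X v * wannihil φ k H v := by
  have hp := hX.integral_pd_mul hH k
  have i1 := ((hX.pd k).mul hH).integrable
  have i2 := (hX.mul (hH.pd k)).integrable
  have hc : HasTemperateGrowth fun v : V => v k / 2 + φ v * v k :=
    (hasTemperateGrowth_coord_half k).add
      (hasTemperateGrowth_fun_mul hω.tg (hasTemperateGrowth_coord k))
  have i3 := ((hX.mul hH).mul_left hc).integrable
  calc _ = ∫ v, ((v k / 2 + φ v * v k) * (X v * H v) - pd k X v * H v) := by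
        congr 1; funext v; rw [wcreation, creation]; ring
    _ = ∫ v, ((v k / 2 + φ v * v k) * (X v * H v) + X v * pd k H v) := by
        rw [integral_sub i3 i1, integral_add i3 i2, hp]; ring
    _ = _ := by congr 1; funext v; rw [wannihil]; ring

variable {γ : ℝ} (h1 : -3 < γ) (h2 : γ < 0)

/-- The flux after conjugation by the weight. -/
noncomputable def _root_.Landau.wflux (γ : ℝ) (φ f G : V → ℝ) (j k : Fin 3) (v : V) : ℝ :=
  coeff γ f j k v * wcreation φ k G v - coeff γ (creation k f) j k v * G v

theorem mul_flux (hω : IsWeight B ω φ) {f g : V → ℝ} (hg : IsSchwartz g)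
    (j k : Fin 3) :
    (fun v => ω v * flux γ f g j k v) = wflux γ φ f (fun v => ω v * g v) j k := by
  funext v
  rw [wflux, ← hω.mul_creation hg.differentiable, flux]
  ring

include h1 h2

theorem isSchwartz_wflux (hω : IsWeight B ω φ) {f G : V → ℝ} (hf : IsSchwartz f)
    (hG : IsSchwartz G) (j k : Fin 3) : IsSchwartz (wflux γ φ f G j k) :=
  ((hω.isSchwartz_wcreation hG k).mul_left (hasTemperateGrowth_coeff h1 h2 hf j k)).sub
    (hG.mul_left (hasTemperateGrowth_coeff h1 h2 (hf.creation k) j k))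

theorem mul_Gam (hω : IsWeight B ω φ) {f g : V → ℝ} (hf : IsSchwartz f)
    (hg : IsSchwartz fun v => ω v * g v) :
    (fun v => ω v * Gam γ f g v) =
      fun v => ∑ j, ∑ k, wcreation φ j (wflux γ φ f (fun v => ω v * g v) j k) v := by
  have hg' := hω.isSchwartz_of_mul hg
  rw [Gam_eq h1 h2 hf hg']
  funext v
  rw [Finset.mul_sum]
  refine Finset.sum_congr rfl fun j _ => ?_
  rw [Finset.mul_sum]
  refine Finset.sum_congr rfl fun k _ => ?_
  rw [← hω.mul_flux hg',
    ← hω.mul_creation (isSchwartz_flux h1 h2 hf hg' j k).differentiable]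

theorem isSchwartz_mul_Gam (hω : IsWeight B ω φ) {f g : V → ℝ} (hf : IsSchwartz f)
    (hg : IsSchwartz fun v => ω v * g v) : IsSchwartz fun v => ω v * Gam γ f g v := by
  rw [hω.mul_Gam h1 h2 hf hg]
  exact IsSchwartz.sum fun j _ => IsSchwartz.sum fun k _ =>
    hω.isSchwartz_wcreation (hω.isSchwartz_wflux h1 h2 hf hg j k) j

/-- The weak form of `ω Γ(f, g)`. -/
theorem integral_mul_Gam (hω : IsWeight B ω φ) {f g H : V → ℝ} (hf : IsSchwartz f)
    (hg : IsSchwartz fun v => ω v * g v) (hH : IsSchwartz H) :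
    ∫ v, (ω v * Gam γ f g v) * H v =
      ∫ v, ∑ j, ∑ k, wflux γ φ f (fun v => ω v * g v) j k v * wannihil φ j H v := by
  have hF := hω.isSchwartz_wflux h1 h2 hf hg
  have e : ∀ v, (ω v * Gam γ f g v) * H v =
      ∑ j, ∑ k, wcreation φ j (wflux γ φ f (fun v => ω v * g v) j k) v * H v := by
    intro v
    rw [show ω v * Gam γ f g v = _ from congrFun (hω.mul_Gam h1 h2 hf hg) v]
    simp only [Finset.sum_mul]
  simp only [e]
  rw [integral_finsetSum _ fun j _ => (IsSchwartz.sum fun k _ =>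
      (hω.isSchwartz_wcreation (hF j k) j).mul hH).integrable,
    integral_finsetSum _ fun j _ => (IsSchwartz.sum fun k _ =>
      (hF j k).mul (hω.isSchwartz_wannihil hH j)).integrable]
  refine Finset.sum_congr rfl fun j _ => ?_
  rw [integral_finsetSum _ fun k _ => ((hω.isSchwartz_wcreation (hF j k) j).mul hH).integrable,
    integral_finsetSum _ fun k _ => ((hF j k).mul (hω.isSchwartz_wannihil hH j)).integrable]
  exact Finset.sum_congr rfl fun k _ => hω.integral_wcreation_mul (hF j k) hH j

end IsWeight

/-! ### Comparison of powers of `⟨v⟩`, `⟨w⟩` and `|v - w|` -/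

theorem one_le_bracket (v : V) : 1 ≤ bracket v := by
  rw [bracket, Real.one_le_sqrt]
  nlinarith [sq_nonneg ‖v‖]

theorem bracket_pos (v : V) : 0 < bracket v := one_pos.trans_le (one_le_bracket v)

theorem bracket_sq (v : V) : bracket v ^ 2 = 1 + ‖v‖ ^ 2 := Real.sq_sqrt (by positivity)

theorem norm_le_bracket (v : V) : ‖v‖ ≤ bracket v := by
  refine Real.le_sqrt_of_sq_le ?_
  linarith

theorem bracket_neg (v : V) : bracket (-v) = bracket v := by rw [bracket, norm_neg, bracket]

theorem bracket_rpow (v : V) (s : ℝ) : bracket v ^ s = (1 + ‖v‖ ^ 2) ^ (s / 2) := by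
  rw [← bracket_sq, ← Real.rpow_two, ← Real.rpow_mul (bracket_pos v).le]
  congr 1
  ring

theorem hasTemperateGrowth_bracket_rpow (s : ℝ) : HasTemperateGrowth fun v => bracket v ^ s := by
  simp only [bracket_rpow]
  exact hasTemperateGrowth_one_add_norm_sq_rpow V _

theorem pd_bracket_rpow (s : ℝ) (k : Fin 3) (v : V) :
    pd k (fun v => bracket v ^ s) v = s * v k * bracket v ^ (s - 2) := by
  have := pd_add_norm_sq_rpow one_pos (0 : V) (s / 2) k v
  simp only [sub_zero, PiLp.zero_apply] at this
  simp only [bracket_rpow]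
  rw [this]
  ring_nf

theorem bracket_le_mul (v w : V) : bracket v ≤ 2 * (bracket (v - w) * bracket w) := by
  have hw := bracket_pos w
  have hz := bracket_pos (v - w)
  refine (pow_le_pow_iff_left₀ (bracket_pos v).le (by positivity) two_ne_zero).1 ?_
  rw [mul_pow, mul_pow, bracket_sq, bracket_sq, bracket_sq]
  have h : ‖v‖ ≤ ‖v - w‖ + ‖w‖ := by simpa using norm_add_le (v - w) w
  have h2 : ‖v‖ ^ 2 ≤ (‖v - w‖ + ‖w‖) ^ 2 := by gcongr
  nlinarith [sq_nonneg (‖v - w‖ - ‖w‖), mul_nonneg (sq_nonneg ‖v - w‖) (sq_nonneg ‖w‖),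
    sq_nonneg ‖w‖, sq_nonneg ‖v - w‖]

theorem bracket_sub_le_mul (v w : V) : bracket (v - w) ≤ 2 * (bracket v * bracket w) := by
  have := bracket_le_mul (v - w) (-w)
  rwa [sub_neg_eq_add, sub_add_cancel, bracket_neg] at this

section

variable {γ : ℝ} (h1 : -3 < γ) (h2 : γ < 0)

include h1 h2

/-- The factor `8 = 2³` dominates `2^{-γ}`. -/
theorem rpow_le_of_le_two_mul {r s : ℝ} (hs : 0 < s) (h : s ≤ 2 * r) : r ^ γ ≤ 8 * s ^ γ := by
  have hr : 0 < r := by linarith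
  calc r ^ γ ≤ (s / 2) ^ γ := Real.rpow_le_rpow_of_nonpos (by positivity) (by linarith) h2.le
    _ = s ^ γ * 2 ^ (-γ) := by
      rw [Real.div_rpow hs.le zero_le_two, Real.rpow_neg zero_le_two, div_eq_mul_inv]
    _ ≤ s ^ γ * 2 ^ (3 : ℝ) := by
      gcongr
      · norm_num
      · linarith
    _ = 8 * s ^ γ := by
      rw [show (2 : ℝ) ^ (3 : ℝ) = 8 by norm_num]
      ring

omit h2 in
theorem rpow_neg_le_cube {s : ℝ} (hs : 1 ≤ s) : s ^ (-γ) ≤ s ^ 3 := by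
  rw [← Real.rpow_natCast]
  exact Real.rpow_le_rpow_of_exponent_le hs (by push_cast; linarith)

/-- Peetre's inequality for a negative exponent. Powers of `⟨w⟩` are harmless throughout, as they
will be absorbed by `√μ(w)`. -/
theorem bracket_sub_rpow_le (v w : V) :
    bracket (v - w) ^ γ ≤ 8 * (bracket v ^ γ * bracket w ^ 3) := by
  have hv := bracket_pos v
  have hw := bracket_pos w
  have h : bracket v / bracket w ≤ 2 * bracket (v - w) := by
    rw [div_le_iff₀ hw]
    linarith [bracket_le_mul v w]
  calc _ ≤ 8 * (bracket v / bracket w) ^ γ := rpow_le_of_le_two_mul h1 h2 (by positivity) h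
    _ = 8 * (bracket v ^ γ * bracket w ^ (-γ)) := by
      rw [Real.div_rpow hv.le hw.le, Real.rpow_neg hw.le, div_eq_mul_inv]
    _ ≤ _ := by
      gcongr
      exact rpow_neg_le_cube h1 (one_le_bracket w)

theorem one_le_bracket_rpow {v w : V} (h : ‖v - w‖ ≤ 1) :
    1 ≤ 64 * (bracket v ^ γ * bracket w ^ 3) := by
  have hb : bracket (v - w) ≤ 2 * 1 := by
    rw [mul_one]
    refine (pow_le_pow_iff_left₀ (bracket_pos _).le zero_le_two two_ne_zero).1 ?_
    rw [bracket_sq]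
    nlinarith [norm_nonneg (v - w)]
  have := rpow_le_of_le_two_mul h1 h2 (bracket_pos _) hb
  rw [Real.one_rpow] at this
  linarith [bracket_sub_rpow_le h1 h2 v w]

theorem norm_sub_rpow_le {v w : V} (h : 1 ≤ ‖v - w‖) :
    ‖v - w‖ ^ γ ≤ 64 * (bracket v ^ γ * bracket w ^ 3) := by
  have hb : bracket (v - w) ≤ 2 * ‖v - w‖ := by
    refine (pow_le_pow_iff_left₀ (bracket_pos _).le (by positivity) two_ne_zero).1 ?_
    rw [bracket_sq]
    nlinarith [norm_nonneg (v - w)]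
  have := rpow_le_of_le_two_mul h1 h2 (bracket_pos _) hb
  linarith [bracket_sub_rpow_le h1 h2 v w]

theorem bracket_rpow_mul_le_norm_sub_rpow {v w : V} (h : v - w ≠ 0) :
    bracket v ^ γ * bracket w ^ γ ≤ 8 * ‖v - w‖ ^ γ := by
  have hz := norm_pos_iff.2 h
  have hb : ‖v - w‖ ≤ 2 * (bracket v * bracket w) :=
    (norm_le_bracket _).trans (bracket_sub_le_mul v w)
  rw [← Real.mul_rpow (bracket_pos v).le (bracket_pos w).le]
  exact rpow_le_of_le_two_mul h1 h2 hz hb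

/-- Far from the diagonal `|z|^γ` is comparable to `⟨v⟩^γ` up to powers of `⟨w⟩`; near it, `1 + γ ≥
-2` allows `|z|⁻²`, and `⟨v⟩^γ` is inserted for free since `⟨v⟩` and `⟨w⟩` are comparable. -/
theorem norm_mul_norm_rpow_le (v w : V) : ‖v - w‖ * ‖v - w‖ ^ γ ≤
    128 * (bracket v ^ γ * bracket w ^ 4 * (bracket v + (‖v - w‖ ^ 2)⁻¹)) := by
  have hv := bracket_pos v
  have hw := bracket_pos w
  have hw1 := one_le_bracket w
  have hvg : 0 < bracket v ^ γ := Real.rpow_pos_of_pos hv _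
  rcases eq_or_ne (v - w) 0 with h0 | h0
  · rw [h0, norm_zero, zero_mul]
    positivity
  have hz := norm_pos_iff.2 h0
  have hi : 0 ≤ (‖v - w‖ ^ 2)⁻¹ := by positivity
  have h34 : bracket w ^ 3 ≤ bracket w ^ 4 := pow_le_pow_right₀ hw1 (by norm_num)
  rcases le_total 1 ‖v - w‖ with h | h
  · calc _ ≤ (2 * (bracket v * bracket w)) * (64 * (bracket v ^ γ * bracket w ^ 3)) := by
          gcongr
          · exact (norm_le_bracket _).trans (bracket_sub_le_mul v w)
          · exact norm_sub_rpow_le h1 h2 h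
      _ = 128 * (bracket v ^ γ * bracket w ^ 4 * bracket v) := by ring
      _ ≤ _ := by gcongr; linarith
  · have e : ‖v - w‖ * ‖v - w‖ ^ γ ≤ (‖v - w‖ ^ 2)⁻¹ := by
      calc _ = ‖v - w‖ ^ (1 + γ) := by rw [Real.rpow_add hz, Real.rpow_one]
        _ ≤ ‖v - w‖ ^ (-2 : ℝ) := Real.rpow_le_rpow_of_exponent_ge hz h (by linarith)
        _ = _ := by rw [Real.rpow_neg hz.le, Real.rpow_two]
    calc _ ≤ 1 * (‖v - w‖ ^ 2)⁻¹ := by rwa [one_mul]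
      _ ≤ 64 * (bracket v ^ γ * bracket w ^ 3) * (‖v - w‖ ^ 2)⁻¹ := by
        gcongr
        exact one_le_bracket_rpow h1 h2 h
      _ ≤ 128 * (bracket v ^ γ * bracket w ^ 4) * (‖v - w‖ ^ 2)⁻¹ := by
        gcongr
        norm_num
      _ = 128 * (bracket v ^ γ * bracket w ^ 4 * (‖v - w‖ ^ 2)⁻¹) := by ring
      _ ≤ _ := by gcongr; linarith

end

/-! ### The anisotropic quadratic form -/

/-- The inner product `(z × x) · (z × y)` of cross products. -/
noncomputable def crossDot (z : V) (x y : Fin 3 → ℝ) : ℝ :=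
  (z 0 * x 1 - z 1 * x 0) * (z 0 * y 1 - z 1 * y 0) +
  (z 1 * x 2 - z 2 * x 1) * (z 1 * y 2 - z 2 * y 1) +
  (z 2 * x 0 - z 0 * x 2) * (z 2 * y 0 - z 0 * y 2)

theorem sum_collisionMatrix (γ : ℝ) (z : V) (x y : Fin 3 → ℝ) :
    ∑ j, ∑ k, collisionMatrix γ j k z * x j * y k = ‖z‖ ^ γ * crossDot z x y := by
  have h := norm_sq_eq_sum z
  simp only [collisionMatrix, h, Fin.sum_univ_three, crossDot]
  simp
  ring

theorem crossDot_self_nonneg (z : V) (x : Fin 3 → ℝ) : 0 ≤ crossDot z x x := by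
  unfold crossDot
  nlinarith [sq_nonneg (z 0 * x 1 - z 1 * x 0), sq_nonneg (z 1 * x 2 - z 2 * x 1),
    sq_nonneg (z 2 * x 0 - z 0 * x 2)]

theorem crossDot_self_eq (z : V) (x : Fin 3 → ℝ) :
    crossDot z x x = ‖z‖ ^ 2 * ∑ i, x i ^ 2 - (∑ i, z i * x i) ^ 2 := by
  rw [norm_sq_eq_sum]
  simp only [Fin.sum_univ_three, crossDot]
  ring

theorem crossDot_self_le (z : V) (x : Fin 3 → ℝ) : crossDot z x x ≤ ‖z‖ ^ 2 * ∑ i, x i ^ 2 := by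
  rw [crossDot_self_eq]
  linarith [sq_nonneg (∑ i, z i * x i)]

theorem crossDot_parallelogram (v w : V) (x : Fin 3 → ℝ) :
    crossDot (v - w) x x + crossDot (v + w) x x = 2 * crossDot v x x + 2 * crossDot w x x := by
  simp only [crossDot, PiLp.sub_apply, PiLp.add_apply]
  ring

theorem crossDot_sub_le (v w : V) (x : Fin 3 → ℝ) :
    crossDot (v - w) x x ≤ 2 * crossDot v x x + 2 * crossDot w x x := by
  rw [← crossDot_parallelogram]
  linarith [crossDot_self_nonneg (v + w) x]

theorem crossDot_add_le (z : V) (x y : Fin 3 → ℝ) :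
    crossDot z (fun i => x i + y i) (fun i => x i + y i) ≤
      2 * crossDot z x x + 2 * crossDot z y y := by
  have h : crossDot z (fun i => x i + y i) (fun i => x i + y i) +
      crossDot z (fun i => x i - y i) (fun i => x i - y i) =
      2 * crossDot z x x + 2 * crossDot z y y := by
    simp only [crossDot]
    ring
  linarith [crossDot_self_nonneg z (fun i => x i - y i)]

theorem abs_crossDot_le (z : V) (x y : Fin 3 → ℝ) :
    |crossDot z x y| ≤ Real.sqrt (crossDot z x x) * Real.sqrt (crossDot z y y) := by
  rw [← Real.sqrt_mul (crossDot_self_nonneg z x)]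
  refine Real.abs_le_sqrt ?_
  have h := sum_mul_sq_le ![z 0 * x 1 - z 1 * x 0, z 1 * x 2 - z 2 * x 1, z 2 * x 0 - z 0 * x 2]
    ![z 0 * y 1 - z 1 * y 0, z 1 * y 2 - z 2 * y 1, z 2 * y 0 - z 0 * y 2]
  simp [Fin.sum_univ_three] at h
  simp only [crossDot]
  linarith

/-- The anisotropic quadratic form `⟨v⟩^γ (|x|² + |v × x|²)`. -/
noncomputable def aniso (γ : ℝ) (v : V) (x : Fin 3 → ℝ) : ℝ :=
  bracket v ^ γ * (∑ i, x i ^ 2 + crossDot v x x)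

theorem aniso_nonneg (γ : ℝ) (v : V) (x : Fin 3 → ℝ) : 0 ≤ aniso γ v x :=
  mul_nonneg (Real.rpow_nonneg (bracket_pos v).le _)
    (add_nonneg (Finset.sum_nonneg fun _ _ => sq_nonneg _) (crossDot_self_nonneg v x))

theorem aniso_add_le (γ : ℝ) (v : V) (x y : Fin 3 → ℝ) :
    aniso γ v (fun i => x i + y i) ≤ 2 * aniso γ v x + 2 * aniso γ v y := by
  have h : ∑ i, (x i + y i) ^ 2 ≤ 2 * ∑ i, x i ^ 2 + 2 * ∑ i, y i ^ 2 := by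
    rw [Finset.mul_sum, Finset.mul_sum, ← Finset.sum_add_distrib]
    exact Finset.sum_le_sum fun i _ => by nlinarith [sq_nonneg (x i - y i)]
  have hb := Real.rpow_nonneg (bracket_pos v).le γ
  unfold aniso
  calc _ ≤ bracket v ^ γ * ((2 * ∑ i, x i ^ 2 + 2 * ∑ i, y i ^ 2) +
        (2 * crossDot v x x + 2 * crossDot v y y)) := by
        gcongr
        exact crossDot_add_le v x y
    _ = _ := by ring

/-- The cross product term vanishes on multiples of `v`. This makes both the harmonic term `v_k/2`
and the gradient of the weight affordable. -/
theorem aniso_smul_self (γ : ℝ) (v : V) (c : ℝ) :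
    aniso γ v (fun i => c * v i) = bracket v ^ γ * (c ^ 2 * ‖v‖ ^ 2) := by
  rw [aniso, norm_sq_eq_sum]
  simp only [crossDot, Fin.sum_univ_three]
  ring

theorem bracket_mul_sum_le_aniso (γ : ℝ) (v : V) (x : Fin 3 → ℝ) :
    bracket v ^ γ * ∑ i, x i ^ 2 ≤ aniso γ v x := by
  have hb := Real.rpow_nonneg (bracket_pos v).le γ
  unfold aniso
  gcongr
  linarith [crossDot_self_nonneg v x]

section

variable {γ : ℝ} (h1 : -3 < γ) (h2 : γ < 0)

include h1 h2

/-- For `|v-w| ≥ 1`, split `(v-w) × x` into `v × x` and `w × x`, the latter costing `⟨w⟩²`. For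
`|v-w| ≤ 1`, the two powers in the cross product reduce the singularity to `|z|^{γ+2} ≤ |z|⁻¹`. -/
theorem norm_rpow_mul_crossDot_le (v w : V) (x : Fin 3 → ℝ) :
    ‖v - w‖ ^ γ * crossDot (v - w) x x ≤
      128 * (bracket w ^ 5 * (1 + ‖v - w‖⁻¹)) * aniso γ v x := by
  have hv := bracket_pos v
  have hw := bracket_pos w
  have hw1 := one_le_bracket w
  have hvg : 0 < bracket v ^ γ := Real.rpow_pos_of_pos hv _
  have hx : 0 ≤ ∑ i, x i ^ 2 := Finset.sum_nonneg fun _ _ => sq_nonneg _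
  have hc := crossDot_self_nonneg v x
  have ha := aniso_nonneg γ v x
  rcases eq_or_ne (v - w) 0 with h0 | h0
  · rw [h0, norm_zero, Real.zero_rpow h2.ne, zero_mul]
    positivity
  have hz := norm_pos_iff.2 h0
  have hi : 0 ≤ ‖v - w‖⁻¹ := by positivity
  rcases le_total 1 ‖v - w‖ with h | h
  · have e : crossDot (v - w) x x ≤ 2 * bracket w ^ 2 * (∑ i, x i ^ 2 + crossDot v x x) := by
      have := crossDot_sub_le v w x
      have := crossDot_self_le w x
      rw [bracket_sq]
      nlinarith [mul_nonneg (sq_nonneg ‖w‖) hc]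
    calc _ ≤ (64 * (bracket v ^ γ * bracket w ^ 3)) *
          (2 * bracket w ^ 2 * (∑ i, x i ^ 2 + crossDot v x x)) :=
          mul_le_mul (norm_sub_rpow_le h1 h2 h) e (crossDot_self_nonneg _ _) (by positivity)
      _ = 128 * (bracket w ^ 5 * 1) * aniso γ v x := by unfold aniso; ring
      _ ≤ _ := by gcongr; linarith
  · have e : ‖v - w‖ ^ γ * crossDot (v - w) x x ≤ ‖v - w‖⁻¹ * ∑ i, x i ^ 2 := by
      calc _ ≤ ‖v - w‖ ^ γ * (‖v - w‖ ^ 2 * ∑ i, x i ^ 2) := by gcongr; exact crossDot_self_le _ _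
        _ = ‖v - w‖ ^ (γ + 2) * ∑ i, x i ^ 2 := by rw [Real.rpow_add hz, Real.rpow_two]; ring
        _ ≤ ‖v - w‖ ^ (-1 : ℝ) * ∑ i, x i ^ 2 := by
          gcongr ?_ * _
          exact Real.rpow_le_rpow_of_exponent_ge hz h (by linarith)
        _ = _ := by rw [Real.rpow_neg_one]
    calc _ ≤ 1 * (‖v - w‖⁻¹ * ∑ i, x i ^ 2) := by rwa [one_mul]
      _ ≤ 64 * (bracket v ^ γ * bracket w ^ 3) * (‖v - w‖⁻¹ * ∑ i, x i ^ 2) := by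
        gcongr
        exact one_le_bracket_rpow h1 h2 h
      _ = 64 * (bracket w ^ 3 * ‖v - w‖⁻¹) * (bracket v ^ γ * ∑ i, x i ^ 2) := by ring
      _ ≤ 128 * (bracket w ^ 5 * ‖v - w‖⁻¹) * aniso γ v x := by
        gcongr ?_ * (?_ * _) * ?_
        · norm_num
        · exact pow_le_pow_right₀ hw1 (by norm_num)
        · exact bracket_mul_sum_le_aniso γ v x
      _ ≤ _ := by gcongr; linarith

theorem abs_collision_form_le (v w : V) (x y : Fin 3 → ℝ) :
    |∑ j, ∑ k, collisionMatrix γ j k (v - w) * x j * y k| ≤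
      128 * (bracket w ^ 5 * (1 + ‖v - w‖⁻¹)) *
        (Real.sqrt (aniso γ v x) * Real.sqrt (aniso γ v y)) := by
  have hz := Real.rpow_nonneg (norm_nonneg (v - w)) γ
  have hw := bracket_pos w
  set M := 128 * (bracket w ^ 5 * (1 + ‖v - w‖⁻¹)) with hM
  have hM0 : 0 ≤ M := by rw [hM]; positivity
  rw [sum_collisionMatrix, abs_mul, abs_of_nonneg hz]
  calc _ ≤ ‖v - w‖ ^ γ * (Real.sqrt (crossDot (v - w) x x) * Real.sqrt (crossDot (v - w) y y)) := by
        gcongr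
        exact abs_crossDot_le _ _ _
    _ = Real.sqrt (‖v - w‖ ^ γ * crossDot (v - w) x x) *
          Real.sqrt (‖v - w‖ ^ γ * crossDot (v - w) y y) := by
        rw [Real.sqrt_mul hz, Real.sqrt_mul hz]
        nth_rewrite 1 [← Real.mul_self_sqrt hz]
        ring
    _ ≤ Real.sqrt (M * aniso γ v x) * Real.sqrt (M * aniso γ v y) := by
        exact mul_le_mul (Real.sqrt_le_sqrt (norm_rpow_mul_crossDot_le h1 h2 v w x))
          (Real.sqrt_le_sqrt (norm_rpow_mul_crossDot_le h1 h2 v w y)) (Real.sqrt_nonneg _)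
          (Real.sqrt_nonneg _)
    _ = _ := by
        rw [Real.sqrt_mul hM0, Real.sqrt_mul hM0]
        nth_rewrite 3 [← Real.mul_self_sqrt hM0]
        ring

end

/-! ### Coercivity of the norm `‖·‖_A` -/

theorem averagedMatrix_eq_coeff (γ : ℝ) (j k : Fin 3) :
    averagedMatrix γ j k = coeff γ sqrtMu j k := by
  funext v
  simp only [averagedMatrix, coeff, kconv, sqrtMu_mul_self]

theorem sum_kconv_collisionMatrix {γ : ℝ} (h1 : -3 < γ) (h2 : γ < 0) {G : V → ℝ}
    (hG : IsSchwartz G) (v : V) (x y : Fin 3 → ℝ) :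
    Integrable (fun w => (∑ j, ∑ k, collisionMatrix γ j k (v - w) * x k * y j) * G w) ∧
    ∑ j, ∑ k, kconv (collisionMatrix γ j k) G v * x k * y j =
      ∫ w, (∑ j, ∑ k, collisionMatrix γ j k (v - w) * x k * y j) * G w := by
  have hi : ∀ j k, Integrable fun w => (collisionMatrix γ j k (v - w) * x k * y j) * G w := by
    intro j k
    refine (((isKernel_collisionMatrix h1 h2 j k).integrable hG v).const_mul (x k * y j)).congr
      (ae_of_all _ fun w => ?_)
    simp only
    ring
  have hs : ∀ w, (∑ j, ∑ k, collisionMatrix γ j k (v - w) * x k * y j) * G w =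
      ∑ j, ∑ k, (collisionMatrix γ j k (v - w) * x k * y j) * G w := fun w => by
    simp only [Finset.sum_mul]
  simp only [hs]
  refine ⟨integrable_finsetSum _ fun j _ => integrable_finsetSum _ fun k _ => hi j k, ?_⟩
  rw [integral_finsetSum _ fun j _ => integrable_finsetSum _ fun k _ => hi j k]
  refine Finset.sum_congr rfl fun j _ => ?_
  rw [integral_finsetSum _ fun k _ => hi j k]
  refine Finset.sum_congr rfl fun k _ => ?_
  rw [kconv, mul_assoc, ← integral_mul_const]
  congr 1
  funext w
  ring

theorem inner_eq_sum (w x : V) : inner ℝ w x = ∑ i : Fin 3, w i * x i := by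
  rw [PiLp.inner_apply]
  exact Finset.sum_congr rfl fun i _ => by simp [mul_comm]

/-- Second moments of a radial density are isotropic. -/
theorem integral_radial_inner_sq {ρ : V → ℝ} (hρ : IsSchwartz ρ)
    (hr : ∀ v w : V, ‖v‖ = ‖w‖ → ρ v = ρ w) (x : V) :
    ∫ w, ρ w * (∑ i, w i * x i) ^ 2 = (∑ i, x i ^ 2) / 3 * ∫ w, ρ w * ‖w‖ ^ 2 := by
  set J : V → ℝ := fun x => ∫ w, ρ w * (inner ℝ w x) ^ 2 with hJ
  -- The reflection exchanging two vectors of equal length preserves Lebesgue measure and `ρ`, so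
  -- `J` depends only on the length; coordinate vectors then determine it.
  have hinv : ∀ x y : V, ‖x‖ = ‖y‖ → J x = J y := by
    intro x y hxy
    set R := (ℝ ∙ (x - y))ᗮ.reflection
    have hR : R x = y := Submodule.reflection_sub hxy
    rw [hJ]
    simp only
    conv_rhs => rw [← R.measurePreserving.integral_comp R.toHomeomorph.measurableEmbedding]
    congr 1
    funext w
    rw [hr (R w) w (R.norm_map w), ← hR, R.inner_map_map]
  have hJi : ∀ i, J (EuclideanSpace.single i ‖x‖) = ‖x‖ ^ 2 * ∫ w, ρ w * w i ^ 2 := by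
    intro i
    rw [hJ, ← integral_const_mul]
    simp only
    congr 1
    funext w
    rw [EuclideanSpace.inner_single_right]
    simp
    ring
  have hJx : ∀ i, J x = ‖x‖ ^ 2 * ∫ w, ρ w * w i ^ 2 := fun i => by
    rw [← hJi i]
    exact hinv _ _ (by simp)
  have hi : ∀ i : Fin 3, Integrable fun w : V => ρ w * w i ^ 2 := fun i =>
    (hρ.mul_right ((hasTemperateGrowth_coord i).pow 2)).integrable
  have hsum : ∫ w, ρ w * ‖w‖ ^ 2 = ∑ i : Fin 3, ∫ w, ρ w * w i ^ 2 := by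
    rw [← integral_finsetSum _ fun i _ => hi i]
    congr 1
    funext w
    rw [norm_sq_eq_sum, Finset.mul_sum]
  have e : ∫ w, ρ w * (∑ i, w i * x i) ^ 2 = J x := by
    rw [hJ]
    simp only [inner_eq_sum]
  rw [e, hsum, ← norm_sq_eq_sum]
  have h0 := hJx 0
  have h1 := hJx 1
  have h2 := hJx 2
  rw [Fin.sum_univ_three]
  linarith

theorem hasTemperateGrowth_crossDot_sub (v : V) (x : Fin 3 → ℝ) :
    HasTemperateGrowth fun w : V => crossDot (v - w) x x := by
  have hl : ∀ i j : Fin 3, HasTemperateGrowth fun w : V =>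
      (v - w) i * x j - (v - w) j * x i := by
    intro i j
    have hs : ∀ i : Fin 3, HasTemperateGrowth fun w : V => (v - w) i := fun i =>
      (HasTemperateGrowth.const (v i)).sub (hasTemperateGrowth_coord i)
    exact (hasTemperateGrowth_fun_mul (hs i) (HasTemperateGrowth.const _)).sub
      (hasTemperateGrowth_fun_mul (hs j) (HasTemperateGrowth.const _))
  exact ((hasTemperateGrowth_fun_mul (hl 0 1) (hl 0 1)).add
    (hasTemperateGrowth_fun_mul (hl 1 2) (hl 1 2))).add
    (hasTemperateGrowth_fun_mul (hl 2 0) (hl 2 0))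

theorem integral_pos_of_isSchwartz {ρ : V → ℝ} (hρ : IsSchwartz ρ) (h0 : ∀ v, 0 ≤ ρ v) {v : V}
    (hv : ρ v ≠ 0) : 0 < ∫ w, ρ w :=
  integral_pos_of_integrable_nonneg_nonzero hρ.continuous hρ.integrable h0 hv

/-- Bound `|v-w|^γ` below by `⟨v⟩^γ ⟨w⟩^γ / 8`, which leaves an even density `ρ`. Averaging over `w`
and `-w`, the parallelogram law splits `|(v-w) × x|²` into `|v × x|²` and `|w × x|²`, and the mean
of the latter is isotropic. -/
theorem averaged_form_lower {γ : ℝ} (h1 : -3 < γ) (h2 : γ < 0) :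
    ∃ c, 0 < c ∧ ∀ (v : V) (x : Fin 3 → ℝ),
      c * aniso γ v x ≤ ∑ j, ∑ k, averagedMatrix γ j k v * x k * x j := by
  set ρ : V → ℝ := fun w => bracket w ^ γ * maxwellian w with hρd
  have hρ : IsSchwartz ρ := isSchwartz_maxwellian.mul_left (hasTemperateGrowth_bracket_rpow γ)
  have hρ0 : ∀ v, 0 < ρ v := fun v =>
    mul_pos (Real.rpow_pos_of_pos (bracket_pos v) _) (maxwellian_pos v)
  have hr : ∀ v w : V, ‖v‖ = ‖w‖ → ρ v = ρ w := by
    intro v w h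
    simp only [hρd, bracket, maxwellian, h]
  have hρ2 : IsSchwartz fun w => ρ w * ‖w‖ ^ 2 := hρ.mul_right (hasTemperateGrowth_norm_sq V)
  have m0 : 0 < ∫ w, ρ w := integral_pos_of_isSchwartz hρ (fun v => (hρ0 v).le) (hρ0 0).ne'
  have m2 : 0 < ∫ w, ρ w * ‖w‖ ^ 2 := by
    refine integral_pos_of_isSchwartz hρ2 (fun v => mul_nonneg (hρ0 v).le (sq_nonneg _))
      (v := EuclideanSpace.single 0 1) ?_
    have := (hρ0 (EuclideanSpace.single 0 1)).ne'
    simp [this]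
  -- The two entries are the coefficients of `|v × x|²` and `|x|²`; `2/3` is one minus the isotropic
  -- fraction `1/3`.
  refine ⟨min (∫ w, ρ w) (2 / 3 * ∫ w, ρ w * ‖w‖ ^ 2) / 8, by positivity, fun v x => ?_⟩
  obtain ⟨hi, he⟩ := sum_kconv_collisionMatrix h1 h2 isSchwartz_maxwellian v x x
  have havg : ∑ j, ∑ k, averagedMatrix γ j k v * x k * x j =
      ∫ w, (∑ j, ∑ k, collisionMatrix γ j k (v - w) * x k * x j) * maxwellian w := by
    rw [← he]
    rfl
  have hsw : ∀ z, ∑ j, ∑ k, collisionMatrix γ j k z * x k * x j = ‖z‖ ^ γ * crossDot z x x := by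
    intro z
    rw [← sum_collisionMatrix]
    exact Finset.sum_congr rfl fun j _ => Finset.sum_congr rfl fun k _ => by ring
  simp only [hsw] at hi havg
  rw [havg]
  have hvg : 0 < bracket v ^ γ := Real.rpow_pos_of_pos (bracket_pos v) _
  have i0 : Integrable fun w => ρ w * crossDot v x x := hρ.integrable.mul_const _
  have i1 : Integrable fun w => ρ w * crossDot (v - w) x x :=
    (hρ.mul_right (hasTemperateGrowth_crossDot_sub v x)).integrable
  have i2 : Integrable fun w => ρ w * crossDot (v + w) x x := by
    refine i1.comp_neg.congr (ae_of_all _ fun w => ?_)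
    simp only [sub_neg_eq_add]
    rw [hr (-w) w (norm_neg w)]
  have i3 : Integrable fun w => ρ w * crossDot w x x := by
    have : IsSchwartz fun w => ρ w * crossDot (0 - w) x x :=
      hρ.mul_right (hasTemperateGrowth_crossDot_sub 0 x)
    refine this.integrable.congr (ae_of_all _ fun w => ?_)
    simp only [crossDot, zero_sub, PiLp.neg_apply]
    ring
  have e12 : ∫ w, ρ w * crossDot (v - w) x x = ∫ w, ρ w * crossDot (v + w) x x := by
    rw [← integral_neg_eq_self]
    congr 1
    funext w
    rw [hr (-w) w (norm_neg w), sub_neg_eq_add]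
  have esum : ∫ w, ρ w * crossDot (v - w) x x =
      crossDot v x x * (∫ w, ρ w) + ∫ w, ρ w * crossDot w x x := by
    have : (∫ w, ρ w * crossDot (v - w) x x) + ∫ w, ρ w * crossDot (v + w) x x =
        2 * (crossDot v x x * ∫ w, ρ w) + 2 * ∫ w, ρ w * crossDot w x x := by
      rw [← integral_add i1 i2, ← integral_const_mul, ← integral_const_mul, ← integral_const_mul,
        ← integral_add ((hρ.integrable.const_mul _).const_mul _) (i3.const_mul _)]
      congr 1
      funext w
      rw [← mul_add, crossDot_parallelogram]
      ring
    rw [← e12] at this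
    linarith
  have e3 : ∫ w, ρ w * crossDot w x x = 2 / 3 * (∫ w, ρ w * ‖w‖ ^ 2) * ∑ i, x i ^ 2 := by
    have hin := integral_radial_inner_sq hρ hr (WithLp.toLp 2 x)
    simp only at hin
    have hii : Integrable fun w : V => ρ w * (∑ i, w i * x i) ^ 2 := by
      refine (hρ.mul_right (HasTemperateGrowth.pow (f := fun w : V => ∑ i, w i * x i) ?_ 2)).integrable
      exact HasTemperateGrowth.sum fun i _ =>
        hasTemperateGrowth_fun_mul (hasTemperateGrowth_coord i) (HasTemperateGrowth.const _)
    calc _ = ∫ w, ((∑ i, x i ^ 2) * (ρ w * ‖w‖ ^ 2) - ρ w * (∑ i, w i * x i) ^ 2) := by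
          congr 1
          funext w
          rw [crossDot_self_eq]
          ring
      _ = _ := by
          rw [integral_sub (hρ2.integrable.const_mul _) hii, integral_const_mul, hin]
          ring
  have hx : 0 ≤ ∑ i, x i ^ 2 := Finset.sum_nonneg fun _ _ => sq_nonneg _
  have hc := crossDot_self_nonneg v x
  have hlow : min (∫ w, ρ w) (2 / 3 * ∫ w, ρ w * ‖w‖ ^ 2) * (∑ i, x i ^ 2 + crossDot v x x) ≤
      ∫ w, ρ w * crossDot (v - w) x x := by
    rw [esum, e3, mul_add]
    have a1 := mul_le_mul_of_nonneg_right
      (min_le_left (∫ w, ρ w) (2 / 3 * ∫ w, ρ w * ‖w‖ ^ 2)) hc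
    have a2 := mul_le_mul_of_nonneg_right
      (min_le_right (∫ w, ρ w) (2 / 3 * ∫ w, ρ w * ‖w‖ ^ 2)) hx
    linarith
  have hpt : ∀ w, bracket v ^ γ / 8 * (ρ w * crossDot (v - w) x x) ≤
      ‖v - w‖ ^ γ * crossDot (v - w) x x * maxwellian w := by
    intro w
    have hcw := crossDot_self_nonneg (v - w) x
    have hm := (maxwellian_pos w).le
    rcases eq_or_ne (v - w) 0 with h0 | h0
    · rw [h0]
      simp [crossDot]
    · have := bracket_rpow_mul_le_norm_sub_rpow h1 h2 h0
      have h8 : bracket v ^ γ / 8 * bracket w ^ γ ≤ ‖v - w‖ ^ γ := by linarith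
      calc _ = (bracket v ^ γ / 8 * bracket w ^ γ) * crossDot (v - w) x x * maxwellian w := by
            rw [hρd]; ring
        _ ≤ _ := by gcongr
  calc _ = bracket v ^ γ / 8 * (min (∫ w, ρ w) (2 / 3 * ∫ w, ρ w * ‖w‖ ^ 2) *
        (∑ i, x i ^ 2 + crossDot v x x)) := by unfold aniso; ring
    _ ≤ bracket v ^ γ / 8 * ∫ w, ρ w * crossDot (v - w) x x := by gcongr
    _ = ∫ w, bracket v ^ γ / 8 * (ρ w * crossDot (v - w) x x) := by rw [integral_const_mul]
    _ ≤ _ := integral_mono (i1.const_mul _) hi hpt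

/-- The energy density `⟨v⟩^γ (|∇G|² + |v × ∇G|² + ⟨v⟩² G²)`. -/
noncomputable def dens (γ : ℝ) (G : V → ℝ) (v : V) : ℝ :=
  aniso γ v (fun i => pd i G v) + bracket v ^ γ * bracket v ^ 2 * G v ^ 2

theorem dens_nonneg (γ : ℝ) (G : V → ℝ) (v : V) : 0 ≤ dens γ G v :=
  add_nonneg (aniso_nonneg _ _ _) (mul_nonneg (mul_nonneg (Real.rpow_nonneg (bracket_pos v).le _)
    (sq_nonneg _)) (sq_nonneg _))

theorem isSchwartz_aniso (γ : ℝ) {X : Fin 3 → V → ℝ} (hX : ∀ i, IsSchwartz (X i)) :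
    IsSchwartz fun v => aniso γ v (fun i => X i v) := by
  have hl : ∀ i j : Fin 3, IsSchwartz fun v : V => v i * X j v - v j * X i v := fun i j =>
    ((hX j).mul_left (hasTemperateGrowth_coord i)).sub ((hX i).mul_left (hasTemperateGrowth_coord j))
  have hs : IsSchwartz fun v => ∑ i, X i v ^ 2 + crossDot v (fun i => X i v) (fun i => X i v) :=
    (IsSchwartz.sum fun i _ => (hX i).sq).add
      ((((hl 0 1).mul (hl 0 1)).add ((hl 1 2).mul (hl 1 2))).add ((hl 2 0).mul (hl 2 0)))
  exact hs.mul_left (hasTemperateGrowth_bracket_rpow γ)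

theorem IsSchwartz.bracket_mul_sq (γ : ℝ) {G : V → ℝ} (hG : IsSchwartz G) :
    IsSchwartz fun v => bracket v ^ γ * G v ^ 2 :=
  hG.sq.mul_left (hasTemperateGrowth_bracket_rpow γ)

theorem hasTemperateGrowth_bracket_sq : HasTemperateGrowth fun v => bracket v ^ 2 := by
  have := hasTemperateGrowth_bracket_rpow 2
  simpa only [Real.rpow_two] using this

theorem isSchwartz_dens (γ : ℝ) {G : V → ℝ} (hG : IsSchwartz G) : IsSchwartz (dens γ G) :=
  (isSchwartz_aniso γ fun i => hG.pd i).add (hG.sq.mul_left (hasTemperateGrowth_fun_mul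
    (hasTemperateGrowth_bracket_rpow γ) hasTemperateGrowth_bracket_sq))

/-- The divergence of `v ⟨v⟩^γ` is at least `(3+γ) ⟨v⟩^γ`. This supplies the zero order mass near
the origin, where the term `|v|² G²` degenerates. -/
theorem weighted_poincare {γ : ℝ} (h2 : γ < 0) {G : V → ℝ} (hG : IsSchwartz G) :
    (3 + γ) * ∫ v, bracket v ^ γ * G v ^ 2 ≤
      ∫ v, bracket v ^ γ * (‖v‖ ^ 2 * G v ^ 2 + gradSq G v) := by
  have hb := hasTemperateGrowth_bracket_rpow γ
  have hX : ∀ k : Fin 3, HasTemperateGrowth fun v : V => v k * bracket v ^ γ := fun k =>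
    hasTemperateGrowth_fun_mul (hasTemperateGrowth_coord k) hb
  have key := integral_divergence_sq hX hG
  have i1 := (hG.bracket_mul_sq γ).integrable.const_mul (3 + γ)
  have i2 : Integrable fun v => bracket v ^ γ * (‖v‖ ^ 2 * G v ^ 2 + gradSq G v) :=
    (((hG.sq.mul_left (hasTemperateGrowth_norm_sq V)).add hG.gradSq).mul_left hb).integrable
  have i3 : Integrable fun v => (∑ k, pd k (fun v : V => v k * bracket v ^ γ) v) * G v ^ 2 +
      2 * G v * ∑ k, v k * bracket v ^ γ * pd k G v :=
    ((hG.sq.mul_left (HasTemperateGrowth.sum fun k _ => pd_hasTemperateGrowth (hX k) k)).add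
      ((hG.mul_left (HasTemperateGrowth.const 2)).mul
        (IsSchwartz.sum fun k _ => (hG.pd k).mul_left (hX k)))).integrable
  have hpt : ∀ v, (3 + γ) * (bracket v ^ γ * G v ^ 2) -
      bracket v ^ γ * (‖v‖ ^ 2 * G v ^ 2 + gradSq G v) ≤
      (∑ k, pd k (fun v : V => v k * bracket v ^ γ) v) * G v ^ 2 +
      2 * G v * ∑ k, v k * bracket v ^ γ * pd k G v := by
    intro v
    have hbp := bracket_pos v
    have hvg : 0 < bracket v ^ γ := Real.rpow_pos_of_pos hbp _
    have hpd : ∀ k, pd k (fun v : V => v k * bracket v ^ γ) v =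
        bracket v ^ γ + γ * v k ^ 2 * bracket v ^ (γ - 2) := by
      intro k
      rw [pd_mul k ((hasTemperateGrowth_coord k).1.differentiable (by simp) v)
        (hb.1.differentiable (by simp) v), pd_coord, pd_bracket_rpow]
      simp
      ring
    have hdiv : (3 + γ) * bracket v ^ γ ≤ ∑ k, pd k (fun v : V => v k * bracket v ^ γ) v := by
      have e : ∑ k, pd k (fun v : V => v k * bracket v ^ γ) v =
          3 * bracket v ^ γ + γ * (‖v‖ ^ 2 * bracket v ^ (γ - 2)) := by
        rw [norm_sq_eq_sum]
        simp only [hpd, Fin.sum_univ_three]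
        ring
      have e2 : bracket v ^ γ = bracket v ^ 2 * bracket v ^ (γ - 2) := by
        rw [← Real.rpow_two, ← Real.rpow_add hbp]
        congr 1
        ring
      have hle : ‖v‖ ^ 2 * bracket v ^ (γ - 2) ≤ bracket v ^ γ := by
        rw [e2, bracket_sq]
        gcongr
        linarith
      rw [e]
      nlinarith
    set S := ∑ k, v k * pd k G v with hS
    have hS' : ∑ k, v k * bracket v ^ γ * pd k G v = bracket v ^ γ * S := by
      rw [hS, Finset.mul_sum]
      exact Finset.sum_congr rfl fun k _ => by ring
    have hSG : -(‖v‖ ^ 2 * G v ^ 2 + gradSq G v) ≤ 2 * G v * S := by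
      rw [norm_sq_eq_sum, hS, gradSq]
      simp only [Fin.sum_univ_three]
      nlinarith [sq_nonneg (v 0 * G v + pd 0 G v), sq_nonneg (v 1 * G v + pd 1 G v),
        sq_nonneg (v 2 * G v + pd 2 G v)]
    rw [hS']
    have a1 := mul_le_mul_of_nonneg_right hdiv (sq_nonneg (G v))
    have a2 := mul_le_mul_of_nonneg_left hSG hvg.le
    linarith
  have := integral_mono (i1.sub i2) i3 hpt
  simp only [Pi.sub_apply] at this
  rw [key, integral_sub i1 i2, integral_const_mul] at this
  linarith

section

variable {γ : ℝ} (h1 : -3 < γ) (h2 : γ < 0)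

include h1 h2

theorem hasTemperateGrowth_averagedMatrix (j k : Fin 3) :
    HasTemperateGrowth (averagedMatrix γ j k) := by
  rw [averagedMatrix_eq_coeff]
  exact hasTemperateGrowth_coeff h1 h2 isSchwartz_sqrtMu j k

/-- The density of `‖G‖_A²`. -/
theorem normASq_eq_integral {G : V → ℝ} (hG : IsSchwartz G) :
    IsSchwartz (fun v => (∑ j, ∑ k, averagedMatrix γ j k v * pd k G v * pd j G v) +
      1 / 4 * G v ^ 2 * ∑ j, ∑ k, averagedMatrix γ j k v * v k * v j) ∧
    normASq γ G = ∫ v, ((∑ j, ∑ k, averagedMatrix γ j k v * pd k G v * pd j G v) +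
      1 / 4 * G v ^ 2 * ∑ j, ∑ k, averagedMatrix γ j k v * v k * v j) := by
  have ha := hasTemperateGrowth_averagedMatrix h1 h2
  have hs : ∀ j k, IsSchwartz fun v => averagedMatrix γ j k v * pd j G v * pd k G v
      + 1 / 4 * averagedMatrix γ j k v * v j * v k * G v ^ 2 := by
    intro j k
    refine (((hG.pd j).mul_left (ha j k)).mul (hG.pd k)).add (hG.sq.mul_left ?_)
    exact hasTemperateGrowth_fun_mul (hasTemperateGrowth_fun_mul (hasTemperateGrowth_fun_mul
      (HasTemperateGrowth.const _) (ha j k)) (hasTemperateGrowth_coord j))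
      (hasTemperateGrowth_coord k)
  have e : ∀ v, (∑ j, ∑ k, averagedMatrix γ j k v * pd k G v * pd j G v) +
      1 / 4 * G v ^ 2 * ∑ j, ∑ k, averagedMatrix γ j k v * v k * v j =
      ∑ j, ∑ k, (averagedMatrix γ j k v * pd j G v * pd k G v
      + 1 / 4 * averagedMatrix γ j k v * v j * v k * G v ^ 2) := by
    intro v
    simp only [Finset.mul_sum, ← Finset.sum_add_distrib]
    exact Finset.sum_congr rfl fun j _ => Finset.sum_congr rfl fun k _ => by ring
  simp only [e]
  refine ⟨IsSchwartz.sum fun j _ => IsSchwartz.sum fun k _ => hs j k, ?_⟩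
  rw [integral_finsetSum _ fun j _ => (IsSchwartz.sum fun k _ => hs j k).integrable, normASq]
  exact Finset.sum_congr rfl fun j _ => (integral_finsetSum _ fun k _ => (hs j k).integrable).symm

/-- Coercivity of the norm `‖·‖_A`. -/
theorem energy_le_normASq : ∃ C, 0 < C ∧ ∀ G : V → ℝ, IsSchwartz G →
    ∫ v, dens γ G v ≤ C * normASq γ G := by
  obtain ⟨c, hc, hlow⟩ := averaged_form_lower h1 h2
  have h3 : 0 < 3 + γ := by linarith
  -- `4/c` comes from coercivity and the factor `1/4` in the norm, `1/(3+γ)` from the Poincaré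
  -- inequality.
  refine ⟨(1 + 1 / (3 + γ)) * (4 / c), by positivity, fun G hG => ?_⟩
  obtain ⟨hs, he⟩ := normASq_eq_integral h1 h2 hG
  have hb := hasTemperateGrowth_bracket_rpow γ
  have sA := isSchwartz_aniso γ fun i => hG.pd i
  have sV : IsSchwartz fun v => bracket v ^ γ * (‖v‖ ^ 2 * G v ^ 2) :=
    (hG.sq.mul_left (hasTemperateGrowth_norm_sq V)).mul_left hb
  have sG := hG.bracket_mul_sq γ
  have hP := weighted_poincare h2 hG
  have b1 : ∫ v, bracket v ^ γ * (‖v‖ ^ 2 * G v ^ 2 + gradSq G v) ≤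
      ∫ v, (aniso γ v (fun i => pd i G v) + bracket v ^ γ * (‖v‖ ^ 2 * G v ^ 2)) := by
    refine integral_mono (((hG.sq.mul_left (hasTemperateGrowth_norm_sq V)).add
      hG.gradSq).mul_left hb).integrable (sA.add sV).integrable fun v => ?_
    have := bracket_mul_sum_le_aniso γ v (fun i => pd i G v)
    simp only [gradSq]
    linarith
  have b2 : ∫ v, (aniso γ v (fun i => pd i G v) + bracket v ^ γ * (‖v‖ ^ 2 * G v ^ 2)) ≤
      4 / c * normASq γ G := by
    rw [he, ← integral_const_mul]
    refine integral_mono (sA.add sV).integrable (hs.integrable.const_mul _) fun v => ?_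
    have l1 := hlow v (fun i => pd i G v)
    have l2 := hlow v (fun i => v i)
    have e1 := aniso_smul_self γ v 1
    simp only [one_mul, one_pow] at e1
    rw [e1] at l2
    have l2' := mul_le_mul_of_nonneg_left l2 (by positivity : 0 ≤ 1 / 4 * G v ^ 2)
    have hA := aniso_nonneg γ v (fun i => pd i G v)
    simp only
    rw [div_mul_eq_mul_div, le_div_iff₀ hc]
    nlinarith [mul_nonneg hc.le hA]
  have b3 : ∫ v, dens γ G v = (∫ v, bracket v ^ γ * G v ^ 2) +
      ∫ v, (aniso γ v (fun i => pd i G v) + bracket v ^ γ * (‖v‖ ^ 2 * G v ^ 2)) := by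
    rw [← integral_add sG.integrable (sA.add sV).integrable]
    congr 1
    funext v
    rw [dens, bracket_sq]
    ring
  have b4 : (∫ v, bracket v ^ γ * G v ^ 2) ≤ 1 / (3 + γ) *
      ∫ v, (aniso γ v (fun i => pd i G v) + bracket v ^ γ * (‖v‖ ^ 2 * G v ^ 2)) := by
    rw [div_mul_eq_mul_div, one_mul, le_div_iff₀ h3]
    linarith
  rw [b3]
  have h4 : 0 < 1 / (3 + γ) := by positivity
  nlinarith

end

/-! ### Cauchy-Schwarz and Hardy bounds for singular convolutions -/

theorem abs_integral_mul_le_sqrt {a b : V → ℝ} (ha : AEStronglyMeasurable a)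
    (hb : AEStronglyMeasurable b) (ia : Integrable fun v => a v ^ 2)
    (ib : Integrable fun v => b v ^ 2) :
    Integrable (fun v => a v * b v) ∧
    |∫ v, a v * b v| ≤ Real.sqrt (∫ v, a v ^ 2) * Real.sqrt (∫ v, b v ^ 2) := by
  have hi : Integrable fun v => a v * b v := by
    refine (ia.add ib).mono' (ha.mul hb) (ae_of_all _ fun v => ?_)
    rw [Real.norm_eq_abs, Pi.add_apply, abs_le]
    constructor <;> nlinarith [sq_nonneg (a v - b v), sq_nonneg (a v + b v)]
  refine ⟨hi, ?_⟩
  rw [← Real.sqrt_mul (integral_nonneg fun v => sq_nonneg _)]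
  refine Real.abs_le_sqrt ?_
  have hq : ∀ t : ℝ, 0 ≤ (∫ v, a v ^ 2) * (t * t) + (-2 * ∫ v, a v * b v) * t + ∫ v, b v ^ 2 := by
    intro t
    have e : (∫ v, (t * a v - b v) ^ 2) =
        (∫ v, a v ^ 2) * (t * t) + (-2 * ∫ v, a v * b v) * t + ∫ v, b v ^ 2 := by
      calc _ = ∫ v, ((t * t) * a v ^ 2 + (-2 * t) * (a v * b v) + b v ^ 2) := by
            congr 1; funext v; ring
        _ = _ := by
            have i12 : Integrable fun v => (t * t) * a v ^ 2 + (-2 * t) * (a v * b v) :=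
              (ia.const_mul _).add (hi.const_mul _)
            rw [integral_add i12 ib, integral_add (ia.const_mul _) (hi.const_mul _), integral_const_mul,
              integral_const_mul]
            ring
    rw [← e]
    exact integral_nonneg fun v => sq_nonneg _
  have := discrim_le_zero hq
  rw [discrim] at this
  linarith

theorem hardy_integral {g : V → ℝ} (hg : IsSchwartz g) (w : V) :
    ∫ v, (‖v - w‖ ^ 2)⁻¹ * g v ^ 2 ≤ 4 * ∫ v, gradSq g v := by
  have h0 : 0 ≤ 4 * ∫ v, gradSq g v :=
    mul_nonneg (by norm_num) (integral_nonneg fun v => gradSq_nonneg g v)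
  rw [← ENNReal.ofReal_le_ofReal_iff h0, ofReal_integral_eq_lintegral_ofReal
    (hardy_integrable hg w) (ae_of_all _ fun v => by positivity)]
  exact hardy_lintegral hg w

/-- The kernel `|z|⁻²`. -/
noncomputable def riesz (z : V) : ℝ := (‖z‖ ^ 2)⁻¹

theorem isKernel_riesz : IsKernel riesz := by
  refine ⟨by unfold riesz; fun_prop, 1, zero_le_one, fun z => ?_⟩
  rw [riesz, one_mul, abs_of_nonneg (by positivity)]
  exact le_add_of_nonneg_right (by positivity)

theorem isKernel_one_add_inv_sq : IsKernel fun z : V => (1 + ‖z‖⁻¹) ^ 2 := by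
  refine ⟨by fun_prop, 2, zero_le_two, fun z => ?_⟩
  rw [abs_of_nonneg (by positivity), ← inv_pow]
  nlinarith [sq_nonneg (‖z‖⁻¹ - 1), norm_nonneg z, sq_nonneg ‖z‖]

/-- The bounded part of the kernel is paired with `G` in `L¹`, the singular part with `G` in `L^∞`.
-/
theorem exists_abs_kconv_le {K : V → ℝ} {A : ℝ}
    (hA : ∀ z, |K z| ≤ A * (1 + (‖z‖ ^ 2)⁻¹)) {G : V → ℝ} (hG : IsSchwartz G) :
    ∃ C, 0 ≤ C ∧ ∀ v, |kconv K G v| ≤ C := by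
  obtain ⟨D, hD, hdec⟩ := hG.one_add_norm_decay 0
  simp only [pow_zero, inv_one, mul_one] at hdec
  have hA0 : 0 ≤ A := by
    have := (abs_nonneg _).trans (hA 0)
    simpa using this
  set s : V → ℝ := fun z => (‖z‖ ^ 2)⁻¹ * Real.exp (-(1 / 2 * ‖z‖ ^ 2)) ^ 2
  have hs0 : ∀ z, 0 ≤ s z := fun z => by positivity
  refine ⟨A * (2 * (∫ w, |G w|) + Real.exp 1 * D * ∫ z, s z), ?_, fun v => ?_⟩
  · have : 0 ≤ ∫ w, |G w| := integral_nonneg fun _ => abs_nonneg _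
    have : 0 ≤ ∫ z, s z := integral_nonneg hs0
    positivity
  have is' : Integrable fun w => s (v - w) := integrable_singular_gaussian.comp_sub_left v
  have iG : Integrable fun w => |G w| := hG.integrable.abs
  calc |kconv K G v| ≤ ∫ w, A * (2 * |G w| + Real.exp 1 * D * s (v - w)) := by
        rw [kconv, ← Real.norm_eq_abs]
        refine norm_integral_le_of_norm_le
          (((iG.const_mul _).add (is'.const_mul _)).const_mul _) (ae_of_all _ fun w => ?_)
        rw [norm_mul, Real.norm_eq_abs, Real.norm_eq_abs]
        have hk : |K (v - w)| ≤ A * (2 + Real.exp 1 * s (v - w)) := by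
          refine (hA _).trans (mul_le_mul_of_nonneg_left ?_ hA0)
          have := inv_norm_sq_le (v - w)
          linarith
        calc _ ≤ A * (2 + Real.exp 1 * s (v - w)) * |G w| := by gcongr
          _ = A * (2 * |G w| + Real.exp 1 * |G w| * s (v - w)) := by ring
          _ ≤ _ := by
            have := hs0 (v - w)
            gcongr
            exact hdec w
    _ = _ := by
        rw [integral_const_mul, integral_add (iG.const_mul _) (is'.const_mul _),
          integral_const_mul, integral_const_mul, integral_sub_left_eq_self s _ v]

/-- Multiplication by the square of a function in `H¹` is bounded by `|z|⁻² *` an integrable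
function. -/
theorem integral_sq_mul_kconv_riesz_le {P R : V → ℝ} (hP : IsSchwartz P) (hR : IsSchwartz R)
    (hR0 : ∀ w, 0 ≤ R w) :
    ∫ v, P v ^ 2 * kconv riesz R v ≤ (4 * ∫ v, gradSq P v) * ∫ w, R w := by
  have hPm := hP.continuous.measurable
  have hRm := hR.continuous.measurable
  have h1 : ∀ w, (∫ v, P v ^ 2 * (riesz (v - w) * R w)) ≤ (4 * ∫ v, gradSq P v) * R w := by
    intro w
    calc _ = (∫ v, (‖v - w‖ ^ 2)⁻¹ * P v ^ 2) * R w := by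
          rw [← integral_mul_const]
          congr 1
          funext v
          rw [riesz]
          ring
      _ ≤ _ := mul_le_mul_of_nonneg_right (hardy_integral hP w) (hR0 w)
  have hi : Integrable (uncurry fun v w => P v ^ 2 * (riesz (v - w) * R w))
      (volume.prod volume) := by
    have hm : AEStronglyMeasurable (uncurry fun v w => P v ^ 2 * (riesz (v - w) * R w))
        ((volume : Measure V).prod volume) := by
      unfold uncurry riesz
      fun_prop
    rw [integrable_prod_iff hm]
    refine ⟨ae_of_all _ fun v => (isKernel_riesz.integrable hR v).const_mul (P v ^ 2), ?_⟩
    refine (hP.sq.mul_right (isKernel_riesz.hasTemperateGrowth_kconv hR)).integrable.congr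
      (ae_of_all _ fun v => ?_)
    simp only [uncurry, kconv, ← integral_const_mul]
    congr 1
    funext w
    have := hR0 w
    rw [Real.norm_of_nonneg (by unfold riesz; positivity)]
  -- After Fubini, Hardy's inequality is applied in `v` for each fixed `w`, with a constant
  -- independent of `w`.
  calc ∫ v, P v ^ 2 * kconv riesz R v = ∫ v, ∫ w, P v ^ 2 * (riesz (v - w) * R w) := by
        simp only [kconv, ← integral_const_mul]
    _ = ∫ w, ∫ v, P v ^ 2 * (riesz (v - w) * R w) := integral_integral_swap hi
    _ ≤ ∫ w, (4 * ∫ v, gradSq P v) * R w := by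
        refine integral_mono ?_ (hR.integrable.const_mul _) h1
        exact hi.integral_prod_right
    _ = _ := integral_const_mul _ _

/-- The weighted `L²` norm `‖⟨·⟩^{γ/2} f‖`. -/
noncomputable def norm0 (γ : ℝ) (f : V → ℝ) : ℝ :=
  Real.sqrt (∫ v, (bracket v ^ (γ / 2) * f v) ^ 2)

theorem bracket_half_sq (γ : ℝ) (v : V) : (bracket v ^ (γ / 2)) ^ 2 = bracket v ^ γ := by
  rw [← Real.rpow_natCast, ← Real.rpow_mul (bracket_pos v).le]
  congr 1
  push_cast
  ring

theorem IsSchwartz.mul_bracket (s : ℝ) {f : V → ℝ} (hf : IsSchwartz f) :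
    IsSchwartz fun v => bracket v ^ s * f v := hf.mul_left (hasTemperateGrowth_bracket_rpow s)

theorem norm0_sq (γ : ℝ) (f : V → ℝ) :
    norm0 γ f ^ 2 = ∫ v, (bracket v ^ (γ / 2) * f v) ^ 2 :=
  Real.sq_sqrt (integral_nonneg fun _ => sq_nonneg _)

/-- A singularity `|z|⁻¹` is locally square integrable, so Cauchy-Schwarz bounds the integral
uniformly in `v`; the Gaussian absorbs `⟨w⟩^{5-γ/2}`. -/
theorem exists_integral_singular_le (γ : ℝ) : ∃ C, 0 ≤ C ∧ ∀ f : V → ℝ, IsSchwartz f → ∀ v : V,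
    Integrable (fun w => bracket w ^ 5 * (1 + ‖v - w‖⁻¹) * (sqrtMu w * |f w|)) ∧
    ∫ w, bracket w ^ 5 * (1 + ‖v - w‖⁻¹) * (sqrtMu w * |f w|) ≤ C * norm0 γ f := by
  set G : V → ℝ := fun w => (bracket w ^ (5 - γ / 2) * sqrtMu w) ^ 2 with hGd
  have hG : IsSchwartz G := (isSchwartz_sqrtMu.mul_bracket _).sq
  obtain ⟨C, hC, hb⟩ := exists_abs_kconv_le (K := fun z : V => (1 + ‖z‖⁻¹) ^ 2) (A := 2) (fun z => by
    rw [abs_of_nonneg (by positivity), ← inv_pow]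
    nlinarith [sq_nonneg (‖z‖⁻¹ - 1)]) hG
  refine ⟨Real.sqrt C, Real.sqrt_nonneg _, fun f hf v => ?_⟩
  set a : V → ℝ := fun w => (1 + ‖v - w‖⁻¹) * (bracket w ^ (5 - γ / 2) * sqrtMu w) with ha
  set b : V → ℝ := fun w => |bracket w ^ (γ / 2) * f w| with hbd
  have ea : (fun w => a w ^ 2) = fun w => (1 + ‖v - w‖⁻¹) ^ 2 * G w := by
    funext w
    rw [ha, hGd]
    ring
  have eb : (fun w => b w ^ 2) = fun w => (bracket w ^ (γ / 2) * f w) ^ 2 := by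
    funext w
    rw [hbd, sq_abs]
  have ma : AEStronglyMeasurable a := by
    have := (isSchwartz_sqrtMu.mul_bracket (5 - γ / 2)).continuous.measurable
    rw [ha]
    fun_prop
  have mb : AEStronglyMeasurable b := (hf.mul_bracket (γ / 2)).continuous.abs.aestronglyMeasurable
  have ia : Integrable fun w => a w ^ 2 := ea ▸ isKernel_one_add_inv_sq.integrable hG v
  have ib : Integrable fun w => b w ^ 2 := eb ▸ (hf.mul_bracket (γ / 2)).sq.integrable
  have hab : (fun w => bracket w ^ 5 * (1 + ‖v - w‖⁻¹) * (sqrtMu w * |f w|)) =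
      fun w => a w * b w := by
    funext w
    have hw := bracket_pos w
    have : bracket w ^ 5 = bracket w ^ (5 - γ / 2) * bracket w ^ (γ / 2) := by
      rw [← Real.rpow_add hw, ← Real.rpow_natCast]
      congr 1
      push_cast
      ring
    rw [ha, hbd, this]
    simp only
    rw [abs_mul, abs_of_pos (Real.rpow_pos_of_pos hw _)]
    ring
  obtain ⟨hi, hle⟩ := abs_integral_mul_le_sqrt ma mb ia ib
  rw [hab]
  refine ⟨hi, (le_abs_self _).trans (hle.trans ?_)⟩
  rw [eb, norm0, ea]
  gcongr
  exact (le_abs_self _).trans (hb v)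

/-- Here `|z|⁻⁴` would not be locally integrable, so the kernel is shared between the two factors of
Cauchy-Schwarz. What remains is `|z|⁻² * (Gaussian weight · f²)`, unbounded in `v` but integrable
against the square of an `H¹` function by Hardy. -/
theorem exists_integral_riesz_le : ∃ C, 0 ≤ C ∧ ∀ f : V → ℝ, IsSchwartz f → ∀ v : V,
    Integrable (fun w => riesz (v - w) * (bracket w ^ 4 * sqrtMu w * |f w|)) ∧
    ∫ w, riesz (v - w) * (bracket w ^ 4 * sqrtMu w * |f w|) ≤
      C * Real.sqrt (kconv riesz (fun w => bracket w ^ (8 : ℝ) * sqrtMu w * f w ^ 2) v) := by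
  obtain ⟨C, hC, hb⟩ := exists_abs_kconv_le (K := riesz) (A := 1) (fun z => by
    rw [riesz, abs_of_nonneg (by positivity)]
    linarith) isSchwartz_sqrtMu
  refine ⟨Real.sqrt C, Real.sqrt_nonneg _, fun f hf v => ?_⟩
  have hr0 : ∀ z, 0 ≤ riesz z := fun z => by unfold riesz; positivity
  set a : V → ℝ := fun w => Real.sqrt (riesz (v - w) * sqrtMu w) with ha
  set b : V → ℝ := fun w => Real.sqrt (riesz (v - w) * (bracket w ^ (8 : ℝ) * sqrtMu w * f w ^ 2))
    with hbd
  have hR : IsSchwartz fun w => bracket w ^ (8 : ℝ) * sqrtMu w * f w ^ 2 :=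
    (isSchwartz_sqrtMu.mul_bracket 8).mul hf.sq
  have e8 : ∀ w, bracket w ^ (8 : ℝ) = (bracket w ^ 4) ^ 2 := fun w => by
    rw [← pow_mul, ← Real.rpow_natCast]
    norm_num
  have p8 : ∀ w, 0 ≤ bracket w ^ (8 : ℝ) * sqrtMu w * f w ^ 2 := fun w => by
    rw [e8]
    have := (sqrtMu_pos w).le
    positivity
  have ea : (fun w => a w ^ 2) = fun w => riesz (v - w) * sqrtMu w := by
    funext w
    exact Real.sq_sqrt (mul_nonneg (hr0 _) (sqrtMu_pos w).le)
  have eb : (fun w => b w ^ 2) =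
      fun w => riesz (v - w) * (bracket w ^ (8 : ℝ) * sqrtMu w * f w ^ 2) := by
    funext w
    exact Real.sq_sqrt (mul_nonneg (hr0 _) (p8 w))
  have ia := isKernel_riesz.integrable isSchwartz_sqrtMu v
  have ib := isKernel_riesz.integrable hR v
  have hab : (fun w => riesz (v - w) * (bracket w ^ 4 * sqrtMu w * |f w|)) =
      fun w => a w * b w := by
    funext w
    have hw := (bracket_pos w).le
    have hm := (sqrtMu_pos w).le
    have hr := hr0 (v - w)
    rw [ha, hbd, ← Real.sqrt_mul (mul_nonneg hr hm), e8]
    symm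
    rw [Real.sqrt_eq_iff_mul_self_eq (by positivity) (by positivity)]
    have : |f w| * |f w| = f w ^ 2 := by rw [abs_mul_abs_self, sq]
    calc _ = riesz (v - w) ^ 2 * (bracket w ^ 4) ^ 2 * sqrtMu w ^ 2 * f w ^ 2 := by ring
      _ = _ := by rw [← this]; ring
  obtain ⟨hi, hle⟩ := abs_integral_mul_le_sqrt (a := a) (b := b)
    ia.aestronglyMeasurable.aemeasurable.sqrt.aestronglyMeasurable
    ib.aestronglyMeasurable.aemeasurable.sqrt.aestronglyMeasurable (ea ▸ ia) (eb ▸ ib)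
  rw [hab]
  refine ⟨hi, (le_abs_self _).trans (hle.trans ?_)⟩
  rw [ea, eb]
  unfold kconv
  gcongr
  exact (le_abs_self _).trans (hb v)

theorem exists_integral_sqrtMu_sq_le (γ : ℝ) : ∃ C, 0 ≤ C ∧ ∀ f : V → ℝ, IsSchwartz f →
    ∫ w, bracket w ^ (8 : ℝ) * sqrtMu w * f w ^ 2 ≤ C * norm0 γ f ^ 2 := by
  obtain ⟨C, hC, hb⟩ := (isSchwartz_sqrtMu.mul_bracket (8 - γ)).one_add_norm_decay 0
  simp only [pow_zero, inv_one, mul_one] at hb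
  refine ⟨C, hC, fun f hf => ?_⟩
  rw [norm0_sq, ← integral_const_mul]
  refine integral_mono ((isSchwartz_sqrtMu.mul_bracket 8).mul hf.sq).integrable
    ((hf.mul_bracket (γ / 2)).sq.integrable.const_mul _) fun w => ?_
  simp only
  rw [mul_pow, bracket_half_sq]
  have hw := bracket_pos w
  have e : bracket w ^ (8 : ℝ) = bracket w ^ (8 - γ) * bracket w ^ γ := by
    rw [← Real.rpow_add hw]
    congr 1
    ring
  have hg := Real.rpow_nonneg hw.le γ
  rw [e]
  calc _ = (bracket w ^ (8 - γ) * sqrtMu w) * (bracket w ^ γ * f w ^ 2) := by ring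
    _ ≤ C * (bracket w ^ γ * f w ^ 2) := by
      gcongr
      exact (le_abs_self _).trans (hb w)

/-! ### The weighted trilinear estimate -/

theorem gradSq_bracket_mul_le (γ : ℝ) {G : V → ℝ} (hG : IsSchwartz G) (v : V) :
    gradSq (fun v => bracket v ^ (γ / 2) * G v) v ≤ (2 + γ ^ 2) * dens γ G v := by
  have hb := bracket_pos v
  have hd := (hasTemperateGrowth_bracket_rpow (γ / 2)).1.differentiable (by simp) v
  have hpd : ∀ k, pd k (fun v => bracket v ^ (γ / 2) * G v) v =
      bracket v ^ (γ / 2) * (γ / 2 * (v k / bracket v ^ 2) * G v + pd k G v) := by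
    intro k
    rw [pd_mul k hd (hG.differentiable v), pd_bracket_rpow, Real.rpow_sub hb, Real.rpow_two]
    field_simp
  have hbg := Real.rpow_nonneg hb.le γ
  have h1 := bracket_mul_sum_le_aniso γ v (fun i => pd i G v)
  have hk : ∀ k, (γ / 2 * (v k / bracket v ^ 2) * G v + pd k G v) ^ 2 ≤
      γ ^ 2 / 2 * (v k ^ 2 * G v ^ 2) + 2 * pd k G v ^ 2 := by
    intro k
    have e : (γ / 2 * (v k / bracket v ^ 2) * G v) ^ 2 ≤ γ ^ 2 / 4 * (v k ^ 2 * G v ^ 2) := by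
      have : (v k / bracket v ^ 2) ^ 2 ≤ v k ^ 2 := by
        rw [div_pow]
        refine div_le_self (sq_nonneg _) ?_
        exact one_le_pow₀ (one_le_pow₀ (one_le_bracket v))
      calc _ = γ ^ 2 / 4 * ((v k / bracket v ^ 2) ^ 2 * G v ^ 2) := by ring
        _ ≤ _ := by gcongr
    nlinarith [sq_nonneg (γ / 2 * (v k / bracket v ^ 2) * G v - pd k G v)]
  calc gradSq (fun v => bracket v ^ (γ / 2) * G v) v
      = bracket v ^ γ * ∑ k, (γ / 2 * (v k / bracket v ^ 2) * G v + pd k G v) ^ 2 := by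
        rw [gradSq, Finset.mul_sum]
        refine Finset.sum_congr rfl fun k _ => ?_
        rw [hpd, mul_pow, bracket_half_sq]
    _ ≤ bracket v ^ γ * ∑ k, (γ ^ 2 / 2 * (v k ^ 2 * G v ^ 2) + 2 * pd k G v ^ 2) := by
        gcongr with k
        exact hk k
    _ = γ ^ 2 / 2 * (bracket v ^ γ * ‖v‖ ^ 2 * G v ^ 2) +
          2 * (bracket v ^ γ * ∑ k, pd k G v ^ 2) := by
        rw [norm_sq_eq_sum]
        simp only [Fin.sum_univ_three]
        ring
    _ ≤ _ := by
        have h3 : bracket v ^ γ * ‖v‖ ^ 2 * G v ^ 2 ≤ bracket v ^ γ * bracket v ^ 2 * G v ^ 2 := by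
          gcongr
          exact norm_le_bracket v
        have h4 : 0 ≤ bracket v ^ γ * ‖v‖ ^ 2 * G v ^ 2 := by positivity
        have h5 := aniso_nonneg γ v (fun i => pd i G v)
        have h6 := mul_le_mul_of_nonneg_left h3 (sq_nonneg γ)
        have h7 := mul_nonneg (sq_nonneg γ) h4
        have h8 := mul_nonneg (sq_nonneg γ) h5
        unfold dens
        nlinarith

/-- Both operators are `±∇` plus `(1/2 + φ) v`, and the part parallel to `v` sees only `⟨v⟩^γ |v|²
G²`. -/
theorem aniso_wcreation_le (γ : ℝ) {B : ℝ} {φ : V → ℝ} (hφ : ∀ v, |φ v| ≤ B) (G : V → ℝ) (v : V) :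
    aniso γ v (fun k => wcreation φ k G v) ≤ (2 + 2 * (1 / 2 + B) ^ 2) * dens γ G v ∧
    aniso γ v (fun k => wannihil φ k G v) ≤ (2 + 2 * (1 / 2 + B) ^ 2) * dens γ G v := by
  have hb := Real.rpow_nonneg (bracket_pos v).le γ
  have e1 : (fun k => wcreation φ k G v) =
      fun k => ((1 / 2 + φ v) * G v) * v k + (fun k => -pd k G v) k := by
    funext k
    rw [wcreation, creation]
    ring
  have e2 : (fun k => wannihil φ k G v) =
      fun k => ((1 / 2 + φ v) * G v) * v k + (fun k => pd k G v) k := by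
    funext k
    rw [wannihil]
    ring
  have hneg : aniso γ v (fun k => -pd k G v) = aniso γ v (fun k => pd k G v) := by
    simp only [aniso, crossDot, Fin.sum_univ_three]
    ring
  have hs : aniso γ v (fun k => ((1 / 2 + φ v) * G v) * v k) ≤
      (1 / 2 + B) ^ 2 * (bracket v ^ γ * bracket v ^ 2 * G v ^ 2) := by
    rw [aniso_smul_self, mul_pow]
    have h1 : (1 / 2 + φ v) ^ 2 ≤ (1 / 2 + B) ^ 2 := by
      have := abs_le.1 (hφ v)
      exact sq_le_sq' (by linarith) (by linarith)
    have h2 := norm_le_bracket v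
    calc _ = (1 / 2 + φ v) ^ 2 * (bracket v ^ γ * ‖v‖ ^ 2 * G v ^ 2) := by ring
      _ ≤ _ := by gcongr
  have hA := aniso_nonneg γ v (fun k => pd k G v)
  have hB : 0 ≤ bracket v ^ γ * bracket v ^ 2 * G v ^ 2 := by positivity
  have hA' := mul_nonneg (sq_nonneg (1 / 2 + B)) hA
  rw [e1, e2]
  constructor
  · refine (aniso_add_le γ v _ _).trans ?_
    rw [hneg]
    unfold dens
    nlinarith
  · refine (aniso_add_le γ v _ _).trans ?_
    unfold dens
    nlinarith

section

variable {γ : ℝ} (h1 : -3 < γ) (h2 : γ < 0)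

include h1 h2

theorem exists_coeff_form_le : ∃ C, 0 ≤ C ∧ ∀ f : V → ℝ, IsSchwartz f →
    ∀ (v : V) (x y : Fin 3 → ℝ), |∑ j, ∑ k, coeff γ f j k v * x k * y j| ≤
      C * norm0 γ f * (Real.sqrt (aniso γ v x) * Real.sqrt (aniso γ v y)) := by
  obtain ⟨C, hC, hb⟩ := exists_integral_singular_le γ
  refine ⟨128 * C, by positivity, fun f hf v x y => ?_⟩
  obtain ⟨-, he⟩ := sum_kconv_collisionMatrix h1 h2 (isSchwartz_sqrtMu.mul hf) v x y
  obtain ⟨hi, hle⟩ := hb f hf v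
  set S := Real.sqrt (aniso γ v x) * Real.sqrt (aniso γ v y) with hS
  have hS0 : 0 ≤ S := by positivity
  unfold coeff
  rw [he, ← Real.norm_eq_abs]
  calc _ ≤ ∫ w, (128 * S) * (bracket w ^ 5 * (1 + ‖v - w‖⁻¹) * (sqrtMu w * |f w|)) := by
        refine norm_integral_le_of_norm_le (hi.const_mul _) (ae_of_all _ fun w => ?_)
        rw [norm_mul, Real.norm_eq_abs, Real.norm_eq_abs, abs_mul, abs_of_pos (sqrtMu_pos w)]
        have e : ∑ j, ∑ k, collisionMatrix γ j k (v - w) * x k * y j =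
            ∑ j, ∑ k, collisionMatrix γ j k (v - w) * y j * x k :=
          Finset.sum_congr rfl fun j _ => Finset.sum_congr rfl fun k _ => by ring
        have := abs_collision_form_le h1 h2 v w y x
        have hm := (sqrtMu_pos w).le
        rw [e]
        calc _ ≤ 128 * (bracket w ^ 5 * (1 + ‖v - w‖⁻¹)) *
              (Real.sqrt (aniso γ v y) * Real.sqrt (aniso γ v x)) * (sqrtMu w * |f w|) := by gcongr
          _ = _ := by rw [hS]; ring
    _ = (128 * S) * ∫ w, bracket w ^ 5 * (1 + ‖v - w‖⁻¹) * (sqrtMu w * |f w|) :=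
        integral_const_mul _ _
    _ ≤ (128 * S) * (C * norm0 γ f) := by gcongr
    _ = _ := by ring

/-- This removes the derivative from `f`, so that the final bound involves `f` only through a
weighted `L²` norm. -/
theorem sum_coeff_creation {f : V → ℝ} (hf : IsSchwartz f) (j : Fin 3) (v : V) :
    ∑ k, coeff γ (creation k f) j k v =
      -kconv (divKernel γ j) (fun v => sqrtMu v * f v) v := by
  rw [← sum_kconv_pd h1 h2 j (isSchwartz_sqrtMu.mul hf), ← Finset.sum_neg_distrib]
  refine Finset.sum_congr rfl fun k _ => ?_
  rw [pd_sqrtMu_mul hf.differentiable, IsKernel.kconv_neg, neg_neg, coeff]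

theorem exists_divKernel_le : ∃ C, 0 ≤ C ∧ ∀ f : V → ℝ, IsSchwartz f → ∀ (j : Fin 3) (v : V),
    |kconv (divKernel γ j) (fun v => sqrtMu v * f v) v| ≤ C * (bracket v ^ γ *
      (bracket v * norm0 γ f +
      Real.sqrt (kconv riesz (fun w => bracket w ^ (8 : ℝ) * sqrtMu w * f w ^ 2) v))) := by
  obtain ⟨C₁, hC₁, hb₁⟩ := exists_integral_singular_le γ
  obtain ⟨C₂, hC₂, hb₂⟩ := exists_integral_riesz_le
  refine ⟨256 * (C₁ + C₂), by positivity, fun f hf j v => ?_⟩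
  obtain ⟨hi₁, hle₁⟩ := hb₁ f hf v
  obtain ⟨hi₂, hle₂⟩ := hb₂ f hf v
  have hv := bracket_pos v
  have hvg := Real.rpow_nonneg hv.le γ
  set D := Real.sqrt (kconv riesz (fun w => bracket w ^ (8 : ℝ) * sqrtMu w * f w ^ 2) v)
  have hD : 0 ≤ D := Real.sqrt_nonneg _
  have hn : 0 ≤ norm0 γ f := Real.sqrt_nonneg _
  rw [kconv, ← Real.norm_eq_abs]
  calc _ ≤ ∫ w, (256 * bracket v ^ γ) * (bracket v * (bracket w ^ 5 * (1 + ‖v - w‖⁻¹) *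
          (sqrtMu w * |f w|)) + riesz (v - w) * (bracket w ^ 4 * sqrtMu w * |f w|)) := by
        refine norm_integral_le_of_norm_le (((hi₁.const_mul _).add hi₂).const_mul _)
          (ae_of_all _ fun w => ?_)
        rw [norm_mul, Real.norm_eq_abs, Real.norm_eq_abs, abs_mul, abs_of_pos (sqrtMu_pos w)]
        have hm := (sqrtMu_pos w).le
        have hw := (bracket_pos w).le
        have hbd : |divKernel γ j (v - w)| ≤
            256 * (bracket v ^ γ * bracket w ^ 4 * (bracket v + riesz (v - w))) := by
          refine (abs_divKernel_le γ j _).trans ?_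
          have := norm_mul_norm_rpow_le h1 h2 v w
          unfold riesz
          linarith
        have h45 : bracket w ^ 4 ≤ bracket w ^ 5 * (1 + ‖v - w‖⁻¹) := by
          calc bracket w ^ 4 ≤ bracket w ^ 5 :=
                pow_le_pow_right₀ (one_le_bracket w) (by norm_num)
            _ ≤ _ := le_mul_of_one_le_right (by positivity)
                (le_add_of_nonneg_right (by positivity))
        calc _ ≤ 256 * (bracket v ^ γ * bracket w ^ 4 * (bracket v + riesz (v - w))) *
              (sqrtMu w * |f w|) := by gcongr
          _ = 256 * bracket v ^ γ * (bracket v * (bracket w ^ 4 * (sqrtMu w * |f w|)) +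
              riesz (v - w) * (bracket w ^ 4 * sqrtMu w * |f w|)) := by ring
          _ ≤ _ := by gcongr
    _ = (256 * bracket v ^ γ) * (bracket v * (∫ w, bracket w ^ 5 * (1 + ‖v - w‖⁻¹) *
          (sqrtMu w * |f w|)) + ∫ w, riesz (v - w) * (bracket w ^ 4 * sqrtMu w * |f w|)) := by
        rw [integral_const_mul, integral_add (hi₁.const_mul _) hi₂, integral_const_mul]
    _ ≤ (256 * bracket v ^ γ) * (bracket v * (C₁ * norm0 γ f) + C₂ * D) := by gcongr
    _ ≤ (256 * bracket v ^ γ) * (bracket v * ((C₁ + C₂) * norm0 γ f) + (C₁ + C₂) * D) := by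
        gcongr <;> linarith
    _ = _ := by ring

theorem normASq_nonneg {G : V → ℝ} (hG : IsSchwartz G) : 0 ≤ normASq γ G := by
  obtain ⟨C, hC, h⟩ := energy_le_normASq h1 h2
  have := (integral_nonneg (dens_nonneg γ G)).trans (h G hG)
  exact nonneg_of_mul_nonneg_right this hC

/-- The flux form is a second order part, estimated by the anisotropic form, plus a part of order
zero in `G` with the divergence kernel. The latter brings in the `|z|⁻²` potential, left under the
square root to be integrated by Hardy. -/
theorem exists_wflux_form_le (B : ℝ) : ∃ C, 0 ≤ C ∧ ∀ φ : V → ℝ, (∀ v, |φ v| ≤ B) →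
    ∀ f G H : V → ℝ, IsSchwartz f → ∀ v,
    |∑ j, ∑ k, wflux γ φ f G j k v * wannihil φ j H v| ≤ C * (Real.sqrt (dens γ H v) *
      Real.sqrt (norm0 γ f ^ 2 * dens γ G v + (bracket v ^ (γ / 2) * G v) ^ 2 *
        kconv riesz (fun w => bracket w ^ (8 : ℝ) * sqrtMu w * f w ^ 2) v)) := by
  obtain ⟨C₁, hC₁, hb₁⟩ := exists_coeff_form_le h1 h2
  obtain ⟨C₂, hC₂, hb₂⟩ := exists_divKernel_le h1 h2
  set K := 2 + 2 * (1 / 2 + B) ^ 2 with hK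
  have hK0 : 0 < K := by positivity
  -- The six is three components times the two contributions of the divergence kernel bound.
  refine ⟨C₁ * K + 6 * (C₂ * Real.sqrt K), by positivity, fun φ hφ f G H hf v => ?_⟩
  set n := norm0 γ f with hn
  have hn0 : 0 ≤ n := Real.sqrt_nonneg _
  set D := kconv riesz (fun w => bracket w ^ (8 : ℝ) * sqrtMu w * f w ^ 2) v with hD
  have hD0 : 0 ≤ D := by
    refine integral_nonneg fun w => mul_nonneg (by unfold riesz; positivity) ?_
    have := (sqrtMu_pos w).le
    have := Real.rpow_nonneg (bracket_pos w).le 8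
    positivity
  obtain ⟨hX, -⟩ := aniso_wcreation_le γ hφ G v
  obtain ⟨-, hY⟩ := aniso_wcreation_le γ hφ H v
  rw [← hK] at hX hY
  set X : Fin 3 → ℝ := fun k => wcreation φ k G v with hXd
  set Y : Fin 3 → ℝ := fun k => wannihil φ k H v with hYd
  have hb := bracket_pos v
  have hbg := Real.rpow_nonneg hb.le (γ / 2)
  set dG := dens γ G v with hdG
  set dH := dens γ H v
  have hdG0 : 0 ≤ dG := dens_nonneg _ _ _
  have hdH0 : 0 ≤ dH := dens_nonneg _ _ _
  set T := n ^ 2 * dG + (bracket v ^ (γ / 2) * G v) ^ 2 * D with hT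
  have hT1 : n * Real.sqrt dG ≤ Real.sqrt T := by
    refine Real.le_sqrt_of_sq_le ?_
    rw [mul_pow, Real.sq_sqrt hdG0, hT]
    exact le_add_of_nonneg_right (by positivity)
  have hT2 : bracket v ^ (γ / 2) * |G v| * Real.sqrt D ≤ Real.sqrt T := by
    refine Real.le_sqrt_of_sq_le ?_
    rw [mul_pow, mul_pow, Real.sq_sqrt hD0, sq_abs, ← mul_pow, hT]
    exact le_add_of_nonneg_left (by positivity)
  have hG1 : bracket v ^ (γ / 2) * bracket v * |G v| ≤ Real.sqrt dG := by
    refine Real.le_sqrt_of_sq_le ?_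
    rw [mul_pow, mul_pow, bracket_half_sq, sq_abs, hdG, dens]
    exact le_add_of_nonneg_left (aniso_nonneg _ _ _)
  have hYj : ∀ j, bracket v ^ (γ / 2) * |Y j| ≤ Real.sqrt K * Real.sqrt dH := by
    intro j
    rw [← Real.sqrt_mul hK0.le]
    refine Real.le_sqrt_of_sq_le ?_
    rw [mul_pow, bracket_half_sq, sq_abs]
    refine le_trans ?_ ((bracket_mul_sum_le_aniso γ v Y).trans hY)
    gcongr
    exact Finset.single_le_sum (f := fun i => Y i ^ 2) (fun i _ => sq_nonneg _) (Finset.mem_univ j)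
  have hsplit : ∑ j, ∑ k, wflux γ φ f G j k v * wannihil φ j H v =
      (∑ j, ∑ k, coeff γ f j k v * X k * Y j) +
      ∑ j, kconv (divKernel γ j) (fun v => sqrtMu v * f v) v * (G v * Y j) := by
    rw [← Finset.sum_add_distrib]
    refine Finset.sum_congr rfl fun j _ => ?_
    have := sum_coeff_creation h1 h2 hf j v
    rw [← neg_eq_iff_eq_neg] at this
    rw [← this, ← Finset.sum_neg_distrib, Finset.sum_mul, ← Finset.sum_add_distrib]
    refine Finset.sum_congr rfl fun k _ => ?_
    rw [wflux]
    ring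
  have hfirst : |∑ j, ∑ k, coeff γ f j k v * X k * Y j| ≤
      C₁ * K * (Real.sqrt dH * Real.sqrt T) := by
    calc _ ≤ C₁ * n * (Real.sqrt (aniso γ v X) * Real.sqrt (aniso γ v Y)) := hb₁ f hf v X Y
      _ ≤ C₁ * n * (Real.sqrt (K * dG) * Real.sqrt (K * dH)) := by gcongr
      _ = C₁ * (Real.sqrt K * Real.sqrt K) * (Real.sqrt dH * (n * Real.sqrt dG)) := by
        rw [Real.sqrt_mul hK0.le, Real.sqrt_mul hK0.le]; ring
      _ ≤ _ := by
        rw [Real.mul_self_sqrt hK0.le]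
        gcongr
  have hsecond : ∀ j, |kconv (divKernel γ j) (fun v => sqrtMu v * f v) v * (G v * Y j)| ≤
      2 * (C₂ * Real.sqrt K) * (Real.sqrt dH * Real.sqrt T) := by
    intro j
    rw [abs_mul, abs_mul]
    calc _ ≤ C₂ * (bracket v ^ γ * (bracket v * n + Real.sqrt D)) * (|G v| * |Y j|) := by
          gcongr
          exact hb₂ f hf j v
      _ = C₂ * (bracket v ^ (γ / 2) * |Y j|) * (n * (bracket v ^ (γ / 2) * bracket v * |G v|) +
          bracket v ^ (γ / 2) * |G v| * Real.sqrt D) := by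
          rw [← bracket_half_sq]; ring
      _ ≤ C₂ * (Real.sqrt K * Real.sqrt dH) * (n * Real.sqrt dG + Real.sqrt T) := by
          exact mul_le_mul (mul_le_mul_of_nonneg_left (hYj j) hC₂)
            (add_le_add (mul_le_mul_of_nonneg_left hG1 hn0) hT2) (by positivity) (by positivity)
      _ ≤ C₂ * (Real.sqrt K * Real.sqrt dH) * (Real.sqrt T + Real.sqrt T) := by gcongr
      _ = _ := by ring
  rw [hsplit]
  calc _ ≤ |∑ j, ∑ k, coeff γ f j k v * X k * Y j| +
        ∑ j, |kconv (divKernel γ j) (fun v => sqrtMu v * f v) v * (G v * Y j)| :=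
        (abs_add_le _ _).trans (add_le_add le_rfl (Finset.abs_sum_le_sum_abs _ _))
    _ ≤ C₁ * K * (Real.sqrt dH * Real.sqrt T) +
        ∑ _j : Fin 3, 2 * (C₂ * Real.sqrt K) * (Real.sqrt dH * Real.sqrt T) := by
        gcongr with j
        exact hsecond j
    _ = _ := by
        rw [Finset.sum_const, Finset.card_univ, Fintype.card_fin, nsmul_eq_mul]
        push_cast
        ring

/-- The basic weighted trilinear estimate. -/
theorem weighted_trilinear (B : ℝ) : ∃ C, 0 < C ∧ ∀ ω φ : V → ℝ, IsWeight B ω φ →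
    ∀ f g H : V → ℝ, IsSchwartz f → IsSchwartz (fun v => ω v * g v) → IsSchwartz H →
    |∫ v, (ω v * Gam γ f g v) * H v| ≤
      C * norm0 γ f * Real.sqrt (normASq γ fun v => ω v * g v) * Real.sqrt (normASq γ H) := by
  obtain ⟨C₁, hC₁, hb₁⟩ := exists_wflux_form_le h1 h2 B
  obtain ⟨C₂, hC₂, hb₂⟩ := exists_integral_sqrtMu_sq_le γ
  obtain ⟨C₃, hC₃, hb₃⟩ := energy_le_normASq h1 h2
  -- `4` is Hardy's constant, `2 + γ²` bounds the gradient of `⟨v⟩^{γ/2} G`, and `C₂` bounds the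
  -- mass of `R` by `norm0 γ f ^ 2`.
  set M := 1 + 4 * (2 + γ ^ 2) * C₂ with hM
  have hM0 : 0 < M := by positivity
  refine ⟨C₁ * (C₃ * Real.sqrt M) + 1, by positivity, fun ω φ hω f g H hf hg hH => ?_⟩
  set G : V → ℝ := fun v => ω v * g v with hGd
  set R : V → ℝ := fun w => bracket w ^ (8 : ℝ) * sqrtMu w * f w ^ 2 with hRd
  have hR : IsSchwartz R := (isSchwartz_sqrtMu.mul_bracket 8).mul hf.sq
  have hR0 : ∀ w, 0 ≤ R w := fun w => by
    have := (sqrtMu_pos w).le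
    have := Real.rpow_nonneg (bracket_pos w).le 8
    positivity
  have hP : IsSchwartz fun v => bracket v ^ (γ / 2) * G v := hg.mul_bracket _
  have sdG := isSchwartz_dens γ hg
  have sdH := isSchwartz_dens γ hH
  set T : V → ℝ := fun v => norm0 γ f ^ 2 * dens γ G v +
    (bracket v ^ (γ / 2) * G v) ^ 2 * kconv riesz R v with hT
  have sP : IsSchwartz fun v => (bracket v ^ (γ / 2) * G v) ^ 2 * kconv riesz R v :=
    hP.sq.mul_right (isKernel_riesz.hasTemperateGrowth_kconv hR)
  have sT : IsSchwartz T := (sdG.mul_left (HasTemperateGrowth.const _)).add sP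
  have hT0 : ∀ v, 0 ≤ T v := fun v => by
    have := dens_nonneg γ G v
    have hk : 0 ≤ kconv riesz R v := integral_nonneg fun w =>
      mul_nonneg (by unfold riesz; positivity) (hR0 w)
    positivity
  have hE : ∫ v, T v ≤ M * norm0 γ f ^ 2 * ∫ v, dens γ G v := by
    have e1 : ∫ v, T v = norm0 γ f ^ 2 * (∫ v, dens γ G v) +
        ∫ v, (bracket v ^ (γ / 2) * G v) ^ 2 * kconv riesz R v := by
      rw [hT, integral_add (sdG.integrable.const_mul _) sP.integrable, integral_const_mul]
    have e2 := integral_sq_mul_kconv_riesz_le hP hR hR0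
    have e3 : ∫ v, gradSq (fun v => bracket v ^ (γ / 2) * G v) v ≤
        (2 + γ ^ 2) * ∫ v, dens γ G v := by
      rw [← integral_const_mul]
      exact integral_mono hP.gradSq.integrable (sdG.integrable.const_mul _)
        fun v => gradSq_bracket_mul_le γ hg v
    have e4 := hb₂ f hf
    have e5 : 0 ≤ ∫ w, R w := integral_nonneg hR0
    have e6 : 0 ≤ ∫ v, dens γ G v := integral_nonneg (dens_nonneg γ G)
    rw [e1]
    calc _ ≤ norm0 γ f ^ 2 * (∫ v, dens γ G v) + (4 * ((2 + γ ^ 2) * ∫ v, dens γ G v)) *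
          (C₂ * norm0 γ f ^ 2) := by
          gcongr
          exact e2.trans (by gcongr)
      _ = _ := by rw [hM]; ring
  have hsq1 : (fun v => Real.sqrt (dens γ H v) ^ 2) = dens γ H :=
    funext fun v => Real.sq_sqrt (dens_nonneg _ _ _)
  have hsq2 : (fun v => Real.sqrt (T v) ^ 2) = T := funext fun v => Real.sq_sqrt (hT0 v)
  obtain ⟨hi, hle⟩ := abs_integral_mul_le_sqrt (a := fun v => Real.sqrt (dens γ H v))
    (b := fun v => Real.sqrt (T v)) sdH.continuous.sqrt.aestronglyMeasurable
    sT.continuous.sqrt.aestronglyMeasurable (by rw [hsq1]; exact sdH.integrable)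
    (by rw [hsq2]; exact sT.integrable)
  rw [hsq1, hsq2] at hle
  have hn : 0 ≤ norm0 γ f := Real.sqrt_nonneg _
  rw [hω.integral_mul_Gam h1 h2 hf hg hH, ← Real.norm_eq_abs]
  calc _ ≤ ∫ v, C₁ * (Real.sqrt (dens γ H v) * Real.sqrt (T v)) :=
        norm_integral_le_of_norm_le (hi.const_mul _) (ae_of_all _ fun v =>
          hb₁ φ hω.abs_le f G H hf v)
    _ = C₁ * ∫ v, Real.sqrt (dens γ H v) * Real.sqrt (T v) := integral_const_mul _ _
    _ ≤ C₁ * (Real.sqrt (∫ v, dens γ H v) * Real.sqrt (∫ v, T v)) := by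
        gcongr
        exact (le_abs_self _).trans hle
    _ ≤ C₁ * (Real.sqrt (C₃ * normASq γ H) *
          Real.sqrt (M * norm0 γ f ^ 2 * (C₃ * normASq γ G))) := by
        gcongr
        · exact hb₃ H hH
        · refine hE.trans ?_
          gcongr
          exact hb₃ G hg
    _ = C₁ * ((Real.sqrt C₃ * Real.sqrt C₃) * Real.sqrt M) * norm0 γ f *
          Real.sqrt (normASq γ G) * Real.sqrt (normASq γ H) := by
        rw [Real.sqrt_mul hC₃.le, Real.sqrt_mul (by positivity), Real.sqrt_mul hM0.le,
          Real.sqrt_sq hn, Real.sqrt_mul hC₃.le]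
        ring
    _ ≤ _ := by
        rw [Real.mul_self_sqrt hC₃.le]
        gcongr
        linarith

end

/-! ### Leibniz sums over multi-indices -/

theorem sum_multiIndex_succ {M : Type*} [AddCommMonoid M] (m : ℕ) (F : (Fin (m + 1) → Fin 3) → M) :
    ∑ I, F I = ∑ i : Fin 3, ∑ I : Fin m → Fin 3, F (Fin.snoc I i) := by
  rw [← (Fin.snocEquiv fun _ : Fin (m + 1) => Fin 3).sum_comp, Fintype.sum_prod_type]
  rfl

/-- `gradH` is defined by its outermost operator. The inductions below need the innermost one, which
acts directly on `Γ(f,g)`. -/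
theorem gradH_succ' (m : ℕ) (f : V → ℝ) (I : Fin (m + 1) → Fin 3) :
    gradH (m + 1) f I = gradH m (creation (I (Fin.last m)) f) (Fin.init I) := by
  induction m with
  | zero => rfl
  | succ m ih =>
    rw [gradH, ih, gradH]
    rfl

theorem gradH_snoc (m : ℕ) (f : V → ℝ) (I : Fin m → Fin 3) (i : Fin 3) :
    gradH (m + 1) f (Fin.snoc I i) = gradH m (creation i f) I := by
  rw [gradH_succ', Fin.snoc_last, Fin.init_snoc]

theorem IsSchwartz.gradH {f : V → ℝ} (hf : IsSchwartz f) (m : ℕ) (I : Fin m → Fin 3) :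
    IsSchwartz (gradH m f I) := by
  induction m with
  | zero => exact hf
  | succ m ih => exact (ih (Fin.tail I)).creation (I 0)

theorem gradH_add {f g : V → ℝ} (hf : IsSchwartz f) (hg : IsSchwartz g) (m : ℕ)
    (I : Fin m → Fin 3) :
    gradH m (fun v => f v + g v) I = fun v => gradH m f I v + gradH m g I v := by
  induction m with
  | zero => rfl
  | succ m ih =>
    rw [gradH, ih, creation_add (hf.gradH m _).differentiable (hg.gradH m _).differentiable]
    rfl

theorem IsWeight.isSchwartz_mul_gradH {B : ℝ} {ω φ : V → ℝ} (hω : IsWeight B ω φ) {f : V → ℝ}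
    (hf : IsSchwartz fun v => ω v * f v) (m : ℕ) (I : Fin m → Fin 3) :
    IsSchwartz fun v => ω v * gradH m f I v := by
  induction m with
  | zero => exact hf
  | succ m ih => exact hω.isSchwartz_mul_creation (ih (Fin.tail I)) (I 0)

/-- Pascal's rule with the term without derivatives on the first factor removed, as needed for the
commutator. -/
theorem pascal_sum_succ (a b : ℕ → ℝ) (m : ℕ) :
    ∑ p ∈ Finset.range (m + 1), ((m + 1).choose (p + 1) : ℝ) * a (p + 1) * b (m + 1 - (p + 1)) =
      ∑ p ∈ Finset.range (m + 1), (m.choose p : ℝ) * a (p + 1) * b (m - p) +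
      ∑ p ∈ Finset.range m, (m.choose (p + 1) : ℝ) * a (p + 1) * b (m + 1 - (p + 1)) := by
  have h : ∑ p ∈ Finset.range m, (m.choose (p + 1) : ℝ) * a (p + 1) * b (m + 1 - (p + 1)) =
      ∑ p ∈ Finset.range (m + 1), (m.choose (p + 1) : ℝ) * a (p + 1) * b (m + 1 - (p + 1)) := by
    rw [Finset.sum_range_succ, Nat.choose_succ_self]
    simp
  rw [h, ← Finset.sum_add_distrib]
  refine Finset.sum_congr rfl fun p _ => ?_
  rw [Nat.choose_succ_succ, Nat.add_sub_add_right]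
  push_cast
  ring

theorem pascal_sum (a b : ℕ → ℝ) (m : ℕ) :
    ∑ p ∈ Finset.range (m + 1 + 1), ((m + 1).choose p : ℝ) * a p * b (m + 1 - p) =
      ∑ p ∈ Finset.range (m + 1), (m.choose p : ℝ) * a (p + 1) * b (m - p) +
      ∑ p ∈ Finset.range (m + 1), (m.choose p : ℝ) * a p * b (m + 1 - p) := by
  rw [Finset.sum_range_succ', pascal_sum_succ,
    Finset.sum_range_succ' (fun p => (m.choose p : ℝ) * a p * b (m + 1 - p))]
  simp
  ring

/-- The `ℓ²` norm of the tensors `∇^p f_j`, measured in a given seminorm. -/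
noncomputable def famNorm (N : (V → ℝ) → ℝ) {J : Type} [Fintype J] (f : J → V → ℝ) (p : ℕ) : ℝ :=
  Real.sqrt (∑ j, ∑ I : Fin p → Fin 3, N (gradH p (f j) I) ^ 2)

/-- Passing from `J` to `J × Fin 3` amounts to one more derivative; this lets families carry the
induction. -/
theorem famNorm_creation (N : (V → ℝ) → ℝ) {J : Type} [Fintype J] (f : J → V → ℝ) (p : ℕ) :
    famNorm N (fun x : J × Fin 3 => creation x.2 (f x.1)) p = famNorm N f (p + 1) := by
  unfold famNorm
  rw [Fintype.sum_prod_type]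
  congr 1
  refine Finset.sum_congr rfl fun j _ => ?_
  rw [sum_multiIndex_succ]
  simp only [gradH_snoc]

/-- The seminorm `‖ω g‖_A`. -/
noncomputable def wnormA (γ : ℝ) (ω g : V → ℝ) : ℝ := Real.sqrt (normASq γ fun v => ω v * g v)

section

variable {γ : ℝ} (h1 : -3 < γ) (h2 : γ < 0)

include h1 h2

theorem trilinear_family_zero {C : ℝ} (hC : 0 ≤ C) {ω : V → ℝ}
    (hbase : ∀ f g H : V → ℝ, IsSchwartz f → IsSchwartz (fun v => ω v * g v) → IsSchwartz H →
      |∫ v, (ω v * Gam γ f g v) * H v| ≤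
        C * norm0 γ f * wnormA γ ω g * Real.sqrt (normASq γ H))
    {J K : Type} [Fintype J] [Fintype K] {f : J → V → ℝ} {g : K → V → ℝ} {H : J → K → V → ℝ}
    (hf : ∀ j, IsSchwartz (f j)) (hg : ∀ k, IsSchwartz fun v => ω v * g k v)
    (hH : ∀ j k, IsSchwartz (H j k)) :
    ∑ j, ∑ k, |∫ v, (ω v * Gam γ (f j) (g k) v) * H j k v| ≤
      C * (Real.sqrt (∑ j, norm0 γ (f j) ^ 2) * Real.sqrt (∑ k, wnormA γ ω (g k) ^ 2)) *
        Real.sqrt (∑ j, ∑ k, normASq γ (H j k)) := by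
  have hn : ∀ j k, Real.sqrt (normASq γ (H j k)) ^ 2 = normASq γ (H j k) := fun j k =>
    Real.sq_sqrt (normASq_nonneg h1 h2 (hH j k))
  calc _ ≤ ∑ j, ∑ k, C * ((norm0 γ (f j) * wnormA γ ω (g k)) * Real.sqrt (normASq γ (H j k))) := by
        gcongr with j _ k _
        refine (hbase _ _ _ (hf j) (hg k) (hH j k)).trans (le_of_eq ?_)
        ring
    _ = C * ∑ x : J × K, (norm0 γ (f x.1) * wnormA γ ω (g x.2)) *
          Real.sqrt (normASq γ (H x.1 x.2)) := by
        rw [Fintype.sum_prod_type, Finset.mul_sum]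
        simp only [Finset.mul_sum]
    _ ≤ C * (Real.sqrt (∑ x : J × K, (norm0 γ (f x.1) * wnormA γ ω (g x.2)) ^ 2) *
          Real.sqrt (∑ x : J × K, Real.sqrt (normASq γ (H x.1 x.2)) ^ 2)) := by
        gcongr
        exact Real.sum_mul_le_sqrt_mul_sqrt _ _ _
    _ = _ := by
        have e : ∑ x : J × K, (norm0 γ (f x.1) * wnormA γ ω (g x.2)) ^ 2 =
            (∑ j, norm0 γ (f j) ^ 2) * ∑ k, wnormA γ ω (g k) ^ 2 := by
          rw [Finset.sum_mul_sum, Fintype.sum_prod_type]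
          simp only [mul_pow]
        rw [e, Real.sqrt_mul (Finset.sum_nonneg fun _ _ => sq_nonneg _)]
        simp only [hn, Fintype.sum_prod_type, mul_assoc]

/-- The innermost operator falls on `f` or on `g` and enlarges the corresponding family, and
Pascal's rule adds the two inductive bounds. Test functions may depend on all indices, so
Cauchy-Schwarz is used only for `m = 0`. There the indices of `f` and `g` are independent, the norms
factor, and no power of three is lost. -/
theorem trilinear_family {B C : ℝ} (hC : 0 ≤ C) {ω φ : V → ℝ} (hω : IsWeight B ω φ)
    (hbase : ∀ f g H : V → ℝ, IsSchwartz f → IsSchwartz (fun v => ω v * g v) → IsSchwartz H →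
      |∫ v, (ω v * Gam γ f g v) * H v| ≤
        C * norm0 γ f * wnormA γ ω g * Real.sqrt (normASq γ H))
    (m : ℕ) : ∀ {J K : Type} [Fintype J] [Fintype K] {f : J → V → ℝ} {g : K → V → ℝ}
    {H : J → K → (Fin m → Fin 3) → V → ℝ}
    (_ : ∀ j, IsSchwartz (f j)) (_ : ∀ k, IsSchwartz fun v => ω v * g k v)
    (_ : ∀ j k I, IsSchwartz (H j k I)),
    ∑ j, ∑ k, ∑ I, |∫ v, (ω v * gradH m (Gam γ (f j) (g k)) I v) * H j k I v| ≤
      C * (∑ p ∈ Finset.range (m + 1),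
        (m.choose p : ℝ) * famNorm (norm0 γ) f p * famNorm (wnormA γ ω) g (m - p)) *
        Real.sqrt (∑ j, ∑ k, ∑ I, normASq γ (H j k I)) := by
  induction m with
  | zero =>
    intro J K _ _ f g H hf hg hH
    have := trilinear_family_zero h1 h2 hC hbase hf hg
      fun j k => hH j k (Pi.uniqueOfIsEmpty _).default
    simpa [famNorm, gradH, Fintype.sum_unique] using this
  | succ m ih =>
    intro J K _ _ f g H hf hg hH
    have hg' : ∀ k, IsSchwartz (g k) := fun k => hω.isSchwartz_of_mul (hg k)
    set S := Real.sqrt (∑ j, ∑ k, ∑ I, normASq γ (H j k I)) with hS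
    have t1 := ih (f := fun x : J × Fin 3 => creation x.2 (f x.1)) (g := g)
      (H := fun x k I => H x.1 k (Fin.snoc I x.2)) (fun x => (hf x.1).creation x.2) hg
      (fun x k I => hH _ _ _)
    have t2 := ih (f := f) (g := fun x : K × Fin 3 => creation x.2 (g x.1))
      (H := fun j x I => H j x.1 (Fin.snoc I x.2)) hf
      (fun x => hω.isSchwartz_mul_creation (hg x.1) x.2) (fun j x I => hH _ _ _)
    simp only [famNorm_creation, Fintype.sum_prod_type] at t1 t2
    have s1 : ∑ j, ∑ i, ∑ k, ∑ I, normASq γ (H j k (Fin.snoc I i)) =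
        ∑ j, ∑ k, ∑ I, normASq γ (H j k I) := by
      refine Finset.sum_congr rfl fun j _ => ?_
      rw [Finset.sum_comm]
      exact Finset.sum_congr rfl fun k _ =>
        (sum_multiIndex_succ m fun I => normASq γ (H j k I)).symm
    have s2 : ∑ j, ∑ k, ∑ i, ∑ I, normASq γ (H j k (Fin.snoc I i)) =
        ∑ j, ∑ k, ∑ I, normASq γ (H j k I) :=
      Finset.sum_congr rfl fun j _ => Finset.sum_congr rfl fun k _ =>
        (sum_multiIndex_succ m fun I => normASq γ (H j k I)).symm
    rw [s1, ← hS] at t1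
    rw [s2, ← hS] at t2
    have key : ∀ j k i I, |∫ v, (ω v * gradH (m + 1) (Gam γ (f j) (g k)) (Fin.snoc I i) v) *
        H j k (Fin.snoc I i) v| ≤
        |∫ v, (ω v * gradH m (Gam γ (creation i (f j)) (g k)) I v) * H j k (Fin.snoc I i) v| +
        |∫ v, (ω v * gradH m (Gam γ (f j) (creation i (g k))) I v) * H j k (Fin.snoc I i) v| := by
      intro j k i I
      have w1 := hω.isSchwartz_mul_gradH (hω.isSchwartz_mul_Gam h1 h2 ((hf j).creation i) (hg k)) m I
      have w2 := hω.isSchwartz_mul_gradH (hω.isSchwartz_mul_Gam h1 h2 (hf j)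
        (hω.isSchwartz_mul_creation (hg k) i)) m I
      have e : gradH (m + 1) (Gam γ (f j) (g k)) (Fin.snoc I i) = fun v =>
          gradH m (Gam γ (creation i (f j)) (g k)) I v +
            gradH m (Gam γ (f j) (creation i (g k))) I v := by
        rw [gradH_snoc, creation_Gam h1 h2 (hf j) (hg' k) i]
        exact gradH_add (isSchwartz_Gam h1 h2 ((hf j).creation i) (hg' k))
          (isSchwartz_Gam h1 h2 (hf j) ((hg' k).creation i)) m I
      refine le_trans (le_of_eq (congrArg abs ?_)) (abs_add_le _ _)
      rw [← integral_add (w1.mul (hH j k (Fin.snoc I i))).integrable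
        (w2.mul (hH j k (Fin.snoc I i))).integrable, e]
      refine integral_congr_ae (Eventually.of_forall fun v => ?_)
      ring
    calc _ = ∑ j, ∑ k, ∑ i, ∑ I, |∫ v, (ω v * gradH (m + 1) (Gam γ (f j) (g k)) (Fin.snoc I i) v) *
          H j k (Fin.snoc I i) v| :=
          Finset.sum_congr rfl fun j _ => Finset.sum_congr rfl fun k _ => sum_multiIndex_succ m _
      _ ≤ ∑ j, ∑ k, ∑ i, ∑ I,
          (|∫ v, (ω v * gradH m (Gam γ (creation i (f j)) (g k)) I v) * H j k (Fin.snoc I i) v| +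
          |∫ v, (ω v * gradH m (Gam γ (f j) (creation i (g k))) I v) * H j k (Fin.snoc I i) v|) := by
          gcongr with j _ k _ i _ I _
          exact key j k i I
      _ = (∑ j, ∑ i, ∑ k, ∑ I,
          |∫ v, (ω v * gradH m (Gam γ (creation i (f j)) (g k)) I v) * H j k (Fin.snoc I i) v|) +
          ∑ j, ∑ k, ∑ i, ∑ I,
          |∫ v, (ω v * gradH m (Gam γ (f j) (creation i (g k))) I v) * H j k (Fin.snoc I i) v| := by
          simp only [Finset.sum_add_distrib]
          congr 1
          exact Finset.sum_congr rfl fun j _ => Finset.sum_comm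
      _ ≤ _ := add_le_add t1 t2
      _ = _ := by
          rw [pascal_sum (famNorm (norm0 γ) f) (famNorm (wnormA γ ω) g), mul_add, add_mul]
          congr 3
          refine Finset.sum_congr rfl fun p hp => ?_
          rw [Finset.mem_range] at hp
          rw [show m + 1 - p = m - p + 1 by omega]

/-- The part of the Leibniz expansion in which `f` is differentiated at least once. -/
theorem trilinear_remainder {B C : ℝ} (hC : 0 ≤ C) {ω φ : V → ℝ} (hω : IsWeight B ω φ)
    (hbase : ∀ f g H : V → ℝ, IsSchwartz f → IsSchwartz (fun v => ω v * g v) → IsSchwartz H →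
      |∫ v, (ω v * Gam γ f g v) * H v| ≤
        C * norm0 γ f * wnormA γ ω g * Real.sqrt (normASq γ H))
    {f : V → ℝ} (hf : IsSchwartz f) (m : ℕ) : ∀ {K : Type} [Fintype K] {g : K → V → ℝ}
    {H : K → (Fin m → Fin 3) → V → ℝ}
    (_ : ∀ k, IsSchwartz fun v => ω v * g k v) (_ : ∀ k I, IsSchwartz (H k I)),
    ∑ k, ∑ I, |∫ v, (ω v * gradH m (Gam γ f (g k)) I v - ω v * Gam γ f (gradH m (g k) I) v) *
        H k I v| ≤
      C * (∑ p ∈ Finset.range m, (m.choose (p + 1) : ℝ) *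
        famNorm (norm0 γ) (fun _ : Unit => f) (p + 1) *
        famNorm (wnormA γ ω) g (m - (p + 1))) *
        Real.sqrt (∑ k, ∑ I, normASq γ (H k I)) := by
  induction m with
  | zero =>
    intro K _ g H hg hH
    simp [gradH]
  | succ m ih =>
    intro K _ g H hg hH
    have hg' : ∀ k, IsSchwartz (g k) := fun k => hω.isSchwartz_of_mul (hg k)
    set S := Real.sqrt (∑ k, ∑ I, normASq γ (H k I)) with hS
    -- Once an operator has fallen on `f`, the others are unrestricted and the full Leibniz estimate
    -- applies; when it falls on `g`, the remainder estimate is used again.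
    have t1 := trilinear_family h1 h2 hC hω hbase m
      (f := fun x : Unit × Fin 3 => creation x.2 ((fun _ : Unit => f) x.1)) (g := g)
      (H := fun x k I => H k (Fin.snoc I x.2)) (fun x => hf.creation x.2) hg
      (fun x k I => hH _ _)
    have t2 := ih (g := fun x : K × Fin 3 => creation x.2 (g x.1))
      (H := fun x I => H x.1 (Fin.snoc I x.2))
      (fun x => hω.isSchwartz_mul_creation (hg x.1) x.2) (fun x I => hH _ _)
    simp only [famNorm_creation (norm0 γ) fun _ : Unit => f] at t1
    simp only [famNorm_creation] at t2
    simp only [Fintype.sum_prod_type, Finset.univ_unique, Finset.sum_singleton] at t1 t2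
    have s2 : ∑ k, ∑ i, ∑ I, normASq γ (H k (Fin.snoc I i)) = ∑ k, ∑ I, normASq γ (H k I) :=
      Finset.sum_congr rfl fun k _ =>
        (sum_multiIndex_succ m fun I => normASq γ (H k I)).symm
    rw [Finset.sum_comm (s := (Finset.univ : Finset (Fin 3))) (t := (Finset.univ : Finset K)) (f :=
      fun i k => ∑ I, normASq γ (H k (Fin.snoc I i))), s2, ← hS] at t1
    rw [s2, ← hS] at t2
    have key : ∀ k i I, |∫ v, (ω v * gradH (m + 1) (Gam γ f (g k)) (Fin.snoc I i) v -
        ω v * Gam γ f (gradH (m + 1) (g k) (Fin.snoc I i)) v) * H k (Fin.snoc I i) v| ≤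
        |∫ v, (ω v * gradH m (Gam γ (creation i f) (g k)) I v) * H k (Fin.snoc I i) v| +
        |∫ v, (ω v * gradH m (Gam γ f (creation i (g k))) I v -
          ω v * Gam γ f (gradH m (creation i (g k)) I) v) * H k (Fin.snoc I i) v| := by
      intro k i I
      have hgi := hω.isSchwartz_mul_creation (hg k) i
      have w1 := hω.isSchwartz_mul_gradH (hω.isSchwartz_mul_Gam h1 h2 (hf.creation i) (hg k)) m I
      have w2 := hω.isSchwartz_mul_gradH (hω.isSchwartz_mul_Gam h1 h2 hf hgi) m I
      have w3 := hω.isSchwartz_mul_Gam h1 h2 hf (hω.isSchwartz_mul_gradH hgi m I)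
      have e : gradH (m + 1) (Gam γ f (g k)) (Fin.snoc I i) = fun v =>
          gradH m (Gam γ (creation i f) (g k)) I v + gradH m (Gam γ f (creation i (g k))) I v := by
        rw [gradH_snoc, creation_Gam h1 h2 hf (hg' k) i]
        exact gradH_add (isSchwartz_Gam h1 h2 (hf.creation i) (hg' k))
          (isSchwartz_Gam h1 h2 hf ((hg' k).creation i)) m I
      refine le_trans (le_of_eq (congrArg abs ?_)) (abs_add_le _ _)
      rw [← integral_add (w1.mul (hH k (Fin.snoc I i))).integrable
        ((w2.sub w3).mul (hH k (Fin.snoc I i))).integrable, e, gradH_snoc m (g k) I i]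
      refine integral_congr_ae (Eventually.of_forall fun v => ?_)
      ring
    calc _ = ∑ k, ∑ i, ∑ I, |∫ v, (ω v * gradH (m + 1) (Gam γ f (g k)) (Fin.snoc I i) v -
          ω v * Gam γ f (gradH (m + 1) (g k) (Fin.snoc I i)) v) * H k (Fin.snoc I i) v| :=
          Finset.sum_congr rfl fun k _ => sum_multiIndex_succ m _
      _ ≤ ∑ k, ∑ i, ∑ I,
          (|∫ v, (ω v * gradH m (Gam γ (creation i f) (g k)) I v) * H k (Fin.snoc I i) v| +
          |∫ v, (ω v * gradH m (Gam γ f (creation i (g k))) I v -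
            ω v * Gam γ f (gradH m (creation i (g k)) I) v) * H k (Fin.snoc I i) v|) := by
          gcongr with k _ i _ I _
          exact key k i I
      _ = (∑ i, ∑ k, ∑ I,
          |∫ v, (ω v * gradH m (Gam γ (creation i f) (g k)) I v) * H k (Fin.snoc I i) v|) +
          ∑ k, ∑ i, ∑ I, |∫ v, (ω v * gradH m (Gam γ f (creation i (g k))) I v -
            ω v * Gam γ f (gradH m (creation i (g k)) I) v) * H k (Fin.snoc I i) v| := by
          simp only [Finset.sum_add_distrib]
          congr 1
          exact Finset.sum_comm
      _ ≤ _ := add_le_add t1 t2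
      _ = _ := by
          rw [pascal_sum_succ (famNorm (norm0 γ) fun _ : Unit => f) (famNorm (wnormA γ ω) g),
            mul_add, add_mul]
          congr 3
          refine Finset.sum_congr rfl fun p hp => ?_
          rw [Finset.mem_range] at hp
          rw [show m + 1 - (p + 1) = m - (p + 1) + 1 by omega]

end

/-! ### The exponential weight and estimate (1) -/

/-- The function `φ` with `∂ₖ ω_t = φ vₖ ω_t`. -/
noncomputable def weightSlope (b c₀ t : ℝ) (v : V) : ℝ := c₀ / (1 + t) * b * bracket v ^ (b - 2)

section

variable {b c₀ t : ℝ}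

theorem weightSlope_nonneg (hb : 0 < b) (hc : 0 < c₀) (ht : 0 ≤ t) (v : V) :
    0 ≤ weightSlope b c₀ t v :=
  mul_nonneg (by positivity) (Real.rpow_nonneg (bracket_pos v).le _)

theorem div_one_add_le (hc : 0 < c₀) (ht : 0 ≤ t) : c₀ / (1 + t) ≤ c₀ :=
  div_le_self hc.le (by linarith)

theorem weightSlope_le (hb : 0 < b) (hb2 : b ≤ 2) (hc : 0 < c₀) (ht : 0 ≤ t) (v : V) :
    weightSlope b c₀ t v ≤ 2 * c₀ * bracket v ^ (b - 2) := by
  have h := div_one_add_le hc ht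
  have h0 : 0 ≤ c₀ / (1 + t) := by positivity
  refine mul_le_mul_of_nonneg_right ?_ (Real.rpow_nonneg (bracket_pos v).le _)
  nlinarith

/-- The slope bound uses `b ≤ 2`, `1 + t ≥ 1` and `⟨v⟩^{b-2} ≤ 1`. It is uniform in `t`, and so are
all later constants. -/
theorem isWeight_weight (hb : 0 < b) (hb2 : b ≤ 2) (hc : 0 < c₀) (ht : 0 ≤ t) :
    IsWeight (2 * c₀) (weight b c₀ t) (weightSlope b c₀ t) := by
  have hd : Differentiable ℝ fun v : V => bracket v ^ b :=
    (hasTemperateGrowth_bracket_rpow b).1.differentiable (by simp)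
  refine ⟨fun v => Real.one_le_exp (mul_nonneg (by positivity)
    (Real.rpow_nonneg (bracket_pos v).le _)), (hd.const_mul _).exp,
    (HasTemperateGrowth.const _).mul (hasTemperateGrowth_bracket_rpow _), fun k v => ?_,
    fun v => ?_⟩
  · have h1 := (((hd v).hasFDerivAt.const_mul (c₀ / (1 + t))).exp).fderiv
    have h2 := pd_bracket_rpow b k v
    unfold pd at h2 ⊢
    unfold weight weightSlope
    rw [h1]
    simp only [smul_apply, smul_eq_mul, h2]
    ring
  · rw [abs_of_nonneg (weightSlope_nonneg hb hc ht v)]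
    refine (weightSlope_le hb hb2 hc ht v).trans ?_
    have := Real.rpow_le_one_of_one_le_of_nonpos (one_le_bracket v) (by linarith : b - 2 ≤ 0)
    nlinarith

theorem Suitable.isSchwartz {f : V → ℝ} (hf : Suitable b c₀ t f) :
    IsSchwartz fun v => weight b c₀ t v * f v := by
  obtain ⟨g, hg⟩ := hf
  exact ⟨g, funext hg⟩

end

theorem famNorm_norm0 (γ : ℝ) (f : V → ℝ) (p : ℕ) :
    famNorm (norm0 γ) (fun _ : Unit => f) p = norm2 (γ / 2) (gradH p f) := by
  simp [famNorm, norm2, norm0_sq]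

theorem abs_pairing_le {m : ℕ} (S T : (Fin m → Fin 3) → V → ℝ) :
    |pairing S T| ≤ ∑ I, |∫ v, S I v * T I v| := Finset.abs_sum_le_sum_abs _ _

section

variable {γ b c₀ t : ℝ} (h1 : -3 < γ) (h2 : γ < 0) (hb : 0 < b) (hb2 : b ≤ 2) (hc : 0 < c₀)
  (ht : 0 ≤ t)

include hb hb2 hc ht

theorem isSchwartz_wgrad {f : V → ℝ} (hf : IsSchwartz fun v => weight b c₀ t v * f v) (m : ℕ)
    (I : Fin m → Fin 3) : IsSchwartz (wgrad b c₀ t m f I) :=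
  (isWeight_weight hb hb2 hc ht).isSchwartz_mul_gradH hf m I

include h1 h2

theorem famNorm_wnormA {f : V → ℝ} (hf : IsSchwartz fun v => weight b c₀ t v * f v) (p : ℕ) :
    famNorm (wnormA γ (weight b c₀ t)) (fun _ : Unit => f) p = normA γ (wgrad b c₀ t p f) := by
  unfold famNorm normA wnormA
  simp only [Finset.univ_unique, Finset.sum_singleton]
  congr 1
  refine Finset.sum_congr rfl fun I _ => ?_
  exact Real.sq_sqrt (normASq_nonneg h1 h2 (isSchwartz_wgrad hb hb2 hc ht hf p I))

omit hb hb2 ht in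
theorem pairing_Gam_le : ∃ C, 0 < C ∧ ∀ b t : ℝ, 0 < b → b ≤ 2 → 0 ≤ t → ∀ f g h : V → ℝ,
    IsSchwartz f → IsSchwartz (fun v => weight b c₀ t v * g v) →
    IsSchwartz (fun v => weight b c₀ t v * h v) → ∀ m : ℕ,
    PairingConverges (wgrad b c₀ t m (Gam γ f g)) (wgrad b c₀ t m h) ∧
    |pairing (wgrad b c₀ t m (Gam γ f g)) (wgrad b c₀ t m h)| ≤
      C * ∑ p ∈ Finset.range (m + 1), (m.choose p : ℝ) * norm2 (γ / 2) (gradH p f) *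
        normA γ (wgrad b c₀ t (m - p) g) * normA γ (wgrad b c₀ t m h) := by
  obtain ⟨C, hC, hbase⟩ := weighted_trilinear h1 h2 (2 * c₀)
  refine ⟨C, hC, fun b t hb hb2 ht f g h hf hg hh m => ⟨fun I => ?_, ?_⟩⟩
  · have hω := isWeight_weight hb hb2 hc ht
    exact ((isSchwartz_wgrad hb hb2 hc ht (hω.isSchwartz_mul_Gam h1 h2 hf hg) m I).mul
      (isSchwartz_wgrad hb hb2 hc ht hh m I)).integrable
  · have hω := isWeight_weight hb hb2 hc ht
    have := trilinear_family h1 h2 hC.le hω (hbase _ _ hω) m (f := fun _ : Unit => f)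
      (g := fun _ : Unit => g) (H := fun _ _ I => wgrad b c₀ t m h I) (fun _ => hf) (fun _ => hg)
      (fun _ _ I => isSchwartz_wgrad hb hb2 hc ht hh m I)
    simp only [Finset.univ_unique, Finset.sum_singleton, famNorm_norm0,
      famNorm_wnormA h1 h2 hb hb2 hc ht hg] at this
    refine ((abs_pairing_le _ _).trans this).trans (le_of_eq ?_)
    rw [mul_assoc, Finset.sum_mul]
    rfl

end

/-! ### Hermite functions: pointwise bounds and exact norms -/

/-- The annihilation operator `A_{-,k} = vₖ/2 + ∂ₖ`. -/
noncomputable def annihil (k : Fin 3) (f : V → ℝ) (v : V) : ℝ := v k / 2 * f v + pd k f v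

theorem creation_eq_sub_annihil (k : Fin 3) (f : V → ℝ) (v : V) :
    creation k f v = v k * f v - annihil k f v := by
  rw [creation, annihil]
  ring

theorem IsSchwartz.annihil {f : V → ℝ} (hf : IsSchwartz f) (k : Fin 3) :
    IsSchwartz (annihil k f) :=
  (hf.mul_left (hasTemperateGrowth_coord_half k)).add (hf.pd k)

/-- The canonical commutation relation, obtained from `A_{-,j} = v_j - A_{+,j}` and the
commutativity of creation operators. -/
theorem annihil_creation {f : V → ℝ} (hf : IsSchwartz f) (j i : Fin 3) (v : V) :
    annihil j (creation i f) v = creation i (annihil j f) v + if j = i then f v else 0 := by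
  have h1 : creation j f = fun v => v j * f v - annihil j f v :=
    funext fun v => creation_eq_sub_annihil j f v
  have hd : Differentiable ℝ fun u : V => u j :=
    (hasTemperateGrowth_coord j).1.differentiable (by simp)
  have h2 : annihil j (creation i f) v = v j * creation i f v - creation j (creation i f) v := by
    rw [creation_eq_sub_annihil j]
    ring
  rw [h2, creation_comm hf j i, h1, creation_sub (hd.fun_mul hf.differentiable)
    (hf.annihil j).differentiable, creation_mul hd hf.differentiable]
  simp only [pd_coord]
  split_ifs <;> ring

theorem annihil_sqrtMu (k : Fin 3) : annihil k sqrtMu = 0 := by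
  funext v
  rw [annihil, pd_sqrtMu, Pi.zero_apply]
  ring

/-- Commute `A_{-,j}` inwards until it kills `√μ`; each creation operator with the same index leaves
a term with that factor deleted. -/
theorem annihil_gradH_succ (n : ℕ) (j : Fin 3) (I : Fin (n + 1) → Fin 3) :
    annihil j (gradH (n + 1) sqrtMu I) =
      fun v => ∑ l, if j = I l then gradH n sqrtMu (l.removeNth I) v else 0 := by
  have hs := isSchwartz_sqrtMu
  have hz : ∀ i : Fin 3, creation i (0 : V → ℝ) = 0 := fun i => by
    funext v
    have : pd i (0 : V → ℝ) v = 0 := by simp [pd]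
    simp [creation, this]
  induction n with
  | zero =>
    funext v
    rw [gradH, annihil_creation (hs.gradH 0 _)]
    simp only [gradH, annihil_sqrtMu, hz]
    simp
  | succ n ih =>
    funext v
    rw [gradH, annihil_creation (hs.gradH _ _), ih (Fin.tail I), Fin.sum_univ_succ, add_comm]
    congr 1
    have hl : ∀ l : Fin (n + 1), IsSchwartz fun v =>
        if j = Fin.tail I l then gradH n sqrtMu (l.removeNth (Fin.tail I)) v else 0 := by
      intro l
      split_ifs
      · exact hs.gradH _ _
      · exact IsSchwartz.zero
    rw [creation_sum fun l _ => (hl l).differentiable]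
    refine Finset.sum_congr rfl fun l _ => ?_
    change _ = if j = Fin.tail I l then gradH (n + 1) sqrtMu (l.succ.removeNth I) v else 0
    split_ifs
    · rw [gradH]
      have : Fin.tail (l.succ.removeNth I) = l.removeNth (Fin.tail I) :=
        funext fun x => congrArg I (Fin.succ_succAbove_succ l x)
      rw [this]
      rfl
    · exact congrFun (hz _) v

/-- `∏_{j<n} (x + √(j+1))`, a majorant of the Hermite polynomials of degree `n`. -/
noncomputable def hermiteMajorant (x : ℝ) (n : ℕ) : ℝ :=
  ∏ j ∈ Finset.range n, (x + Real.sqrt (j + 1))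

theorem hermiteMajorant_nonneg {x : ℝ} (hx : 0 ≤ x) (n : ℕ) : 0 ≤ hermiteMajorant x n :=
  Finset.prod_nonneg fun _ _ => by positivity

/-- The three-term Hermite recurrence with positive signs, reduced to `n + 1 ≤ (x + √(n+1)) √(n+2)`.
-/
theorem hermiteMajorant_step {x : ℝ} (hx : 0 ≤ x) (n : ℕ) :
    x * hermiteMajorant x (n + 1) + (n + 1) * hermiteMajorant x n ≤ hermiteMajorant x (n + 2) := by
  have h0 := hermiteMajorant_nonneg hx n
  have e1 : hermiteMajorant x (n + 1) = hermiteMajorant x n * (x + Real.sqrt (n + 1)) :=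
    Finset.prod_range_succ _ _
  have e2 : hermiteMajorant x (n + 2) = hermiteMajorant x (n + 1) * (x + Real.sqrt (n + 1 + 1)) := by
    rw [hermiteMajorant, Finset.prod_range_succ]
    push_cast
    rfl
  have h1 : Real.sqrt (n + 1) * Real.sqrt (n + 1) = (n + 1 : ℝ) :=
    Real.mul_self_sqrt (by positivity)
  have h2 : Real.sqrt (n + 1) ≤ Real.sqrt ((n : ℝ) + 1 + 1) := Real.sqrt_le_sqrt (by linarith)
  have h3 := Real.sqrt_nonneg ((n : ℝ) + 1)
  have h4 : (n + 1 : ℝ) ≤ (x + Real.sqrt (n + 1)) * Real.sqrt ((n : ℝ) + 1 + 1) := by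
    nlinarith [mul_nonneg hx (h3.trans h2)]
  rw [e2, e1]
  nlinarith [mul_le_mul_of_nonneg_left h4 h0]

/-- Write the outermost `A_+` as `v - A_-`; annihilation leaves at most `n + 1` terms two degrees
lower, which is the recurrence of the majorant. -/
theorem abs_gradH_sqrtMu_le (n : ℕ) (I : Fin n → Fin 3) (v : V) :
    |gradH n sqrtMu I v| ≤ hermiteMajorant ‖v‖ n * sqrtMu v := by
  have hμ := (sqrtMu_pos v).le
  induction n using Nat.strong_induction_on with
  | _ n ih =>
  match n with
  | 0 => simp [gradH, hermiteMajorant, abs_of_nonneg hμ]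
  | 1 =>
    rw [gradH, creation_eq_sub_annihil]
    simp only [gradH, annihil_sqrtMu, Pi.zero_apply, sub_zero]
    rw [abs_mul, abs_of_nonneg hμ]
    refine mul_le_mul_of_nonneg_right ?_ hμ
    have := abs_coord_le v (I 0)
    simp [hermiteMajorant]
    linarith
  | n + 2 =>
    have h1 := ih (n + 1) (by omega) (Fin.tail I)
    have h2 := fun J => ih n (by omega) J
    rw [gradH, creation_eq_sub_annihil, annihil_gradH_succ]
    have h3 : |∑ l, if I 0 = Fin.tail I l then gradH n sqrtMu (l.removeNth (Fin.tail I)) v else 0|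
        ≤ (n + 1) * (hermiteMajorant ‖v‖ n * sqrtMu v) := by
      refine (Finset.abs_sum_le_sum_abs _ _).trans ?_
      refine (Finset.sum_le_card_nsmul _ _ (hermiteMajorant ‖v‖ n * sqrtMu v) fun l _ => ?_).trans
        (le_of_eq ?_)
      · split_ifs
        · exact h2 _
        · rw [abs_zero]
          exact mul_nonneg (hermiteMajorant_nonneg (norm_nonneg v) n) hμ
      · simp
    have h4 : |v (I 0) * gradH (n + 1) sqrtMu (Fin.tail I) v| ≤
        ‖v‖ * (hermiteMajorant ‖v‖ (n + 1) * sqrtMu v) := by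
      rw [abs_mul]
      exact mul_le_mul (abs_coord_le v _) h1 (abs_nonneg _) (norm_nonneg v)
    refine (abs_sub _ _).trans ((add_le_add h4 h3).trans ?_)
    have := mul_le_mul_of_nonneg_right (hermiteMajorant_step (norm_nonneg v) n) hμ
    linarith

/-- Each factor is at most `x + √n`, so the square is at most `(2/r)^n (r(x²+n))^n`, and `y^n ≤ n!
e^y`. The parameter `r` trades geometric growth in `n` against the Gaussian loss. -/
theorem hermiteMajorant_sq_le {x r : ℝ} (hx : 0 ≤ x) (hr : 0 < r) (n : ℕ) :
    hermiteMajorant x n ^ 2 ≤ (2 * Real.exp r / r) ^ n * n.factorial * Real.exp (r * x ^ 2) := by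
  have h1 : hermiteMajorant x n ≤ (x + Real.sqrt n) ^ n := by
    refine (Finset.prod_le_prod (fun _ _ => by positivity) fun j hj => ?_).trans
      (le_of_eq (Finset.prod_const _)) |>.trans (le_of_eq (by rw [Finset.card_range]))
    have : (j : ℝ) + 1 ≤ n := by
      exact_mod_cast Finset.mem_range.1 hj
    exact add_le_add_right (Real.sqrt_le_sqrt this) _
  have h2 : (x + Real.sqrt n) ^ 2 ≤ 2 * (x ^ 2 + n) := by
    nlinarith [sq_nonneg (x - Real.sqrt n), Real.sq_sqrt (Nat.cast_nonneg (α := ℝ) n)]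
  have h3 := Real.pow_div_factorial_le_exp (r * (x ^ 2 + n)) (by positivity) n
  rw [div_le_iff₀ (by positivity)] at h3
  calc hermiteMajorant x n ^ 2 ≤ ((x + Real.sqrt n) ^ n) ^ 2 :=
        pow_le_pow_left₀ (hermiteMajorant_nonneg hx n) h1 2
    _ = ((x + Real.sqrt n) ^ 2) ^ n := by rw [← pow_mul, ← pow_mul, mul_comm]
    _ ≤ (2 * (x ^ 2 + n)) ^ n := pow_le_pow_left₀ (sq_nonneg _) h2 n
    _ = (2 / r) ^ n * (r * (x ^ 2 + n)) ^ n := by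
        rw [← mul_pow]
        congr 1
        field_simp
    _ ≤ (2 / r) ^ n * (Real.exp (r * (x ^ 2 + n)) * n.factorial) :=
        mul_le_mul_of_nonneg_left h3 (by positivity)
    _ = _ := by
        rw [mul_add, Real.exp_add, mul_comm r (n : ℝ), Real.exp_nat_mul, mul_div_right_comm, mul_pow]
        ring

theorem gradH_sqrtMu_sq_le {r : ℝ} (hr : 0 < r) (n : ℕ) (I : Fin n → Fin 3) (v : V) :
    gradH n sqrtMu I v ^ 2 ≤ (2 * Real.exp r / r) ^ n * n.factorial *
      (Real.exp (r * ‖v‖ ^ 2) * maxwellian v) := by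
  rw [← sq_abs]
  refine (pow_le_pow_left₀ (abs_nonneg _) (abs_gradH_sqrtMu_le n I v) 2).trans ?_
  rw [mul_pow, sq (sqrtMu v), sqrtMu_mul_self, ← mul_assoc]
  exact mul_le_mul_of_nonneg_right (hermiteMajorant_sq_le (norm_nonneg v) hr n)
    (maxwellian_pos v).le

theorem isWeight_one : IsWeight 0 (fun _ => 1) fun _ => 0 :=
  ⟨fun _ => le_rfl, differentiable_const _, HasTemperateGrowth.const 0,
    fun k v => by simp [pd], fun _ => by simp⟩

theorem wcreation_zero (k : Fin 3) (G : V → ℝ) : wcreation (fun _ => 0) k G = creation k G := by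
  funext v
  simp [wcreation]

theorem wannihil_zero (k : Fin 3) (G : V → ℝ) : wannihil (fun _ => 0) k G = annihil k G := by
  funext v
  simp [wannihil, annihil]

theorem integral_creation_mul {G H : V → ℝ} (hG : IsSchwartz G) (hH : IsSchwartz H) (k : Fin 3) :
    ∫ v, creation k G v * H v = ∫ v, G v * annihil k H v := by
  have := isWeight_one.integral_wcreation_mul hG hH k
  rwa [wcreation_zero, wannihil_zero] at this

/-- The number operator `∑ A_{+,k} A_{-,k}` counts creation operators. -/
theorem sum_creation_annihil_gradH (n : ℕ) (I : Fin n → Fin 3) (v : V) :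
    ∑ k, creation k (annihil k (gradH n sqrtMu I)) v = n * gradH n sqrtMu I v := by
  have hs := isSchwartz_sqrtMu
  induction n generalizing v with
  | zero => simp [gradH, annihil_sqrtMu, creation, pd]
  | succ n ih =>
    set h := gradH n sqrtMu (Fin.tail I) with hh
    have sh : IsSchwartz h := hs.gradH _ _
    have e : ∀ k, creation k (annihil k (creation (I 0) h)) v =
        creation (I 0) (creation k (annihil k h)) v +
          if k = I 0 then creation (I 0) h v else 0 := by
      intro k
      rw [show annihil k (creation (I 0) h) = fun v => creation (I 0) (annihil k h) v +
        if k = I 0 then h v else 0 from funext fun v => annihil_creation sh k (I 0) v]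
      by_cases hk : k = I 0
      · simp only [hk, if_true]
        rw [creation_add ((sh.annihil _).creation _).differentiable sh.differentiable]
      · simp only [hk, if_false, add_zero]
        rw [creation_comm (sh.annihil k)]
    have e2 : ∑ k, creation (I 0) (creation k (annihil k h)) v = n * creation (I 0) h v := by
      rw [← congrFun (creation_sum (fun k _ => ((sh.annihil k).creation k).differentiable) (I 0)) v,
        show (fun u => ∑ k, creation k (annihil k h) u) = fun u => (fun _ => (n : ℝ)) u * h u from
          funext (ih (Fin.tail I)),
        creation_mul (differentiable_const _) sh.differentiable]
      simp [pd]
    rw [gradH, ← hh]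
    simp only [e]
    rw [Finset.sum_add_distrib, e2]
    simp
    ring

theorem sum_multiIndex_cons {M : Type*} [AddCommMonoid M] (m : ℕ)
    (F : (Fin (m + 1) → Fin 3) → M) :
    ∑ I, F I = ∑ I : Fin m → Fin 3, ∑ i : Fin 3, F (Fin.cons i I) := by
  rw [← (Fin.consEquiv fun _ : Fin (m + 1) => Fin 3).sum_comp, Fintype.sum_prod_type,
    Finset.sum_comm]
  rfl

theorem gradH_cons (m : ℕ) (f : V → ℝ) (I : Fin m → Fin 3) (i : Fin 3) :
    gradH (m + 1) f (Fin.cons i I) = creation i (gradH m f I) := by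
  rw [gradH, Fin.cons_zero, Fin.tail_cons]

/-- For `h` of degree `n`, `∑_i ‖A_{+,i} h‖² = (h, (N + 3) h) = (n + 3) ‖h‖²` with `N` the number
operator. The product `3 · 4 ⋯ (n + 2)` is `(n+2)!/2`. -/
theorem sum_integral_gradH_sqrtMu_sq (n : ℕ) :
    ∑ I, ∫ v, gradH n sqrtMu I v ^ 2 = (n + 2).factorial / 2 * ∫ v, sqrtMu v ^ 2 := by
  have hs := isSchwartz_sqrtMu
  induction n with
  | zero => simp [gradH]
  | succ n ih =>
    have key : ∀ I : Fin n → Fin 3, ∑ i, ∫ v, gradH (n + 1) sqrtMu (Fin.cons i I) v ^ 2 =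
        (n + 3) * ∫ v, gradH n sqrtMu I v ^ 2 := by
      intro I
      have sh := hs.gradH n I
      have e : ∀ i, ∫ v, gradH (n + 1) sqrtMu (Fin.cons i I) v ^ 2 =
          ∫ v, (gradH n sqrtMu I v * creation i (annihil i (gradH n sqrtMu I)) v +
            gradH n sqrtMu I v ^ 2) := by
        intro i
        simp only [gradH_cons, sq]
        rw [integral_creation_mul sh (sh.creation i)]
        refine integral_congr_ae (Eventually.of_forall fun v => ?_)
        simp only [annihil_creation sh, if_true]
        ring
      simp only [e]
      rw [← integral_finsetSum _ fun i _ =>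
        ((sh.mul ((sh.annihil i).creation i)).add sh.sq).integrable, ← integral_const_mul]
      refine integral_congr_ae (Eventually.of_forall fun v => ?_)
      simp only [Finset.sum_add_distrib, ← Finset.mul_sum, sum_creation_annihil_gradH]
      simp
      ring
    rw [sum_multiIndex_cons]
    simp only [key]
    rw [← Finset.mul_sum, ih, show n + 1 + 2 = n + 2 + 1 from rfl, Nat.factorial_succ (n + 2)]
    push_cast
    ring

theorem norm2_le {s : ℝ} (hs : s ≤ 0) {m : ℕ} {T : (Fin m → Fin 3) → V → ℝ}
    (hT : ∀ I, IsSchwartz (T I)) : norm2 s T ≤ Real.sqrt (∑ I, ∫ v, T I v ^ 2) := by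
  refine Real.sqrt_le_sqrt (Finset.sum_le_sum fun I _ => integral_mono
    ((hT I).mul_bracket s).sq.integrable (hT I).sq.integrable fun v => ?_)
  have h0 := Real.rpow_nonneg (bracket_pos v).le s
  have h1 := Real.rpow_le_one_of_one_le_of_nonpos (one_le_bracket v) hs
  simp only [mul_pow]
  exact mul_le_of_le_one_left (sq_nonneg _) (pow_le_one₀ h0 h1)

theorem norm2_gradH_sqrtMu_le {s : ℝ} (hs : s ≤ 0) (n : ℕ) :
    norm2 s (gradH n sqrtMu) ≤
      Real.sqrt (∫ v, sqrtMu v ^ 2) * Real.sqrt ((n + 2).factorial / 2) := by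
  refine (norm2_le hs fun I => isSchwartz_sqrtMu.gradH n I).trans (le_of_eq ?_)
  rw [sum_integral_gradH_sqrtMu_sq, Real.sqrt_mul (by positivity), mul_comm]

/-! ### Weighted `A`-norms of Hermite functions and estimate (2) -/

section

variable {γ : ℝ} (h1 : -3 < γ) (h2 : γ < 0)

include h1 h2

theorem averaged_form_le : ∃ C, 0 ≤ C ∧ ∀ (v : V) (x : Fin 3 → ℝ),
    ∑ j, ∑ k, averagedMatrix γ j k v * x k * x j ≤ C * (bracket v ^ 2 * ∑ i, x i ^ 2) := by
  obtain ⟨C, hC, h⟩ := exists_coeff_form_le h1 h2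
  refine ⟨C * norm0 γ sqrtMu, mul_nonneg hC (Real.sqrt_nonneg _), fun v x => ?_⟩
  have h3 := (le_abs_self _).trans (h sqrtMu isSchwartz_sqrtMu v x x)
  rw [Real.mul_self_sqrt (aniso_nonneg _ _ _)] at h3
  simp only [averagedMatrix_eq_coeff]
  refine h3.trans (mul_le_mul_of_nonneg_left ?_ (mul_nonneg hC (Real.sqrt_nonneg _)))
  have h4 : ∑ i, x i ^ 2 + crossDot v x x ≤ bracket v ^ 2 * ∑ i, x i ^ 2 := by
    rw [bracket_sq]
    linarith [crossDot_self_le v x]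
  have h5 : 0 ≤ ∑ i, x i ^ 2 + crossDot v x x :=
    add_nonneg (Finset.sum_nonneg fun _ _ => sq_nonneg _) (crossDot_self_nonneg v x)
  exact (mul_le_of_le_one_left h5
    (Real.rpow_le_one_of_one_le_of_nonpos (one_le_bracket v) h2.le)).trans h4

/-- A pointwise bound of `h` and its creations gives a bound of `‖ω h‖_A`. -/
theorem normASq_mul_le (B : ℝ) : ∃ C, 0 ≤ C ∧ ∀ ω φ : V → ℝ, IsWeight B ω φ → ∀ h : V → ℝ,
    IsSchwartz (fun v => ω v * h v) → ∀ E : V → ℝ,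
    (∀ v, h v ^ 2 ≤ E v) → (∀ k v, creation k h v ^ 2 ≤ E v) →
    Integrable (fun v => bracket v ^ 4 * (ω v ^ 2 * E v)) →
    normASq γ (fun v => ω v * h v) ≤ C * ∫ v, bracket v ^ 4 * (ω v ^ 2 * E v) := by
  obtain ⟨C, hC, hle⟩ := averaged_form_le h1 h2
  -- `2(1/2+B)² + 6` from the gradient (three components, a factor two each), plus one from the zero
  -- order term.
  refine ⟨C * (2 * (1 / 2 + B) ^ 2 + 7), by positivity, fun ω φ hω h hh E hE hE' hi => ?_⟩
  obtain ⟨hs, he⟩ := normASq_eq_integral h1 h2 hh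
  have hh' : IsSchwartz h := hω.isSchwartz_of_mul hh
  rw [he, ← integral_const_mul]
  refine integral_mono hs.integrable (hi.const_mul _) fun v => ?_
  have l1 := hle v fun k => pd k (fun u => ω u * h u) v
  have l2 := hle v fun k => v k
  rw [← norm_sq_eq_sum] at l2
  have hB : 0 ≤ B := (abs_nonneg _).trans (hω.abs_le v)
  have e1 : ∀ k, pd k (fun u => ω u * h u) v =
      ω v * ((1 / 2 + φ v) * v k * h v - creation k h v) := by
    intro k
    rw [pd_mul k (hω.differentiable v) (hh'.differentiable v), hω.pd_eq, creation]
    ring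
  have hφ : (1 / 2 + φ v) ^ 2 ≤ (1 / 2 + B) ^ 2 := by
    have := abs_le.1 (hω.abs_le v)
    exact sq_le_sq' (by linarith) (by linarith)
  have l3 : ∑ k, (pd k (fun u => ω u * h u) v) ^ 2 ≤
      ω v ^ 2 * (2 * (1 / 2 + B) ^ 2 * ‖v‖ ^ 2 * E v + 6 * E v) := by
    calc _ ≤ ∑ k, ω v ^ 2 * (2 * ((1 / 2 + B) ^ 2 * v k ^ 2 * E v) + 2 * E v) := by
          refine Finset.sum_le_sum fun k _ => ?_
          rw [e1, mul_pow]
          refine mul_le_mul_of_nonneg_left ?_ (sq_nonneg _)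
          have a1 := hE' k v
          have a2 : ((1 / 2 + φ v) * v k * h v) ^ 2 ≤ (1 / 2 + B) ^ 2 * v k ^ 2 * E v := by
            rw [mul_pow, mul_pow]
            exact mul_le_mul (mul_le_mul_of_nonneg_right hφ (sq_nonneg _)) (hE v) (sq_nonneg _)
              (by positivity)
          nlinarith [sq_nonneg ((1 / 2 + φ v) * v k * h v + creation k h v)]
      _ = _ := by
          rw [norm_sq_eq_sum]
          simp only [Fin.sum_univ_three]
          ring
  have hE0 : 0 ≤ E v := (sq_nonneg _).trans (hE v)
  have hb := bracket_sq v
  have hn := sq_nonneg ‖v‖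
  have hω2 := sq_nonneg (ω v)
  have hx : 0 ≤ ω v ^ 2 * E v := mul_nonneg hω2 hE0
  have l4 : (ω v * h v) ^ 2 ≤ ω v ^ 2 * E v := by
    rw [mul_pow]
    exact mul_le_mul_of_nonneg_left (hE v) hω2
  have l5 : bracket v ^ 2 * ∑ k, (pd k (fun u => ω u * h u) v) ^ 2 ≤
      (2 * (1 / 2 + B) ^ 2 + 6) * (bracket v ^ 4 * (ω v ^ 2 * E v)) := by
    refine (mul_le_mul_of_nonneg_left l3 (sq_nonneg _)).trans ?_
    have : ω v ^ 2 * (2 * (1 / 2 + B) ^ 2 * ‖v‖ ^ 2 * E v + 6 * E v) ≤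
        (2 * (1 / 2 + B) ^ 2 + 6) * (bracket v ^ 2 * (ω v ^ 2 * E v)) := by
      rw [hb]
      nlinarith [mul_nonneg hn hx, mul_nonneg (sq_nonneg (1 / 2 + B)) hx]
    refine (mul_le_mul_of_nonneg_left this (sq_nonneg (bracket v))).trans (le_of_eq (by ring))
  have l6 : 1 / 4 * (ω v * h v) ^ 2 * (bracket v ^ 2 * ‖v‖ ^ 2) ≤
      bracket v ^ 4 * (ω v ^ 2 * E v) := by
    have : bracket v ^ 2 * ‖v‖ ^ 2 ≤ bracket v ^ 4 := by nlinarith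
    calc _ ≤ 1 / 4 * (ω v ^ 2 * E v) * bracket v ^ 4 := by gcongr
      _ ≤ _ := by nlinarith [mul_nonneg hx (by positivity : 0 ≤ bracket v ^ 4)]
  have l7 : 1 / 4 * (ω v * h v) ^ 2 * ∑ j, ∑ k, averagedMatrix γ j k v * v k * v j ≤
      C * (1 / 4 * (ω v * h v) ^ 2 * (bracket v ^ 2 * ‖v‖ ^ 2)) := by
    refine (mul_le_mul_of_nonneg_left l2 (by positivity)).trans (le_of_eq (by ring))
  have l8 := mul_le_mul_of_nonneg_left l5 hC
  have l9 := mul_le_mul_of_nonneg_left l6 hC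
  linarith

end

theorem exists_rpow_le_sq {b c : ℝ} (hb : 0 < b) (hb2 : b < 2) (hc : 0 < c) :
    ∃ D : ℝ, ∀ y : ℝ, 1 ≤ y → c * y ^ b ≤ y ^ 2 / 8 + D := by
  -- The point where `c y^b = y²/8`.
  set R := (8 * c) ^ (1 / (2 - b)) with hR
  have hR0 : 0 < R := Real.rpow_pos_of_pos (by positivity) _
  have h2b : 0 < 2 - b := by linarith
  have hRb : R ^ (2 - b) = 8 * c := by
    rw [hR, ← Real.rpow_mul (by positivity), one_div_mul_cancel h2b.ne', Real.rpow_one]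
  refine ⟨c * R ^ b, fun y hy => ?_⟩
  have hy0 : 0 < y := by linarith
  rcases le_total y R with h | h
  · have := mul_le_mul_of_nonneg_left (Real.rpow_le_rpow hy0.le h hb.le) hc.le
    nlinarith [sq_nonneg y]
  · have h3 : 8 * c ≤ y ^ (2 - b) := hRb ▸ Real.rpow_le_rpow hR0.le h h2b.le
    have h4 : y ^ (2 - b) * y ^ b = y ^ 2 := by
      rw [← Real.rpow_add hy0, sub_add_cancel, Real.rpow_two]
    have h5 := mul_le_mul_of_nonneg_right h3 (Real.rpow_nonneg hy0.le b)
    have h6 : 0 ≤ c * R ^ b := mul_nonneg hc.le (Real.rpow_nonneg hR0.le _)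
    rw [h4] at h5
    linarith

theorem IsWeight.isSchwartz_mul_sqrtMu {B : ℝ} {ω φ : V → ℝ} (hω : IsWeight B ω φ) {r C : ℝ}
    (hr : 0 < r) (h : ∀ v, ω v ^ 2 * maxwellian v ≤ C * Real.exp (-(r * ‖v‖ ^ 2))) :
    IsSchwartz fun v => ω v * sqrtMu v := by
  refine isSchwartz_of_pd_eq_mul (p := fun k v => φ v * v k - v k / 2)
    (hω.differentiable.mul isSchwartz_sqrtMu.differentiable)
    (fun k => (hasTemperateGrowth_fun_mul hω.tg (hasTemperateGrowth_coord k)).sub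
      (hasTemperateGrowth_coord_half k)) (fun k v => ?_) fun k => ?_
  · rw [pd_mul k (hω.differentiable v) (isSchwartz_sqrtMu.differentiable v), hω.pd_eq, pd_sqrtMu]
    ring
  · obtain ⟨D, hD⟩ := exp_neg_mul_sq_decay hr (2 * k)
    refine ⟨Real.sqrt (C * D), fun v => Real.le_sqrt_of_sq_le ?_⟩
    have hC : 0 ≤ C := by
      have h0 := (mul_nonneg (sq_nonneg (ω 0)) (maxwellian_pos 0).le).trans (h 0)
      exact nonneg_of_mul_nonneg_left h0 (Real.exp_pos _)
    have e : ((1 + ‖v‖) ^ k * |ω v * sqrtMu v|) ^ 2 =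
        (1 + ‖v‖) ^ (2 * k) * (ω v ^ 2 * maxwellian v) := by
      rw [mul_pow, sq_abs, ← sqrtMu_mul_self]
      ring
    rw [e]
    calc _ ≤ (1 + ‖v‖) ^ (2 * k) * (C * Real.exp (-(r * ‖v‖ ^ 2))) :=
          mul_le_mul_of_nonneg_left (h v) (by positivity)
      _ = C * ((1 + ‖v‖) ^ (2 * k) * Real.exp (-(r * ‖v‖ ^ 2))) := by ring
      _ ≤ C * D := mul_le_mul_of_nonneg_left (hD _ (norm_nonneg v)) hC

/-- At `b = 2` the worst exponent of `ω² μ` is `(2c₀ - 1/2)|v|²`, whence the threshold `1/4`. The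
spare Gaussian is spent twice: one factor pays for the loss in the Hermite bound, the other secures
integrability. -/
theorem weight_gaussian_le {b c₀ : ℝ} (hb : 0 < b) (hb2 : b ≤ 2) (hc : 0 < c₀)
    (h : b < 2 ∨ c₀ < 1 / 4) : ∃ r C : ℝ, 0 < r ∧ 0 < C ∧ ∀ t : ℝ, 0 ≤ t → ∀ v : V,
    weight b c₀ t v ^ 2 * (Real.exp (r * ‖v‖ ^ 2) * maxwellian v) ≤
      C * Real.exp (-(r * ‖v‖ ^ 2)) := by
  have key : ∃ r D : ℝ, 0 < r ∧ ∀ y : ℝ, 1 ≤ y → 2 * (c₀ * y ^ b) + (2 * r - 1 / 2) * y ^ 2 ≤ D := by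
    rcases lt_or_eq_of_le hb2 with hb3 | hb3
    · obtain ⟨D, hD⟩ := exists_rpow_le_sq hb hb3 hc
      refine ⟨1 / 8, 2 * D, by norm_num, fun y hy => ?_⟩
      linarith [hD y hy]
    · have hc4 : c₀ < 1 / 4 := h.resolve_left (by rw [hb3]; exact lt_irrefl _)
      -- With this `r` the coefficient `2c₀ + 2r - 1/2` of `y²` vanishes.
      refine ⟨(1 / 2 - 2 * c₀) / 2, 0, by linarith, fun y _ => le_of_eq ?_⟩
      rw [hb3, Real.rpow_two]
      ring
  obtain ⟨r, D, hr, hD⟩ := key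
  have hK : 0 < (2 * Real.pi) ^ (-(3 / 2) : ℝ) := Real.rpow_pos_of_pos (by positivity) _
  refine ⟨r, (2 * Real.pi) ^ (-(3 / 2) : ℝ) * Real.exp (D - 2 * r + 1 / 2), hr,
    mul_pos hK (Real.exp_pos _), fun t ht v => ?_⟩
  have h1 := hD (bracket v) (one_le_bracket v)
  rw [bracket_sq] at h1
  have h2 : c₀ / (1 + t) * bracket v ^ b ≤ c₀ * bracket v ^ b :=
    mul_le_mul_of_nonneg_right (div_one_add_le hc ht) (Real.rpow_nonneg (bracket_pos v).le _)
  rw [weight, maxwellian, ← Real.exp_nat_mul]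
  calc _ = (2 * Real.pi) ^ (-(3 / 2) : ℝ) * Real.exp
        (((2 : ℕ) : ℝ) * (c₀ / (1 + t) * bracket v ^ b) + (r * ‖v‖ ^ 2 + -‖v‖ ^ 2 / 2)) := by
        rw [Real.exp_add, Real.exp_add]
        ring
    _ ≤ (2 * Real.pi) ^ (-(3 / 2) : ℝ) * Real.exp (D - 2 * r + 1 / 2 + -(r * ‖v‖ ^ 2)) := by
        refine mul_le_mul_of_nonneg_left (Real.exp_le_exp.2 ?_) hK.le
        push_cast
        linarith
    _ = _ := by
        rw [Real.exp_add]
        ring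

theorem creation_neg (k : Fin 3) (f : V → ℝ) :
    creation k (fun v => -f v) = fun v => -creation k f v := by
  funext v
  rw [creation, creation, pd_neg]
  ring

theorem gradH_neg (m : ℕ) (f : V → ℝ) (I : Fin m → Fin 3) :
    gradH m (fun v => -f v) I = fun v => -gradH m f I v := by
  induction m with
  | zero => rfl
  | succ m ih => rw [gradH, ih, creation_neg, gradH]

section

variable {γ b c₀ : ℝ} (h1 : -3 < γ) (h2 : γ < 0) (hb : 0 < b) (hb2 : b ≤ 2) (hc : 0 < c₀)
  (h : b < 2 ∨ c₀ < 1 / 4)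

include h1 h2 hb hb2 hc h

theorem exists_normA_wgrad_sqrtMu_le : ∃ C₅ C₆ : ℝ, 0 < C₅ ∧ 0 < C₆ ∧ ∀ t : ℝ, 0 ≤ t →
    IsSchwartz (fun v => weight b c₀ t v * sqrtMu v) ∧ ∀ n : ℕ,
    normA γ (wgrad b c₀ t n sqrtMu) ≤
      C₆ * (Real.sqrt C₅ ^ n * Real.sqrt ((n + 3).factorial : ℝ)) := by
  obtain ⟨r, D, hr, hD, hle⟩ := weight_gaussian_le hb hb2 hc h
  obtain ⟨C, hC, hA⟩ := normASq_mul_le h1 h2 (2 * c₀)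
  set K := 2 * Real.exp r / r with hK
  -- Needed to use one bound, of degree `n + 1`, for both `∇^n √μ` and its creations.
  have hK1 : 1 ≤ K := by
    rw [hK, le_div_iff₀ hr]
    linarith [Real.add_one_le_exp r, Real.exp_pos r]
  have hK0 : 0 < K := by linarith
  have hdom : IsSchwartz fun v : V => bracket v ^ 4 * (D * Real.exp (-(r * ‖v‖ ^ 2))) := by
    have := ((isSchwartz_gaussian hr).mul_left (HasTemperateGrowth.const D)).mul_bracket 4
    have e : ∀ v : V, bracket v ^ (4 : ℝ) = bracket v ^ 4 := fun v => by
      rw [← Real.rpow_natCast]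
      norm_num
    simpa only [e] using this
  set J := ∫ v : V, bracket v ^ 4 * (D * Real.exp (-(r * ‖v‖ ^ 2))) with hJ
  have hJ0 : 0 ≤ J := integral_nonneg fun v => by have := bracket_pos v; positivity
  -- The three counts the `3^n` components and `K` is the rate in the Hermite bound; the `+ 1`
  -- ensures positivity.
  refine ⟨3 * K, Real.sqrt (C * (K * J) + 1), by positivity, by positivity,
    fun t ht => ?_⟩
  have hω := isWeight_weight hb hb2 hc ht
  have hS : IsSchwartz fun v => weight b c₀ t v * sqrtMu v := by
    refine hω.isSchwartz_mul_sqrtMu hr fun v => le_trans ?_ (hle t ht v)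
    refine mul_le_mul_of_nonneg_left ?_ (sq_nonneg _)
    exact le_mul_of_one_le_left (maxwellian_pos v).le (Real.one_le_exp (by positivity))
  refine ⟨hS, fun n => ?_⟩
  have hF : (0 : ℝ) ≤ (n + 1).factorial := by positivity
  have hpt : ∀ v : V, bracket v ^ 4 * (weight b c₀ t v ^ 2 * (K ^ (n + 1) * (n + 1).factorial *
      (Real.exp (r * ‖v‖ ^ 2) * maxwellian v))) ≤ K ^ (n + 1) * (n + 1).factorial *
        (bracket v ^ 4 * (D * Real.exp (-(r * ‖v‖ ^ 2)))) := by
    intro v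
    have h3 : (0 : ℝ) ≤ K ^ (n + 1) * (n + 1).factorial * bracket v ^ 4 := by
      have := bracket_pos v
      positivity
    calc _ = K ^ (n + 1) * (n + 1).factorial * bracket v ^ 4 *
          (weight b c₀ t v ^ 2 * (Real.exp (r * ‖v‖ ^ 2) * maxwellian v)) := by ring
      _ ≤ _ := mul_le_mul_of_nonneg_left (hle t ht v) h3
      _ = _ := by ring
  have hint : Integrable fun v : V => bracket v ^ 4 * (weight b c₀ t v ^ 2 *
      (K ^ (n + 1) * (n + 1).factorial * (Real.exp (r * ‖v‖ ^ 2) * maxwellian v))) := by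
    refine (hdom.integrable.const_mul (K ^ (n + 1) * (n + 1).factorial)).mono' ?_
      (ae_of_all _ fun v => ?_)
    · have c1 : Continuous (weight b c₀ t) := hω.differentiable.continuous
      have c2 : Continuous maxwellian := isSchwartz_maxwellian.continuous
      have c3 : Continuous bracket := by
        unfold bracket
        fun_prop
      exact Continuous.aestronglyMeasurable (by fun_prop)
    · rw [Real.norm_of_nonneg]
      · exact hpt v
      · have := bracket_pos v
        have := maxwellian_pos v
        positivity
  have hI : ∀ I : Fin n → Fin 3, normASq γ (wgrad b c₀ t n sqrtMu I) ≤
      C * (K ^ (n + 1) * (n + 1).factorial * J) := by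
    intro I
    have hcomp : ∀ v : V, (0 : ℝ) ≤ Real.exp (r * ‖v‖ ^ 2) * maxwellian v := fun v =>
      mul_nonneg (Real.exp_pos _).le (maxwellian_pos v).le
    refine (hA _ _ hω (gradH n sqrtMu I) (hω.isSchwartz_mul_gradH hS n I) _ (fun v => ?_)
      (fun k v => ?_) hint).trans (mul_le_mul_of_nonneg_left ?_ hC)
    · refine (gradH_sqrtMu_sq_le hr n I v).trans (mul_le_mul_of_nonneg_right ?_ (hcomp v))
      refine mul_le_mul (pow_le_pow_right₀ hK1 n.le_succ) ?_ (by positivity) (by positivity)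
      exact_mod_cast Nat.factorial_le n.le_succ
    · have := gradH_sqrtMu_sq_le hr (n + 1) (Fin.cons k I) v
      rwa [gradH_cons] at this
    · rw [hJ, ← integral_const_mul]
      exact integral_mono hint (hdom.integrable.const_mul _) hpt
  have hsum : ∑ I, normASq γ (wgrad b c₀ t n sqrtMu I) ≤
      (C * (K * J) + 1) * ((3 * K) ^ n * (n + 3).factorial) := by
    refine (Finset.sum_le_card_nsmul _ _ _ fun I _ => hI I).trans ?_
    have hf : ((n + 1).factorial : ℝ) ≤ (n + 3).factorial := by
      exact_mod_cast Nat.factorial_le (by omega)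
    simp only [Finset.card_univ, Fintype.card_fun, Fintype.card_fin, nsmul_eq_mul]
    push_cast
    calc (3 : ℝ) ^ n * (C * (K ^ (n + 1) * (n + 1).factorial * J))
        = (C * (K * J)) * ((3 * K) ^ n * (n + 1).factorial) := by
          rw [mul_pow]
          ring
      _ ≤ _ := by
          refine mul_le_mul (by linarith) ?_ (by positivity) (by positivity)
          exact mul_le_mul_of_nonneg_left hf (by positivity)
  rw [normA, Real.sqrt_le_left (by positivity), mul_pow, mul_pow, ← pow_mul, mul_comm n 2, pow_mul,
    Real.sq_sqrt (by positivity), Real.sq_sqrt (by positivity), Real.sq_sqrt (by positivity)]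
  exact hsum

theorem exists_pairing_opL2_le : ∃ C₅ C₆ : ℝ, 0 < C₅ ∧ 0 < C₆ ∧ ∀ (m : ℕ) (t : ℝ) (f : V → ℝ),
    0 ≤ t → IsSchwartz (fun v => weight b c₀ t v * f v) →
    PairingConverges (wgrad b c₀ t m (opL2 γ f)) (wgrad b c₀ t m f) ∧
    |pairing (wgrad b c₀ t m (opL2 γ f)) (wgrad b c₀ t m f)| ≤
      C₆ * ∑ p ∈ Finset.range (m + 1), (m.choose p : ℝ) * Real.sqrt C₅ ^ (m - p) *
        Real.sqrt ((m - p + 3).factorial : ℝ) * norm2 (γ / 2) (gradH p f) *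
        normA γ (wgrad b c₀ t m f) := by
  obtain ⟨C₅, C₆, h5, h6, hμ⟩ := exists_normA_wgrad_sqrtMu_le h1 h2 hb hb2 hc h
  obtain ⟨C, hC, hp⟩ := pairing_Gam_le h1 h2 hc
  refine ⟨C₅, C * C₆, h5, by positivity, fun m t f ht hf => ?_⟩
  obtain ⟨hS, hn⟩ := hμ t ht
  obtain ⟨p1, p2⟩ := hp b t hb hb2 ht f sqrtMu f
    ((isWeight_weight hb hb2 hc ht).isSchwartz_of_mul hf) hS hf m
  have e : ∀ I v, wgrad b c₀ t m (opL2 γ f) I v * wgrad b c₀ t m f I v =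
      -(wgrad b c₀ t m (Gam γ f sqrtMu) I v * wgrad b c₀ t m f I v) := by
    intro I v
    have : gradH m (opL2 γ f) I v = -gradH m (Gam γ f sqrtMu) I v :=
      congrFun (gradH_neg m (Gam γ f sqrtMu) I) v
    rw [wgrad, this, wgrad, wgrad]
    ring
  refine ⟨fun I => (p1 I).neg.congr (ae_of_all _ fun v => (e I v).symm), ?_⟩
  have e2 : pairing (wgrad b c₀ t m (opL2 γ f)) (wgrad b c₀ t m f) =
      -pairing (wgrad b c₀ t m (Gam γ f sqrtMu)) (wgrad b c₀ t m f) := by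
    simp only [pairing, e, integral_neg, Finset.sum_neg_distrib]
  rw [e2, abs_neg, mul_assoc, Finset.mul_sum]
  refine p2.trans (mul_le_mul_of_nonneg_left (Finset.sum_le_sum fun p _ => ?_) hC.le)
  have h3 : 0 ≤ (m.choose p : ℝ) * norm2 (γ / 2) (gradH p f) :=
    mul_nonneg (Nat.cast_nonneg _) (Real.sqrt_nonneg _)
  calc _ ≤ (m.choose p : ℝ) * norm2 (γ / 2) (gradH p f) *
        (C₆ * (Real.sqrt C₅ ^ (m - p) * Real.sqrt ((m - p + 3).factorial : ℝ))) *
        normA γ (wgrad b c₀ t m f) :=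
        mul_le_mul_of_nonneg_right (mul_le_mul_of_nonneg_left (hn _) h3) (Real.sqrt_nonneg _)
    _ = _ := by ring

end

/-! ### The commutator with the linearized operator and estimate (3) -/

theorem collisionMatrix_comm (γ : ℝ) (j k : Fin 3) (z : V) :
    collisionMatrix γ j k z = collisionMatrix γ k j z := by
  simp only [collisionMatrix, eq_comm (a := j), mul_comm (z j)]

theorem averagedMatrix_comm (γ : ℝ) (j k : Fin 3) (v : V) :
    averagedMatrix γ j k v = averagedMatrix γ k j v := by
  simp only [averagedMatrix, collisionMatrix_comm γ j k]

theorem creation_sqrtMu (k : Fin 3) : creation k sqrtMu = fun v => v k * sqrtMu v := by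
  funext v
  rw [creation, pd_sqrtMu]
  ring

section

variable {γ : ℝ} (h1 : -3 < γ) (h2 : γ < 0)

include h1 h2

/-- As `A_{+,k} √μ = w_k √μ` and `a(v-w)(v-w) = 0`, the factor `w_k` under the integral may be
replaced by `v_k`. -/
theorem sum_coeff_creation_sqrtMu (j : Fin 3) (v : V) :
    ∑ k, coeff γ (creation k sqrtMu) j k v = ∑ k, averagedMatrix γ j k v * v k := by
  have hs := isSchwartz_sqrtMu
  have i1 : ∀ k, Integrable fun w => collisionMatrix γ j k (v - w) *
      (sqrtMu w * creation k sqrtMu w) := fun k =>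
    (isKernel_collisionMatrix h1 h2 j k).integrable (hs.mul (hs.creation k)) v
  have i2 : ∀ k, Integrable fun w => collisionMatrix γ j k (v - w) * (sqrtMu w * sqrtMu w) :=
    fun k => (isKernel_collisionMatrix h1 h2 j k).integrable (hs.mul hs) v
  rw [eq_comm, ← sub_eq_zero, ← Finset.sum_sub_distrib]
  simp only [averagedMatrix_eq_coeff, coeff, kconv]
  have e : ∀ k, (∫ w, collisionMatrix γ j k (v - w) * (sqrtMu w * sqrtMu w)) * v k -
      ∫ w, collisionMatrix γ j k (v - w) * (sqrtMu w * creation k sqrtMu w) =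
      ∫ w, collisionMatrix γ j k (v - w) * (v - w) k * (sqrtMu w * sqrtMu w) := by
    intro k
    rw [← integral_mul_const, ← integral_sub ((i2 k).mul_const _) (i1 k)]
    refine integral_congr_ae (Eventually.of_forall fun w => ?_)
    simp only [creation_sqrtMu, PiLp.sub_apply]
    ring
  have i3 : ∀ k, Integrable fun w =>
      collisionMatrix γ j k (v - w) * (v - w) k * (sqrtMu w * sqrtMu w) := by
    intro k
    refine (((i2 k).mul_const (v k)).sub (i1 k)).congr (ae_of_all _ fun w => ?_)
    simp only [creation_sqrtMu, PiLp.sub_apply, Pi.sub_apply]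
    ring
  simp only [e]
  rw [← integral_finsetSum _ fun k _ => i3 k]
  simp only [← Finset.sum_mul, sum_collisionMatrix_mul_self, zero_mul, integral_zero]

/-- The conjugated flux collapses to `-ā (A_- H - φ v H)` and is paired with `A_- H + φ v H`. By the
symmetry of `ā` the cross terms cancel, leaving a difference of two quadratic forms. -/
theorem integral_mul_Gam_sqrtMu {B : ℝ} {ω φ : V → ℝ} (hω : IsWeight B ω φ) {h : V → ℝ}
    (hh : IsSchwartz fun v => ω v * h v) :
    ∫ v, (ω v * Gam γ sqrtMu h v) * (ω v * h v) =
      ∫ v, ((φ v * (ω v * h v)) ^ 2 * (∑ j, ∑ k, averagedMatrix γ j k v * v k * v j) -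
        ∑ j, ∑ k, averagedMatrix γ j k v * annihil k (fun v => ω v * h v) v *
          annihil j (fun v => ω v * h v) v) := by
  rw [hω.integral_mul_Gam h1 h2 isSchwartz_sqrtMu hh hh]
  refine integral_congr_ae (Eventually.of_forall fun v => ?_)
  set H : V → ℝ := fun v => ω v * h v with hH
  have e1 : ∀ j, ∑ k, wflux γ φ sqrtMu H j k v =
      -∑ k, averagedMatrix γ j k v * (annihil k H v - φ v * v k * H v) := by
    intro j
    simp only [wflux]
    rw [Finset.sum_sub_distrib, ← Finset.sum_mul, sum_coeff_creation_sqrtMu h1 h2 j v,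
      Finset.sum_mul, ← Finset.sum_sub_distrib, ← Finset.sum_neg_distrib]
    refine Finset.sum_congr rfl fun k _ => ?_
    rw [averagedMatrix_eq_coeff, wcreation, creation_eq_sub_annihil]
    ring
  have e2 : ∀ j, wannihil φ j H v = annihil j H v + φ v * v j * H v := fun j => rfl
  simp only [← Finset.sum_mul, e1, e2]
  simp only [Fin.sum_univ_three]
  rw [averagedMatrix_comm γ 1 0, averagedMatrix_comm γ 2 0, averagedMatrix_comm γ 2 1]
  change _ = (φ v * H v) ^ 2 * _ - _
  ring

theorem integral_weight_commutator {B : ℝ} {ω φ : V → ℝ} (hω : IsWeight B ω φ) {h : V → ℝ}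
    (hh : IsSchwartz fun v => ω v * h v) :
    ∫ v, (ω v * Gam γ sqrtMu h v - Gam γ sqrtMu (fun v => ω v * h v) v) * (ω v * h v) =
      ∫ v, (φ v * (ω v * h v)) ^ 2 * ∑ j, ∑ k, averagedMatrix γ j k v * v k * v j := by
  have hs := isSchwartz_sqrtMu
  have ha := hasTemperateGrowth_averagedMatrix h1 h2
  have hh1 : IsSchwartz fun v => (fun _ => (1 : ℝ)) v * (ω v * h v) := by simpa using hh
  have a1 := integral_mul_Gam_sqrtMu h1 h2 hω hh
  -- The same identity with trivial weight, applied to `ω h`; subtraction cancels the dissipation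
  -- exactly.
  have a2 := integral_mul_Gam_sqrtMu h1 h2 isWeight_one hh1
  have w1 := (hω.isSchwartz_mul_Gam h1 h2 hs hh).mul hh
  have w2 := (isSchwartz_Gam h1 h2 hs hh).mul hh
  have w3 : IsSchwartz fun v => (φ v * (ω v * h v)) ^ 2 *
      ∑ j, ∑ k, averagedMatrix γ j k v * v k * v j := by
    have t : HasTemperateGrowth fun v : V => ∑ j, ∑ k, averagedMatrix γ j k v * v k * v j :=
      HasTemperateGrowth.sum fun j _ => HasTemperateGrowth.sum fun k _ =>
        ((ha j k).mul (hasTemperateGrowth_coord k)).mul (hasTemperateGrowth_coord j)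
    exact (hh.mul_left hω.tg).sq.mul_right t
  have w4 : IsSchwartz fun v => ∑ j, ∑ k, averagedMatrix γ j k v *
      annihil k (fun v => ω v * h v) v * annihil j (fun v => ω v * h v) v :=
    IsSchwartz.sum fun j _ => IsSchwartz.sum fun k _ =>
      ((hh.annihil k).mul_left (ha j k)).mul (hh.annihil j)
  rw [integral_sub w3.integrable w4.integrable] at a1
  simp only [one_mul, zero_mul, zero_pow two_ne_zero, zero_sub, integral_neg] at a2
  simp only [sub_mul]
  rw [integral_sub w1.integrable w2.integrable, a1, a2]
  ring

end

/-- Where the slope is not small, the velocity is bounded. -/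
theorem weightSlope_sq_le {b c₀ : ℝ} (hb : 0 < b) (hb2 : b ≤ 2) (hc : 0 < c₀)
    (h : b < 2 ∨ c₀ ≤ 1 / 16) : ∃ R : ℝ, 1 ≤ R ∧ ∀ t : ℝ, 0 ≤ t → ∀ v : V,
    weightSlope b c₀ t v ^ 2 ≤ 1 / 32 ∨ bracket v ≤ R := by
  have hsq : ∀ t : ℝ, 0 ≤ t → ∀ v : V, 2 * c₀ * bracket v ^ (b - 2) ≤ 1 / 8 →
      weightSlope b c₀ t v ^ 2 ≤ 1 / 32 := by
    intro t ht v hv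
    have h0 := weightSlope_nonneg hb hc ht v
    have h1 := (weightSlope_le hb hb2 hc ht v).trans hv
    nlinarith
  rcases h with h | h
  · have h2b : 0 < 2 - b := by linarith
    -- Chosen so that `2 c₀ R^{b-2} = 1/8`.
    set R := (16 * c₀) ^ (1 / (2 - b)) with hR
    have hR0 : 0 < R := Real.rpow_pos_of_pos (by positivity) _
    have hRb : R ^ (2 - b) = 16 * c₀ := by
      rw [hR, ← Real.rpow_mul (by positivity), one_div_mul_cancel h2b.ne', Real.rpow_one]
    refine ⟨max 1 R, le_max_left _ _, fun t ht v => ?_⟩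
    rcases le_total (bracket v) R with hv | hv
    · exact Or.inr (hv.trans (le_max_right _ _))
    · refine Or.inl (hsq t ht v ?_)
      have h3 : 16 * c₀ ≤ bracket v ^ (2 - b) := hRb ▸ Real.rpow_le_rpow hR0.le hv h2b.le
      rw [show b - 2 = -(2 - b) by ring, Real.rpow_neg (bracket_pos v).le,
        ← div_eq_mul_inv, div_le_iff₀ (Real.rpow_pos_of_pos (bracket_pos v) _)]
      linarith
  · refine ⟨1, le_rfl, fun t ht v => Or.inl (hsq t ht v ?_)⟩
    have := Real.rpow_le_one_of_one_le_of_nonpos (one_le_bracket v) (by linarith : b - 2 ≤ 0)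
    nlinarith

section

variable {γ : ℝ} (h1 : -3 < γ) (h2 : γ < 0)

include h1 h2

theorem averaged_form_nonneg (v : V) (x : Fin 3 → ℝ) :
    0 ≤ ∑ j, ∑ k, averagedMatrix γ j k v * x k * x j := by
  obtain ⟨c, hc, h⟩ := averaged_form_lower h1 h2
  exact (mul_nonneg hc.le (aniso_nonneg γ v x)).trans (h v x)

theorem isSchwartz_sq_mul_form {G : V → ℝ} (hG : IsSchwartz G) : IsSchwartz fun v =>
    G v ^ 2 * ∑ j, ∑ k, averagedMatrix γ j k v * v k * v j :=
  hG.sq.mul_right (HasTemperateGrowth.sum fun j _ => HasTemperateGrowth.sum fun k _ =>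
    ((hasTemperateGrowth_averagedMatrix h1 h2 j k).mul (hasTemperateGrowth_coord k)).mul
      (hasTemperateGrowth_coord j))

theorem integral_sq_mul_form_le {G : V → ℝ} (hG : IsSchwartz G) :
    ∫ v, G v ^ 2 * ∑ j, ∑ k, averagedMatrix γ j k v * v k * v j ≤ 4 * normASq γ G := by
  obtain ⟨hs, he⟩ := normASq_eq_integral h1 h2 hG
  rw [he, ← integral_const_mul]
  refine integral_mono (isSchwartz_sq_mul_form h1 h2 hG).integrable (hs.integrable.const_mul _)
    fun v => ?_
  have := averaged_form_nonneg h1 h2 v fun k => pd k G v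
  change _ ≤ 4 * _
  linarith

/-- The left side is bounded both by the energy of `G`, because the operator is of first order, and
by the zero order energy of its image, hence by the geometric mean. This trades one full top order
norm for a norm of one order less. -/
theorem integral_bracket_sq_le (B : ℝ) : ∃ C, 0 ≤ C ∧ ∀ ω φ : V → ℝ, IsWeight B ω φ →
    ∀ G : V → ℝ, IsSchwartz G → ∀ i : Fin 3,
    ∫ v, bracket v ^ γ * wcreation φ i G v ^ 2 ≤
      C * Real.sqrt (normASq γ G) * Real.sqrt (normASq γ (wcreation φ i G)) := by
  obtain ⟨C, hC, hle⟩ := energy_le_normASq h1 h2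
  set D := 2 + 2 * (1 / 2 + B) ^ 2 with hD
  refine ⟨Real.sqrt (D * C) * Real.sqrt C, by positivity, fun ω φ hω G hG i => ?_⟩
  have hH := hω.isSchwartz_wcreation hG i
  have hX : IsSchwartz fun v => bracket v ^ γ * wcreation φ i G v ^ 2 := hH.bracket_mul_sq γ
  have hb : ∀ v : V, 0 ≤ bracket v ^ γ := fun v => Real.rpow_nonneg (bracket_pos v).le γ
  have hX0 : 0 ≤ ∫ v, bracket v ^ γ * wcreation φ i G v ^ 2 :=
    integral_nonneg fun v => mul_nonneg (hb v) (sq_nonneg _)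
  have b1 : ∫ v, bracket v ^ γ * wcreation φ i G v ^ 2 ≤ C * normASq γ (wcreation φ i G) := by
    refine le_trans (integral_mono hX.integrable (isSchwartz_dens γ hH).integrable fun v => ?_)
      (hle _ hH)
    have a1 := aniso_nonneg γ v fun k => pd k (wcreation φ i G) v
    have a2 : 1 ≤ bracket v ^ 2 := one_le_pow₀ (one_le_bracket v)
    have a3 := mul_nonneg (hb v) (sq_nonneg (wcreation φ i G v))
    simp only [dens]
    nlinarith
  have b2 : ∫ v, bracket v ^ γ * wcreation φ i G v ^ 2 ≤ D * C * normASq γ G := by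
    rw [mul_assoc]
    refine le_trans ?_ (mul_le_mul_of_nonneg_left (hle _ hG) (by positivity))
    rw [← integral_const_mul]
    refine integral_mono hX.integrable ((isSchwartz_dens γ hG).integrable.const_mul _) fun v => ?_
    refine le_trans ?_ (aniso_wcreation_le γ hω.abs_le G v).1
    refine le_trans ?_ (bracket_mul_sum_le_aniso γ v _)
    refine mul_le_mul_of_nonneg_left ?_ (hb v)
    exact Finset.single_le_sum (f := fun k => wcreation φ k G v ^ 2) (fun _ _ => sq_nonneg _)
      (Finset.mem_univ i)
  calc _ = Real.sqrt (∫ v, bracket v ^ γ * wcreation φ i G v ^ 2) *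
        Real.sqrt (∫ v, bracket v ^ γ * wcreation φ i G v ^ 2) := (Real.mul_self_sqrt hX0).symm
    _ ≤ Real.sqrt (D * C * normASq γ G) * Real.sqrt (C * normASq γ (wcreation φ i G)) :=
        mul_le_mul (Real.sqrt_le_sqrt b2) (Real.sqrt_le_sqrt b1) (Real.sqrt_nonneg _)
          (Real.sqrt_nonneg _)
    _ = _ := by
        rw [Real.sqrt_mul (by positivity), Real.sqrt_mul hC.le]
        ring

theorem exists_weight_commutator_le {b c₀ : ℝ} (hb : 0 < b) (hb2 : b ≤ 2) (hc : 0 < c₀)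
    (h : b < 2 ∨ c₀ ≤ 1 / 16) : ∃ C, 0 ≤ C ∧ ∀ t : ℝ, 0 ≤ t → ∀ G : V → ℝ, IsSchwartz G →
    ∀ i : Fin 3, ∫ v, (weightSlope b c₀ t v * wcreation (weightSlope b c₀ t) i G v) ^ 2 *
        (∑ j, ∑ k, averagedMatrix γ j k v * v k * v j) ≤
      1 / 8 * normASq γ (wcreation (weightSlope b c₀ t) i G) +
        C * (Real.sqrt (normASq γ G) *
          Real.sqrt (normASq γ (wcreation (weightSlope b c₀ t) i G))) := by
  obtain ⟨R, hR, hsl⟩ := weightSlope_sq_le hb hb2 hc h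
  obtain ⟨C₁, hC₁, hle₁⟩ := averaged_form_le h1 h2
  obtain ⟨C₂, hC₂, hle₂⟩ := integral_bracket_sq_le h1 h2 (2 * c₀)
  -- On `⟨v⟩ ≤ R`: `φ² ≤ (2c₀)²`, `ā v·v ≤ C₁ R⁴`, and `1 ≤ R³ ⟨v⟩^γ` because `γ > -3`.
  set M := (2 * c₀) ^ 2 * (C₁ * R ^ 4) * R ^ 3 with hM
  have hR0 : 0 < R := by linarith
  refine ⟨M * C₂, by positivity, fun t ht G hG i => ?_⟩
  have hω := isWeight_weight hb hb2 hc ht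
  set φ := weightSlope b c₀ t with hφ
  have hH := hω.isSchwartz_wcreation hG i
  have hpt : ∀ v : V, (φ v * wcreation φ i G v) ^ 2 *
      (∑ j, ∑ k, averagedMatrix γ j k v * v k * v j) ≤
      1 / 32 * (wcreation φ i G v ^ 2 * ∑ j, ∑ k, averagedMatrix γ j k v * v k * v j) +
        M * (bracket v ^ γ * wcreation φ i G v ^ 2) := by
    intro v
    have hS := averaged_form_nonneg h1 h2 v fun k => v k
    have hbv := Real.rpow_nonneg (bracket_pos v).le γ
    have hq := sq_nonneg (wcreation φ i G v)
    have hqS := mul_nonneg hq hS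
    have hbq := mul_nonneg hbv hq
    rw [mul_pow, mul_assoc]
    rcases hsl t ht v with hv | hv
    · exact (mul_le_mul_of_nonneg_right hv hqS).trans (le_add_of_nonneg_right (by positivity))
    · have l1 := hle₁ v fun k => v k
      rw [← norm_sq_eq_sum] at l1
      have l2 : bracket v ^ 2 * ‖v‖ ^ 2 ≤ R ^ 4 := by
        have e := pow_le_pow_left₀ (bracket_pos v).le hv 2
        have e2 : ‖v‖ ^ 2 ≤ R ^ 2 := by
          have := bracket_sq v
          linarith
        calc _ ≤ R ^ 2 * R ^ 2 := mul_le_mul e e2 (sq_nonneg _) (sq_nonneg _)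
          _ = R ^ 4 := by ring
      have l3 : 1 ≤ R ^ 3 * bracket v ^ γ := by
        have e3 : bracket v ^ (-3 : ℝ) ≤ bracket v ^ γ :=
          Real.rpow_le_rpow_of_exponent_le (one_le_bracket v) h1.le
        have e4 : bracket v ^ (3 : ℝ) * bracket v ^ (-3 : ℝ) = 1 := by
          rw [← Real.rpow_add (bracket_pos v)]
          norm_num
        have e5 : bracket v ^ (3 : ℝ) ≤ R ^ 3 := by
          rw [show (3 : ℝ) = ((3 : ℕ) : ℝ) by norm_num, Real.rpow_natCast]
          exact pow_le_pow_left₀ (bracket_pos v).le hv 3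
        rw [← e4]
        exact mul_le_mul e5 e3 (Real.rpow_nonneg (bracket_pos v).le _) (by positivity)
      have l4 : φ v ^ 2 ≤ (2 * c₀) ^ 2 := by
        rw [← sq_abs]
        exact pow_le_pow_left₀ (abs_nonneg _) (hω.abs_le v) 2
      refine le_trans ?_ (le_add_of_nonneg_left (by positivity))
      calc φ v ^ 2 * (wcreation φ i G v ^ 2 * ∑ j, ∑ k, averagedMatrix γ j k v * v k * v j)
          ≤ (2 * c₀) ^ 2 * (wcreation φ i G v ^ 2 * (C₁ * R ^ 4)) := by
            refine mul_le_mul l4 (mul_le_mul_of_nonneg_left ?_ hq) hqS (sq_nonneg _)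
            exact l1.trans (mul_le_mul_of_nonneg_left l2 hC₁)
        _ = (2 * c₀) ^ 2 * (wcreation φ i G v ^ 2 * (C₁ * R ^ 4)) * 1 := (mul_one _).symm
        _ ≤ (2 * c₀) ^ 2 * (wcreation φ i G v ^ 2 * (C₁ * R ^ 4)) * (R ^ 3 * bracket v ^ γ) :=
            mul_le_mul_of_nonneg_left l3 (by positivity)
        _ = _ := by
            rw [hM]
            ring
  have s0 : IsSchwartz fun v => (φ v * wcreation φ i G v) ^ 2 *
      (∑ j, ∑ k, averagedMatrix γ j k v * v k * v j) :=
    isSchwartz_sq_mul_form h1 h2 (hH.mul_left hω.tg)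
  have s1 := isSchwartz_sq_mul_form h1 h2 hH
  have s2 : IsSchwartz fun v => bracket v ^ γ * wcreation φ i G v ^ 2 := hH.bracket_mul_sq γ
  refine (integral_mono s0.integrable
    ((s1.integrable.const_mul (1 / 32)).add (s2.integrable.const_mul M)) hpt).trans ?_
  rw [integral_add' (s1.integrable.const_mul (1 / 32)) (s2.integrable.const_mul M),
    integral_const_mul, integral_const_mul]
  -- The `1/8` of the theorem is `1/32` times the factor `4` found here.
  have f1 := integral_sq_mul_form_le h1 h2 hH
  have f2 := mul_le_mul_of_nonneg_left (hle₂ _ φ hω G hG i) (by positivity : 0 ≤ M)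
  linarith

end

section

variable {γ : ℝ} (h1 : -3 < γ) (h2 : γ < 0)

include h1 h2

theorem exists_leibniz_remainder_le {c₀ : ℝ} (hc : 0 < c₀) : ∃ C, 0 ≤ C ∧
    ∀ b t : ℝ, 0 < b → b ≤ 2 → 0 ≤ t → ∀ (f : V → ℝ) (m : ℕ),
    IsSchwartz (fun v => weight b c₀ t v * f v) →
    ∑ I, |∫ v, (weight b c₀ t v * gradH m (Gam γ sqrtMu f) I v -
        weight b c₀ t v * Gam γ sqrtMu (gradH m f I) v) * wgrad b c₀ t m f I v| ≤
      C * ∑ p ∈ Finset.range m, (m.choose p : ℝ) * Real.sqrt (((m - p + 2).factorial : ℝ) / 2) *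
        normA γ (wgrad b c₀ t p f) * normA γ (wgrad b c₀ t m f) := by
  obtain ⟨C, hC, hbase⟩ := weighted_trilinear h1 h2 (2 * c₀)
  set M := Real.sqrt (∫ v, sqrtMu v ^ 2) with hM
  refine ⟨C * M, mul_nonneg hC.le (Real.sqrt_nonneg _), fun b t hb hb2 ht f m hf => ?_⟩
  have hω := isWeight_weight hb hb2 hc ht
  have key := trilinear_remainder h1 h2 hC.le hω (hbase _ _ hω) isSchwartz_sqrtMu m
    (g := fun _ : Unit => f) (H := fun _ I => wgrad b c₀ t m f I) (fun _ => hf)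
    (fun _ I => isSchwartz_wgrad hb hb2 hc ht hf m I)
  simp only [Finset.univ_unique, Finset.sum_singleton, famNorm_norm0,
    famNorm_wnormA h1 h2 hb hb2 hc ht hf] at key
  refine key.trans ?_
  rw [mul_assoc, mul_assoc]
  refine mul_le_mul_of_nonneg_left ?_ hC.le
  -- Reindexed so that `p` counts the derivatives on `f` instead of those on `√μ`.
  rw [Finset.sum_mul, ← Finset.sum_range_reflect, Finset.mul_sum]
  refine Finset.sum_le_sum fun p hp => ?_
  rw [Finset.mem_range] at hp
  have e1 : m - 1 - p + 1 = m - p := by omega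
  have e2 : m - (m - p) = p := by omega
  rw [e1, e2, Nat.choose_symm hp.le]
  have h3 := norm2_gradH_sqrtMu_le (s := γ / 2) (by linarith) (m - p)
  have h4 : 0 ≤ normA γ (wgrad b c₀ t p f) * normA γ (wgrad b c₀ t m f) :=
    mul_nonneg (Real.sqrt_nonneg _) (Real.sqrt_nonneg _)
  calc _ = (m.choose p : ℝ) * norm2 (γ / 2) (gradH (m - p) sqrtMu) *
        (normA γ (wgrad b c₀ t p f) * normA γ (wgrad b c₀ t m f)) := mul_assoc _ _ _
    _ ≤ (m.choose p : ℝ) * (M * Real.sqrt ((m - p + 2).factorial / 2)) *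
        (normA γ (wgrad b c₀ t p f) * normA γ (wgrad b c₀ t m f)) :=
        mul_le_mul_of_nonneg_right (mul_le_mul_of_nonneg_left h3 (Nat.cast_nonneg _)) h4
    _ = _ := by ring

theorem exists_sum_weight_commutator_le {b c₀ : ℝ} (hb : 0 < b) (hb2 : b ≤ 2) (hc : 0 < c₀)
    (h : b < 2 ∨ c₀ ≤ 1 / 16) : ∃ C, 0 ≤ C ∧ ∀ (t : ℝ) (f : V → ℝ) (m : ℕ), 0 ≤ t →
    IsSchwartz (fun v => weight b c₀ t v * f v) →
    ∑ I, |∫ v, (weight b c₀ t v * Gam γ sqrtMu (gradH (m + 1) f I) v -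
        Gam γ sqrtMu (wgrad b c₀ t (m + 1) f I) v) * wgrad b c₀ t (m + 1) f I v| ≤
      1 / 8 * normA γ (wgrad b c₀ t (m + 1) f) ^ 2 + C * (Real.sqrt 3 *
        normA γ (wgrad b c₀ t m f) * normA γ (wgrad b c₀ t (m + 1) f)) := by
  obtain ⟨C, hC, hle⟩ := exists_weight_commutator_le h1 h2 hb hb2 hc h
  refine ⟨C, hC, fun t f m ht hf => ?_⟩
  have hω := isWeight_weight hb hb2 hc ht
  have hS := fun n I => isSchwartz_wgrad hb hb2 hc ht hf n I
  have hN := fun n I => normASq_nonneg h1 h2 (hS n I)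
  have e0 : ∀ I : Fin (m + 1) → Fin 3, wgrad b c₀ t (m + 1) f I =
      wcreation (weightSlope b c₀ t) (I 0) (wgrad b c₀ t m f (Fin.tail I)) := fun I =>
    hω.mul_creation ((hω.isSchwartz_of_mul (hS m (Fin.tail I))).differentiable) (I 0)
  have hI : ∀ I : Fin (m + 1) → Fin 3,
      |∫ v, (weight b c₀ t v * Gam γ sqrtMu (gradH (m + 1) f I) v -
        Gam γ sqrtMu (wgrad b c₀ t (m + 1) f I) v) * wgrad b c₀ t (m + 1) f I v| ≤
      1 / 8 * normASq γ (wgrad b c₀ t (m + 1) f I) +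
        C * (Real.sqrt (normASq γ (wgrad b c₀ t m f (Fin.tail I))) *
          Real.sqrt (normASq γ (wgrad b c₀ t (m + 1) f I))) := by
    intro I
    have e1 := integral_weight_commutator h1 h2 hω (hS (m + 1) I)
    have e2 := hle t ht _ (hS m (Fin.tail I)) (I 0)
    rw [← e0] at e2
    refine le_trans (le_of_eq ?_) e2
    refine (congrArg abs e1).trans (abs_of_nonneg ?_)
    exact integral_nonneg fun v => mul_nonneg (sq_nonneg _)
      (averaged_form_nonneg h1 h2 v fun k => v k)
  refine (Finset.sum_le_sum fun I _ => hI I).trans ?_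
  rw [Finset.sum_add_distrib, ← Finset.mul_sum, ← Finset.mul_sum, normA,
    Real.sq_sqrt (Finset.sum_nonneg fun I _ => hN _ I)]
  refine add_le_add_right (mul_le_mul_of_nonneg_left ?_ hC) _
  refine (Real.sum_mul_le_sqrt_mul_sqrt _ _ _).trans (le_of_eq ?_)
  simp only [Real.sq_sqrt (hN _ _)]
  -- Each component of order `m` is the tail of three multi-indices, which produces `√3`.
  rw [sum_multiIndex_cons m fun I => normASq γ (wgrad b c₀ t m f (Fin.tail I))]
  simp only [Fin.tail_cons, Finset.sum_const, Finset.card_univ, Fintype.card_fin, nsmul_eq_mul]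
  rw [← Finset.mul_sum, Real.sqrt_mul (by norm_num)]
  norm_num [normA]

theorem exists_pairing_commL1_le {b c₀ : ℝ} (hb : 0 < b) (hb2 : b ≤ 2) (hc : 0 < c₀)
    (h : b < 2 ∨ c₀ ≤ 1 / 16) : ∃ C, 0 < C ∧ ∀ (m : ℕ) (t : ℝ) (f : V → ℝ), 1 ≤ m → 0 ≤ t →
    IsSchwartz (fun v => weight b c₀ t v * f v) →
    PairingConverges (commL1 γ b c₀ t m f) (wgrad b c₀ t m f) ∧
    |pairing (commL1 γ b c₀ t m f) (wgrad b c₀ t m f)| ≤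
      1 / 8 * normA γ (wgrad b c₀ t m f) ^ 2 +
      C * ∑ p ∈ Finset.range m, (m.choose p : ℝ) * Real.sqrt (((m - p + 2).factorial : ℝ) / 2) *
        normA γ (wgrad b c₀ t p f) * normA γ (wgrad b c₀ t m f) := by
  obtain ⟨C₁, hC₁, hle₁⟩ := exists_leibniz_remainder_le h1 h2 hc
  obtain ⟨C₂, hC₂, hle₂⟩ := exists_sum_weight_commutator_le h1 h2 hb hb2 hc h
  refine ⟨C₁ + C₂ + 1, by positivity, fun m t f hm ht hf => ?_⟩
  obtain ⟨m, rfl⟩ := Nat.exists_eq_add_of_le' hm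
  have hω := isWeight_weight hb hb2 hc ht
  have hs := isSchwartz_sqrtMu
  have hS := fun I => isSchwartz_wgrad hb hb2 hc ht hf (m + 1) I
  have w1 := fun I => hω.isSchwartz_mul_gradH (hω.isSchwartz_mul_Gam h1 h2 hs hf) (m + 1) I
  have w2 := fun I => hω.isSchwartz_mul_Gam h1 h2 hs (hS I)
  have w3 := fun I => isSchwartz_Gam h1 h2 hs (hS I)
  have i1 := fun I => (((w1 I).sub (w2 I)).mul (hS I)).integrable
  have i2 := fun I => (((w2 I).sub (w3 I)).mul (hS I)).integrable
  -- Insert `ω Γ(√μ, ∇^{m+1} f)` between the two terms: the first difference is the Leibniz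
  -- remainder, the second the commutator with the weight.
  have e : ∀ I v, commL1 γ b c₀ t (m + 1) f I v * wgrad b c₀ t (m + 1) f I v =
      -((weight b c₀ t v * gradH (m + 1) (Gam γ sqrtMu f) I v -
        weight b c₀ t v * Gam γ sqrtMu (gradH (m + 1) f I) v) * wgrad b c₀ t (m + 1) f I v +
      (weight b c₀ t v * Gam γ sqrtMu (gradH (m + 1) f I) v -
        Gam γ sqrtMu (wgrad b c₀ t (m + 1) f I) v) * wgrad b c₀ t (m + 1) f I v) := by
    intro I v
    have : gradH (m + 1) (opL1 γ f) I v = -gradH (m + 1) (Gam γ sqrtMu f) I v :=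
      congrFun (gradH_neg (m + 1) (Gam γ sqrtMu f) I) v
    rw [commL1, wgrad, this, opL1]
    ring
  refine ⟨fun I => ((i1 I).add (i2 I)).neg.congr (ae_of_all _ fun v => (e I v).symm), ?_⟩
  have hb1 := hle₁ b t hb hb2 ht f (m + 1) hf
  have hb2' := hle₂ t f m ht hf
  set S := ∑ p ∈ Finset.range (m + 1), ((m + 1).choose p : ℝ) *
    Real.sqrt (((m + 1 - p + 2).factorial : ℝ) / 2) *
    normA γ (wgrad b c₀ t p f) * normA γ (wgrad b c₀ t (m + 1) f) with hSd
  have hterm : ∀ p ∈ Finset.range (m + 1), 0 ≤ ((m + 1).choose p : ℝ) *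
      Real.sqrt (((m + 1 - p + 2).factorial : ℝ) / 2) *
      normA γ (wgrad b c₀ t p f) * normA γ (wgrad b c₀ t (m + 1) f) := fun p _ => by
    unfold normA
    positivity
  have hS0 : 0 ≤ S := Finset.sum_nonneg hterm
  -- The weight commutator matches the last summand, whose factorial factor is `√(3!/2) = √3` and
  -- whose binomial coefficient is at least one.
  have hlast : Real.sqrt 3 * normA γ (wgrad b c₀ t m f) * normA γ (wgrad b c₀ t (m + 1) f) ≤ S := by
    refine le_trans ?_ (Finset.single_le_sum hterm (Finset.self_mem_range_succ m))
    have e3 : m + 1 - m + 2 = 3 := by omega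
    have e4 : (((3 : ℕ).factorial : ℝ) / 2) = 3 := by norm_num [Nat.factorial]
    rw [e3, e4, Nat.choose_succ_self_right]
    have h0 : 0 ≤ Real.sqrt 3 * normA γ (wgrad b c₀ t m f) * normA γ (wgrad b c₀ t (m + 1) f) := by
      unfold normA
      positivity
    push_cast
    nlinarith [mul_nonneg (Nat.cast_nonneg (α := ℝ) m) h0]
  calc |pairing (commL1 γ b c₀ t (m + 1) f) (wgrad b c₀ t (m + 1) f)|
      ≤ ∑ I, |∫ v, commL1 γ b c₀ t (m + 1) f I v * wgrad b c₀ t (m + 1) f I v| :=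
        abs_pairing_le _ _
    _ ≤ (∑ I, |∫ v, (weight b c₀ t v * gradH (m + 1) (Gam γ sqrtMu f) I v -
          weight b c₀ t v * Gam γ sqrtMu (gradH (m + 1) f I) v) * wgrad b c₀ t (m + 1) f I v|) +
        ∑ I, |∫ v, (weight b c₀ t v * Gam γ sqrtMu (gradH (m + 1) f I) v -
          Gam γ sqrtMu (wgrad b c₀ t (m + 1) f I) v) * wgrad b c₀ t (m + 1) f I v| := by
        rw [← Finset.sum_add_distrib]
        refine Finset.sum_le_sum fun I _ => ?_
        simp only [e, integral_neg, abs_neg]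
        rw [integral_add (i1 I) (i2 I)]
        exact abs_add_le _ _
    _ ≤ _ := by
        have := mul_le_mul_of_nonneg_left hlast hC₂
        linarith

end

end Landau

/-! ### Choice of the constants -/

theorem proposition2p3 (γ : ℝ) (hγ : -3 < γ) (hγ' : γ < 0) :
    ∃ κ : ℝ, 0 < κ ∧ ∀ b c₀ : ℝ, 0 < b → b ≤ 2 → 0 < c₀ →
      ∃ C₄ C₅ C₆ C₇ : ℝ, 0 < C₄ ∧ 0 < C₅ ∧ 0 < C₆ ∧ 0 < C₇ ∧
        ∀ (m : ℕ) (t : ℝ) (f : Landau.V → ℝ), 1 ≤ m → 0 ≤ t → Landau.Suitable b c₀ t f →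
          (Landau.PairingConverges (Landau.wgrad b c₀ t m (Landau.Gam γ f f))
              (Landau.wgrad b c₀ t m f) ∧
            |Landau.pairing (Landau.wgrad b c₀ t m (Landau.Gam γ f f))
                (Landau.wgrad b c₀ t m f)| ≤
              C₄ * ∑ p ∈ Finset.range (m + 1), (m.choose p : ℝ) *
                Landau.norm2 (γ / 2) (Landau.gradH p f) *
                Landau.normA γ (Landau.wgrad b c₀ t (m - p) f) *
                Landau.normA γ (Landau.wgrad b c₀ t m f)) ∧
          (b < 2 ∨ c₀ < 1 / 4 →
            Landau.PairingConverges (Landau.wgrad b c₀ t m (Landau.opL2 γ f))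
              (Landau.wgrad b c₀ t m f) ∧
            |Landau.pairing (Landau.wgrad b c₀ t m (Landau.opL2 γ f))
                (Landau.wgrad b c₀ t m f)| ≤
              C₆ * ∑ p ∈ Finset.range (m + 1), (m.choose p : ℝ) *
                Real.sqrt C₅ ^ (m - p) * Real.sqrt ((m - p + 3).factorial : ℝ) *
                Landau.norm2 (γ / 2) (Landau.gradH p f) *
                Landau.normA γ (Landau.wgrad b c₀ t m f)) ∧
          (b < 2 ∨ c₀ ≤ κ →
            Landau.PairingConverges (Landau.commL1 γ b c₀ t m f)
              (Landau.wgrad b c₀ t m f) ∧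
            |Landau.pairing (Landau.commL1 γ b c₀ t m f) (Landau.wgrad b c₀ t m f)| ≤
              1 / 8 * Landau.normA γ (Landau.wgrad b c₀ t m f) ^ 2 +
              C₇ * ∑ p ∈ Finset.range m, (m.choose p : ℝ) *
                Real.sqrt (((m - p + 2).factorial : ℝ) / 2) *
                Landau.normA γ (Landau.wgrad b c₀ t p f) *
                Landau.normA γ (Landau.wgrad b c₀ t m f) +
              C₇ * ∑ p ∈ Finset.Icc 1 m, (m.choose p : ℝ) * (p : ℝ) *
                Real.sqrt (((m - p + 2).factorial : ℝ) / 2) *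
                Landau.normA γ (Landau.wgrad b c₀ t (p - 1) f) *
                Landau.normA γ (Landau.wgrad b c₀ t m f)) := by
  -- With `c₀ ≤ 1/16` the slope of the weight is at most `1/8` everywhere, even when `b = 2`.
  refine ⟨1 / 16, by norm_num, fun b c₀ hb hb2 hc => ?_⟩
  obtain ⟨C₄, h4, H1⟩ := Landau.pairing_Gam_le hγ hγ' hc
  have H2 : ∃ C₅ C₆ : ℝ, 0 < C₅ ∧ 0 < C₆ ∧ (b < 2 ∨ c₀ < 1 / 4 →
      ∀ (m : ℕ) (t : ℝ) (f : Landau.V → ℝ), 0 ≤ t →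
      Landau.IsSchwartz (fun v => Landau.weight b c₀ t v * f v) →
      Landau.PairingConverges (Landau.wgrad b c₀ t m (Landau.opL2 γ f))
        (Landau.wgrad b c₀ t m f) ∧
      |Landau.pairing (Landau.wgrad b c₀ t m (Landau.opL2 γ f)) (Landau.wgrad b c₀ t m f)| ≤
        C₆ * ∑ p ∈ Finset.range (m + 1), (m.choose p : ℝ) * Real.sqrt C₅ ^ (m - p) *
          Real.sqrt ((m - p + 3).factorial : ℝ) * Landau.norm2 (γ / 2) (Landau.gradH p f) *
          Landau.normA γ (Landau.wgrad b c₀ t m f)) := by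
    by_cases h : b < 2 ∨ c₀ < 1 / 4
    · obtain ⟨C₅, C₆, h5, h6, H⟩ := Landau.exists_pairing_opL2_le hγ hγ' hb hb2 hc h
      exact ⟨C₅, C₆, h5, h6, fun _ => H⟩
    -- The constants must exist before the condition on `b` and `c₀` is known; when it fails, any
    -- positive values serve.
    · exact ⟨1, 1, one_pos, one_pos, fun h' => absurd h' h⟩
  have H3 : ∃ C₇ : ℝ, 0 < C₇ ∧ (b < 2 ∨ c₀ ≤ 1 / 16 →
      ∀ (m : ℕ) (t : ℝ) (f : Landau.V → ℝ), 1 ≤ m → 0 ≤ t →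
      Landau.IsSchwartz (fun v => Landau.weight b c₀ t v * f v) →
      Landau.PairingConverges (Landau.commL1 γ b c₀ t m f) (Landau.wgrad b c₀ t m f) ∧
      |Landau.pairing (Landau.commL1 γ b c₀ t m f) (Landau.wgrad b c₀ t m f)| ≤
        1 / 8 * Landau.normA γ (Landau.wgrad b c₀ t m f) ^ 2 +
        C₇ * ∑ p ∈ Finset.range m, (m.choose p : ℝ) *
          Real.sqrt (((m - p + 2).factorial : ℝ) / 2) *
          Landau.normA γ (Landau.wgrad b c₀ t p f) *
          Landau.normA γ (Landau.wgrad b c₀ t m f)) := by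
    by_cases h : b < 2 ∨ c₀ ≤ 1 / 16
    · obtain ⟨C₇, h7, H⟩ := Landau.exists_pairing_commL1_le hγ hγ' hb hb2 hc h
      exact ⟨C₇, h7, fun _ => H⟩
    · exact ⟨1, one_pos, fun h' => absurd h' h⟩
  obtain ⟨C₅, C₆, h5, h6, H2⟩ := H2
  obtain ⟨C₇, h7, H3⟩ := H3
  refine ⟨C₄, C₅, C₆, C₇, h4, h5, h6, h7, fun m t f hm ht hf => ?_⟩
  have hs := hf.isSchwartz
  refine ⟨H1 b t hb hb2 ht f f f
    ((Landau.isWeight_weight hb hb2 hc ht).isSchwartz_of_mul hs) hs hs m,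
    fun h => H2 h m t f ht hs, fun h => ?_⟩
  obtain ⟨p1, p2⟩ := H3 h m t f hm ht hs
  -- The first two terms already bound the commutator; the last sum is nonnegative and is simply
  -- added.
  refine ⟨p1, p2.trans (le_add_of_nonneg_right (mul_nonneg h7.le (Finset.sum_nonneg fun p _ => ?_)))⟩
  unfold Landau.normA
  positivity
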